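/- \textbf{Setting.} Let $d\ge 1$ and let $a=(a_{ij})_{0\le j\le i\le d}$ be unknowns, with $a_{ij}=a_{ji}$; put $\Phi_a(x,y)=\sum_{i,j=0}^{d}a_{ij}x^iy^j$. For a graph $H$ on $[n]=\{1,\dots,n\}$ let $W(H)\subseteq\mathbb C^{(d+1)(d+2)/2+n}$ be the common zero set of the polynomials $\Phi_a(x_v,x_w)$, $vw$ an edge of $H$, in the unknowns $a,x_1,\dots,x_n$; let $Z(H)\subseteq W(H)$ be the subset where $x_v=x_w$ for some $v\ne w$; let $U(H)$ be the Zariski closure of $W(H)\setminus Z(H)$, $\mathcal I(H)$ the ideal of $U(H)$, and $\mathcal I_a(H)=\mathcal I(H)\cap\mathbb C[a]$ the \emph{characteristic ideal} of $H$. For complete graphs $H=K_n$ we take $d=n-1$. For $K_n$ let $\mathcal J_n\subseteq\mathbb C[a,s_1,\dots,s_n]$ be the ideal of all $F(a,s)$ such that $F(a,e_1(x),\dots,e_n(x))\in\mathcal I(K_n)$, where $e_k$ is the $k$-th elementary symmetric polynomial of $x_1,\dots,x_n$. An ideal $J\subseteq\mathbb C[a,s_1,\dots,s_n]$ is said to have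 \emph{free top variable} $s_n$ if $J\cap\mathbb C[a,s_n]$ is generated by $J\cap\mathbb C[a]$ and $\dim\mathbb C[a,s_1,\dots,s_n]/J=\dim\mathbb C[a]/(J\cap\mathbb C[a])+1$ (Krull dimensions). For $c\in\mathbb C^{(d+1)(d+2)/2}$ such that $\Phi_c$ has partial degree exactly $d$, $G(\Phi_c)$ is the graph with vertex set $\mathbb C$ in which $u,v$ are adjacent if $\Phi_c(u,v)=0$; a vertex $u$ is singular if $\Phi_c(u,u)=0$ (a loop), or $\Phi_c(u,y)$ has a multiple root (a multiple arc), or $\Phi_c(u,y)$ has degree less than $d$ (a defective vertex); $G(\Phi_c)^*$ consists of the connected components of $G(\Phi_c)$ without singular vertices. \textbf{Statement.} (1) $\mathcal I_a(K_3)$ is generated by \[ a_{00}\,a_{22} + a_{20}\,a_{11} - a_{20}^2 - a_{21}\,a_{10} .\] $\mathcal I_a(K_4)$ is generated by the 6 polynomials \[ a_{11}\,a_{33} - a_{32}\,a_{21} + a_{32}\,a_{30} - a_{31}^2 + a_{31}\,a_{22} - a_{33}\,a_{20} ,\] \[ a_{10}\,a_{33} - a_{32}\,a_{20} - a_{30}\,a_{31}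 + a_{30}\,a_{22} ,\] \[ a_{10}\,a_{21}\,a_{32} - a_{10}\,a_{31}\,a_{22} - a_{10}\,a_{32}\,a_{30} + a_{10}\,a_{31}^2 - a_{11}\,a_{32}\,a_{20} + a_{11}\,a_{30}\,a_{22} - a_{11}\,a_{30}\,a_{31} + a_{32}\,a_{20}^2 - a_{20}\,a_{30}\,a_{22} + a_{20}\,a_{30}\,a_{31} ,\] \[ a_{00}\,a_{33} - a_{31}\,a_{20} + a_{30}\,a_{21} - a_{30}^2 ,\] \[ a_{00}\,a_{32} - a_{31}\,a_{10} + a_{30}\,a_{11} - a_{30}\,a_{20} ,\] \[ a_{00}\,a_{22} - a_{10}\,a_{21} + a_{10}\,a_{30} - a_{20}^2 + a_{20}\,a_{11} - a_{31}\,a_{00} .\] $\mathcal I_a(K_5)$ is generated by the 22 polynomials \[ a_{22}\,a_{44} - a_{44}\,a_{31} + a_{41}\,a_{43} - a_{43}\,a_{32} - a_{42}^2 + a_{42}\,a_{33} ,\] \[ a_{21}\,a_{44} - a_{44}\,a_{30} + a_{43}\,a_{40} - a_{43}\,a_{31} - a_{41}\,a_{42} + a_{41}\,a_{33} ,\] \[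 a_{21}\,a_{32}\,a_{43} + a_{43}\,a_{41}\,a_{30} - a_{30}\,a_{43}\,a_{32} - a_{30}\,a_{42}^2 + a_{30}\,a_{42}\,a_{33} - a_{43}\,a_{40}\,a_{31} + a_{43}\,a_{31}^2 + a_{31}\,a_{41}\,a_{42} - a_{31}\,a_{41}\,a_{33} - a_{21}\,a_{41}\,a_{43} + a_{21}\,a_{42}^2 - a_{21}\,a_{42}\,a_{33} + a_{22}\,a_{43}\,a_{40} - a_{22}\,a_{43}\,a_{31} - a_{22}\,a_{41}\,a_{42} + a_{22}\,a_{41}\,a_{33} ,\] \[ a_{20}\,a_{44} - a_{43}\,a_{30} - a_{42}\,a_{40} + a_{40}\,a_{33} ,\] \[ a_{20}\,a_{32}\,a_{43} - a_{42}\,a_{33}\,a_{20} - a_{41}\,a_{43}\,a_{20} + a_{42}^2\,a_{20} - a_{22}\,a_{43}\,a_{30} + a_{22}\,a_{40}\,a_{33} - a_{42}\,a_{40}\,a_{22} + a_{31}\,a_{43}\,a_{30} - a_{31}\,a_{40}\,a_{33} + a_{42}\,a_{40}\,a_{31} ,\] \[ a_{20}\,a_{31}\,a_{43} - a_{41}\,a_{33}\,a_{20}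 + a_{41}\,a_{42}\,a_{20} - a_{21}\,a_{43}\,a_{30} + a_{21}\,a_{40}\,a_{33} + a_{43}\,a_{30}^2 - a_{30}\,a_{40}\,a_{33} + a_{40}\,a_{42}\,a_{30} - a_{40}\,a_{42}\,a_{21} - a_{40}\,a_{43}\,a_{20} ,\] \[ a_{20}\,a_{31}\,a_{42} + a_{22}\,a_{41}\,a_{30} - a_{42}\,a_{30}\,a_{21} - a_{32}\,a_{41}\,a_{20} - a_{31}\,a_{41}\,a_{30} + a_{41}^2\,a_{20} + a_{42}\,a_{30}^2 - a_{40}\,a_{32}\,a_{30} + a_{40}\,a_{32}\,a_{21} + a_{40}\,a_{31}^2 - a_{22}\,a_{40}\,a_{31} - a_{40}\,a_{42}\,a_{20} - a_{40}^2\,a_{31} + a_{40}^2\,a_{22} + a_{40}\,a_{41}\,a_{30} - a_{40}\,a_{41}\,a_{21} ,\] \[ a_{11}\,a_{44} - a_{43}\,a_{30} - a_{42}\,a_{31} - a_{41}^2 + a_{41}\,a_{32} + a_{40}\,a_{33} ,\] \[ a_{11}\,a_{43} - a_{41}\,a_{31} + a_{41}\,a_{22} + a_{42}\,a_{30} - a_{42}\,a_{21}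 - a_{43}\,a_{20} ,\] \[ a_{11}\,a_{33} + a_{32}\,a_{30} - a_{32}\,a_{21} - a_{31}^2 + a_{31}\,a_{22} - a_{42}\,a_{11} - a_{33}\,a_{20} + a_{42}\,a_{20} + a_{40}\,a_{31} - a_{40}\,a_{22} - a_{41}\,a_{30} + a_{41}\,a_{21} ,\] \[ a_{10}\,a_{44} - a_{42}\,a_{30} + a_{40}\,a_{32} - a_{41}\,a_{40} ,\] \[ a_{10}\,a_{43} - a_{42}\,a_{20} + a_{40}\,a_{22} - a_{40}\,a_{31} ,\] \[ a_{10}\,a_{33} + a_{41}\,a_{20} - a_{10}\,a_{42} - a_{32}\,a_{20} - a_{30}\,a_{31} + a_{30}\,a_{22} ,\] \[ a_{10}\,a_{31}\,a_{42} - a_{32}\,a_{41}\,a_{10} - a_{40}\,a_{10}\,a_{42} + a_{41}^2\,a_{10} - a_{30}\,a_{42}\,a_{11} + a_{32}\,a_{40}\,a_{11} - a_{41}\,a_{40}\,a_{11} + a_{30}\,a_{42}\,a_{20} - a_{40}\,a_{32}\,a_{20} + a_{40}\,a_{41}\,a_{20} ,\] \[ a_{10}\,a_{21}\,a_{42} -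 a_{22}\,a_{41}\,a_{10} - a_{30}\,a_{10}\,a_{42} + a_{31}\,a_{41}\,a_{10} - a_{20}\,a_{42}\,a_{11} + a_{22}\,a_{40}\,a_{11} - a_{31}\,a_{40}\,a_{11} + a_{42}\,a_{20}^2 - a_{20}\,a_{40}\,a_{22} + a_{20}\,a_{40}\,a_{31} ,\] \[ a_{10}\,a_{21}\,a_{32} - a_{10}\,a_{40}\,a_{31} + a_{22}\,a_{40}\,a_{10} + a_{11}\,a_{41}\,a_{20} - a_{11}\,a_{32}\,a_{20} - a_{11}\,a_{30}\,a_{31} + a_{11}\,a_{30}\,a_{22} - a_{20}\,a_{30}\,a_{22} - a_{10}\,a_{31}\,a_{22} - a_{10}\,a_{32}\,a_{30} - a_{21}\,a_{41}\,a_{10} - a_{41}\,a_{20}^2 + a_{10}\,a_{31}^2 + a_{32}\,a_{20}^2 + a_{30}\,a_{41}\,a_{10} + a_{20}\,a_{30}\,a_{31} ,\] \[ a_{00}\,a_{44} - a_{41}\,a_{30} + a_{40}\,a_{31} - a_{40}^2 ,\] \[ a_{00}\,a_{43} - a_{41}\,a_{20} - a_{40}\,a_{30} + a_{40}\,a_{21}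 ,\] \[ a_{00}\,a_{42} - a_{40}\,a_{20} - a_{41}\,a_{10} + a_{40}\,a_{11} ,\] \[ a_{00}\,a_{33} - a_{41}\,a_{10} - a_{30}^2 + a_{30}\,a_{21} + a_{40}\,a_{11} - a_{31}\,a_{20} ,\] \[ a_{00}\,a_{32} - a_{31}\,a_{10} + a_{40}\,a_{10} - a_{00}\,a_{41} - a_{30}\,a_{20} + a_{30}\,a_{11} ,\] \[ a_{00}\,a_{22} - a_{10}\,a_{21} + a_{10}\,a_{30} - a_{20}^2 + a_{20}\,a_{11} - a_{31}\,a_{00} .\] (2) For $K_6$ and polynomials $\Phi_a$ with $a_{54}=0$ (the other 20 coefficients being unknowns), the characteristic ideal, defined in the same way in the polynomial ring in these 20 unknowns, has a reduced Gröbner basis with exactly 48 elements for the lexicographic order with $a_{00}>a_{10}>a_{11}>a_{20}>\dots>a_{55}$; these 48 polynomials generate it. (3) Consider the following systems $S_n(t)$ with a placeholder $t$. $S_3(t)$: \[ a_{00} - a_{20}\,s_2 + a_{21}\,t ,\] \[ a_{10} + a_{20}\,s_1 + a_{22}\,t ,\] \[ a_{11} - a_{20} + a_{21}\,s_1 + a_{22}\,s_2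 .\] $S_4(t)$: \[ a_{00} + a_{30}\,s_3 + a_{31}\,t ,\] \[ a_{10} - a_{30}\,s_2 + a_{32}\,t ,\] \[ a_{11} + a_{30}\,s_1 - a_{31}\,s_2 - a_{32}\,s_3 + a_{33}\,t ,\] \[ a_{21} - a_{30} + a_{31}\,s_1 - a_{33}\,s_3 ,\] \[ a_{22} - a_{31} + a_{32}\,s_1 + a_{33}\,s_2 ,\] \[ a_{20} + a_{30}\,s_1 + a_{33}\,t .\] $S_5(t)$: \[ a_{00} - a_{40}\,s_4 + a_{41}\,t ,\] \[ a_{10} + a_{40}\,s_3 + a_{42}\,t ,\] \[ a_{11} - a_{40}\,s_2 + a_{41}\,s_3 + a_{42}\,s_4 + a_{43}\,t ,\] \[ a_{20} - a_{40}\,s_2 + a_{43}\,t ,\] \[ a_{21} + a_{44}\,t + a_{40}\,s_1 - a_{41}\,s_2 + a_{43}\,s_4 ,\] \[ a_{22} + a_{44}\,s_4 - a_{40} + a_{41}\,s_1 - a_{42}\,s_2 - a_{43}\,s_3 ,\] \[ a_{30} + a_{44}\,t + a_{40}\,s_1 ,\] \[ a_{31} + a_{44}\,s_4 - a_{40} +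 a_{41}\,s_1 ,\] \[ a_{32} - a_{44}\,s_3 - a_{41} + a_{42}\,s_1 ,\] \[ a_{33} + a_{44}\,s_2 - a_{42} + a_{43}\,s_1 .\] $S_6(t)$: \[ a_{00} + a_{50}\,s_5 + a_{51}\,t ,\] \[ a_{10} - a_{50}\,s_4 + a_{52}\,t ,\] \[ a_{11} + a_{50}\,s_3 - a_{51}\,s_4 - a_{52}\,s_5 + a_{53}\,t ,\] \[ a_{20} + a_{50}\,s_3 + a_{53}\,t ,\] \[ a_{21} - a_{50}\,s_2 + a_{51}\,s_3 - a_{53}\,s_5 + a_{54}\,t ,\] \[ a_{22} + a_{50}\,s_1 - a_{51}\,s_2 + a_{52}\,s_3 + a_{53}\,s_4 - a_{54}\,s_5 + a_{55}\,t ,\] \[ a_{30} - a_{50}\,s_2 + a_{54}\,t ,\] \[ a_{31} + a_{50}\,s_1 - a_{51}\,s_2 - a_{54}\,s_5 + a_{55}\,t ,\] \[ a_{32} - a_{50} + a_{51}\,s_1 - a_{52}\,s_2 + a_{54}\,s_4 - a_{55}\,s_5 ,\] \[ a_{33} - a_{51} + a_{52}\,s_1 - a_{53}\,s_2 - a_{54}\,s_3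 + a_{55}\,s_4 ,\] \[ a_{40} + a_{50}\,s_1 + a_{55}\,t ,\] \[ a_{41} - a_{50} + a_{51}\,s_1 - a_{55}\,s_5 ,\] \[ a_{42} - a_{51} + a_{52}\,s_1 + a_{55}\,s_4 ,\] \[ a_{43} - a_{52} + a_{53}\,s_1 - a_{55}\,s_3 ,\] \[ a_{44} - a_{53} + a_{54}\,s_1 + a_{55}\,s_2 .\] For $n=3,4,5,6$: (a) $\mathcal J_n$ is generated by $S_n((-1)^n s_n)$, $\mathcal J_n\cap\mathbb C[a]=\mathcal I_a(K_n)$, and $\mathcal J_n$ has free top variable $s_n$. (b) The reduced system, $S_n(-1+s_1)$ for $n=3,5$ and $S_n(s_1)$ for $n=4,6$ (that is, the system normalized by $s_n=1-s_1$, resp. $s_n=s_1$), does not involve the top elementary symmetric function $s_n$; the ideal it generates in $\mathbb C[a,s_1,\dots,s_n]$ meets $\mathbb C[a]$ exactly in $\mathcal I_a(K_n)$ and has free top variable $s_n$. (4) The conjecture holds for $K_3,K_4,K_5,K_6$: for $n=3,4,5,6$ and every symmetric polynomial $\Phi$ of partial degree $n-1$, if some component of $G(\Phi)^*$ is isomorphic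 to $K_n$, then all components of $G(\Phi)^*$ are isomorphic to $K_n$. -/

import Mathlib

open MvPolynomial

noncomputable section

namespace PolyGraph

/-! ### Symmetric polynomials of partial degree `d` in two variables -/

/-- Index set of the coefficients `a_{ij}`, `0 ≤ j ≤ i ≤ d`, ordered lexicographically
(`00 < 10 < 11 < 20 < ⋯ < dd`). -/
abbrev CoeffIdx (d : ℕ) : Type :=
  {p : Fin (d + 1) ×ₗ Fin (d + 1) // (ofLex p).2 ≤ (ofLex p).1}

/-- The index of `a_{ij} = a_{ji}`. -/
def idx {d : ℕ} (i j : Fin (d + 1)) : CoeffIdx d :=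
  ⟨toLex (max i j, min i j), min_le_max⟩

/-- `Φ_A(x_v, x_w) = ∑_{i,j=0}^d A_{ij} x_v^i x_w^j`, where the coefficients `A_{ij} = A_{ji}` are
polynomials in parameters indexed by `τ`. -/
def phi {d n : ℕ} {τ : Type} (A : CoeffIdx d → MvPolynomial τ ℂ) (v w : Fin n) :
    MvPolynomial (τ ⊕ Fin n) ℂ :=
  ∑ i : Fin (d + 1), ∑ j : Fin (d + 1),
    rename Sum.inl (A (idx i j)) * X (Sum.inr v) ^ (i : ℕ) * X (Sum.inr w) ^ (j : ℕ)

/-- All coefficients are independent unknowns. -/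
def genericCoeff (d : ℕ) : CoeffIdx d → MvPolynomial (CoeffIdx d) ℂ := X

/-- All coefficients are independent unknowns, except that `a_{v₀} = 0`. -/
def reducedCoeff (d : ℕ) (v₀ : CoeffIdx d) :
    CoeffIdx d → MvPolynomial {v : CoeffIdx d // v ≠ v₀} ℂ :=
  fun v => if h : v = v₀ then 0 else X ⟨v, h⟩

/-! ### The characteristic ideal of a graph -/

section Ideals

variable {d n : ℕ} {τ : Type} (A : CoeffIdx d → MvPolynomial τ ℂ) (H : SimpleGraph (Fin n))

/-- The system `S(H)`. -/
def systemS : Set (MvPolynomial (τ ⊕ Fin n) ℂ) :=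
  {f | ∃ v w, H.Adj v w ∧ f = phi A v w}

/-- The variety `W(H)`. -/
def varietyW : Set (τ ⊕ Fin n → ℂ) := zeroLocus ℂ (Ideal.span (systemS A H))

/-- The part `Z(H)` of `W(H)` on which two of the `x_v` coincide. -/
def varietyZ : Set (τ ⊕ Fin n → ℂ) :=
  {p | p ∈ varietyW A H ∧ ∃ v w, v ≠ w ∧ p (Sum.inr v) = p (Sum.inr w)}

/-- The variety `U(H)`: the Zariski closure of `W(H) \ Z(H)`. -/
def varietyU : Set (τ ⊕ Fin n → ℂ) :=
  zeroLocus ℂ (vanishingIdeal ℂ (varietyW A H \ varietyZ A H))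

/-- The ideal `𝓘(H)` of `U(H)`. -/
def graphIdeal : Ideal (MvPolynomial (τ ⊕ Fin n) ℂ) := vanishingIdeal ℂ (varietyU A H)

/-- The characteristic ideal: the polynomials of `𝓘(H)` in the coefficient unknowns alone. -/
def charIdeal : Ideal (MvPolynomial τ ℂ) := (graphIdeal A H).comap (rename Sum.inl)

end Ideals

/-- The characteristic ideal of the complete graph `K_{d+1}` (all coefficients unknown). -/
def charIdealK (d : ℕ) : Ideal (MvPolynomial (CoeffIdx d) ℂ) :=
  charIdeal (genericCoeff d) (⊤ : SimpleGraph (Fin (d + 1)))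

/-- The characteristic ideal of `K_{d+1}` for the polynomials with `a_{v₀} = 0`, an ideal in the
polynomial ring in the remaining coefficients. -/
def charIdealKReduced (d : ℕ) (v₀ : CoeffIdx d) :
    Ideal (MvPolynomial {v : CoeffIdx d // v ≠ v₀} ℂ) :=
  charIdeal (reducedCoeff d v₀) (⊤ : SimpleGraph (Fin (d + 1)))

/-! ### Reduced Gröbner bases -/

/-- `G` is the reduced Gröbner basis of `I` for the monomial order `m`. In the field `degree_le`
and in the field `isReduced` the relation `≤` is divisibility of monomials. -/
structure IsReducedGroebnerBasis {σ : Type} (m : MonomialOrder σ) (I : Ideal (MvPolynomial σ ℂ))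
    (G : Set (MvPolynomial σ ℂ)) : Prop where
  subset : ∀ g ∈ G, g ∈ I
  monic : ∀ g ∈ G, m.leadingCoeff g = 1
  degree_le : ∀ f ∈ I, f ≠ 0 → ∃ g ∈ G, m.degree g ≤ m.degree f
  isReduced : ∀ g ∈ G, ∀ h ∈ G, h ≠ g → ∀ e ∈ g.support, ¬ m.degree h ≤ e

/-! ### The listed generators -/

/-- The unknown `a_{ij}`. -/
def coeffVar {d : ℕ} (i j : Fin (d + 1)) : MvPolynomial (CoeffIdx d) ℂ := X (idx i j)

/-- The generators for `K_3`, as expressions in the `a_{ij}`, `j ≤ i`. -/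
def gensK3 {R : Type} [CommRing R] (a : Fin 3 → Fin 3 → R) : Set R :=
  {a 0 0 * a 2 2 + a 2 0 * a 1 1 - a 2 0 ^ 2 - a 2 1 * a 1 0}

/-- The generators for `K_4`, as expressions in the `a_{ij}`, `j ≤ i`. -/
def gensK4 {R : Type} [CommRing R] (a : Fin 4 → Fin 4 → R) : Set R :=
  {a 1 1 * a 3 3 - a 3 2 * a 2 1 + a 3 2 * a 3 0 - a 3 1 ^ 2 + a 3 1 * a 2 2
      - a 3 3 * a 2 0,
    a 1 0 * a 3 3 - a 3 2 * a 2 0 - a 3 0 * a 3 1 + a 3 0 * a 2 2,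
    a 1 0 * a 2 1 * a 3 2 - a 1 0 * a 3 1 * a 2 2 - a 1 0 * a 3 2 * a 3 0
      + a 1 0 * a 3 1 ^ 2 - a 1 1 * a 3 2 * a 2 0 + a 1 1 * a 3 0 * a 2 2
      - a 1 1 * a 3 0 * a 3 1 + a 3 2 * a 2 0 ^ 2 - a 2 0 * a 3 0 * a 2 2
      + a 2 0 * a 3 0 * a 3 1,
    a 0 0 * a 3 3 - a 3 1 * a 2 0 + a 3 0 * a 2 1 - a 3 0 ^ 2,
    a 0 0 * a 3 2 - a 3 1 * a 1 0 + a 3 0 * a 1 1 - a 3 0 * a 2 0,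
    a 0 0 * a 2 2 - a 1 0 * a 2 1 + a 1 0 * a 3 0 - a 2 0 ^ 2 + a 2 0 * a 1 1
      - a 3 1 * a 0 0}

/-- The generators for `K_5`, as expressions in the `a_{ij}`, `j ≤ i`. -/
def gensK5 {R : Type} [CommRing R] (a : Fin 5 → Fin 5 → R) : Set R :=
  {a 2 2 * a 4 4 - a 4 4 * a 3 1 + a 4 1 * a 4 3 - a 4 3 * a 3 2 - a 4 2 ^ 2
      + a 4 2 * a 3 3,
    a 2 1 * a 4 4 - a 4 4 * a 3 0 + a 4 3 * a 4 0 - a 4 3 * a 3 1 - a 4 1 * a 4 2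
      + a 4 1 * a 3 3,
    a 2 1 * a 3 2 * a 4 3 + a 4 3 * a 4 1 * a 3 0 - a 3 0 * a 4 3 * a 3 2
      - a 3 0 * a 4 2 ^ 2 + a 3 0 * a 4 2 * a 3 3 - a 4 3 * a 4 0 * a 3 1
      + a 4 3 * a 3 1 ^ 2 + a 3 1 * a 4 1 * a 4 2 - a 3 1 * a 4 1 * a 3 3
      - a 2 1 * a 4 1 * a 4 3 + a 2 1 * a 4 2 ^ 2 - a 2 1 * a 4 2 * a 3 3
      + a 2 2 * a 4 3 * a 4 0 - a 2 2 * a 4 3 * a 3 1 - a 2 2 * a 4 1 * a 4 2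
      + a 2 2 * a 4 1 * a 3 3,
    a 2 0 * a 4 4 - a 4 3 * a 3 0 - a 4 2 * a 4 0 + a 4 0 * a 3 3,
    a 2 0 * a 3 2 * a 4 3 - a 4 2 * a 3 3 * a 2 0 - a 4 1 * a 4 3 * a 2 0
      + a 4 2 ^ 2 * a 2 0 - a 2 2 * a 4 3 * a 3 0 + a 2 2 * a 4 0 * a 3 3
      - a 4 2 * a 4 0 * a 2 2 + a 3 1 * a 4 3 * a 3 0 - a 3 1 * a 4 0 * a 3 3
      + a 4 2 * a 4 0 * a 3 1,
    a 2 0 * a 3 1 * a 4 3 - a 4 1 * a 3 3 * a 2 0 + a 4 1 * a 4 2 * a 2 0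
      - a 2 1 * a 4 3 * a 3 0 + a 2 1 * a 4 0 * a 3 3 + a 4 3 * a 3 0 ^ 2
      - a 3 0 * a 4 0 * a 3 3 + a 4 0 * a 4 2 * a 3 0 - a 4 0 * a 4 2 * a 2 1
      - a 4 0 * a 4 3 * a 2 0,
    a 2 0 * a 3 1 * a 4 2 + a 2 2 * a 4 1 * a 3 0 - a 4 2 * a 3 0 * a 2 1
      - a 3 2 * a 4 1 * a 2 0 - a 3 1 * a 4 1 * a 3 0 + a 4 1 ^ 2 * a 2 0
      + a 4 2 * a 3 0 ^ 2 - a 4 0 * a 3 2 * a 3 0 + a 4 0 * a 3 2 * a 2 1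
      + a 4 0 * a 3 1 ^ 2 - a 2 2 * a 4 0 * a 3 1 - a 4 0 * a 4 2 * a 2 0
      - a 4 0 ^ 2 * a 3 1 + a 4 0 ^ 2 * a 2 2 + a 4 0 * a 4 1 * a 3 0
      - a 4 0 * a 4 1 * a 2 1,
    a 1 1 * a 4 4 - a 4 3 * a 3 0 - a 4 2 * a 3 1 - a 4 1 ^ 2 + a 4 1 * a 3 2
      + a 4 0 * a 3 3,
    a 1 1 * a 4 3 - a 4 1 * a 3 1 + a 4 1 * a 2 2 + a 4 2 * a 3 0 - a 4 2 * a 2 1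
      - a 4 3 * a 2 0,
    a 1 1 * a 3 3 + a 3 2 * a 3 0 - a 3 2 * a 2 1 - a 3 1 ^ 2 + a 3 1 * a 2 2
      - a 4 2 * a 1 1 - a 3 3 * a 2 0 + a 4 2 * a 2 0 + a 4 0 * a 3 1
      - a 4 0 * a 2 2 - a 4 1 * a 3 0 + a 4 1 * a 2 1,
    a 1 0 * a 4 4 - a 4 2 * a 3 0 + a 4 0 * a 3 2 - a 4 1 * a 4 0,
    a 1 0 * a 4 3 - a 4 2 * a 2 0 + a 4 0 * a 2 2 - a 4 0 * a 3 1,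
    a 1 0 * a 3 3 + a 4 1 * a 2 0 - a 1 0 * a 4 2 - a 3 2 * a 2 0 - a 3 0 * a 3 1
      + a 3 0 * a 2 2,
    a 1 0 * a 3 1 * a 4 2 - a 3 2 * a 4 1 * a 1 0 - a 4 0 * a 1 0 * a 4 2
      + a 4 1 ^ 2 * a 1 0 - a 3 0 * a 4 2 * a 1 1 + a 3 2 * a 4 0 * a 1 1
      - a 4 1 * a 4 0 * a 1 1 + a 3 0 * a 4 2 * a 2 0 - a 4 0 * a 3 2 * a 2 0
      + a 4 0 * a 4 1 * a 2 0,
    a 1 0 * a 2 1 * a 4 2 - a 2 2 * a 4 1 * a 1 0 - a 3 0 * a 1 0 * a 4 2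
      + a 3 1 * a 4 1 * a 1 0 - a 2 0 * a 4 2 * a 1 1 + a 2 2 * a 4 0 * a 1 1
      - a 3 1 * a 4 0 * a 1 1 + a 4 2 * a 2 0 ^ 2 - a 2 0 * a 4 0 * a 2 2
      + a 2 0 * a 4 0 * a 3 1,
    a 1 0 * a 2 1 * a 3 2 - a 1 0 * a 4 0 * a 3 1 + a 2 2 * a 4 0 * a 1 0
      + a 1 1 * a 4 1 * a 2 0 - a 1 1 * a 3 2 * a 2 0 - a 1 1 * a 3 0 * a 3 1
      + a 1 1 * a 3 0 * a 2 2 - a 2 0 * a 3 0 * a 2 2 - a 1 0 * a 3 1 * a 2 2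
      - a 1 0 * a 3 2 * a 3 0 - a 2 1 * a 4 1 * a 1 0 - a 4 1 * a 2 0 ^ 2
      + a 1 0 * a 3 1 ^ 2 + a 3 2 * a 2 0 ^ 2 + a 3 0 * a 4 1 * a 1 0
      + a 2 0 * a 3 0 * a 3 1,
    a 0 0 * a 4 4 - a 4 1 * a 3 0 + a 4 0 * a 3 1 - a 4 0 ^ 2,
    a 0 0 * a 4 3 - a 4 1 * a 2 0 - a 4 0 * a 3 0 + a 4 0 * a 2 1,
    a 0 0 * a 4 2 - a 4 0 * a 2 0 - a 4 1 * a 1 0 + a 4 0 * a 1 1,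
    a 0 0 * a 3 3 - a 4 1 * a 1 0 - a 3 0 ^ 2 + a 3 0 * a 2 1 + a 4 0 * a 1 1
      - a 3 1 * a 2 0,
    a 0 0 * a 3 2 - a 3 1 * a 1 0 + a 4 0 * a 1 0 - a 0 0 * a 4 1 - a 3 0 * a 2 0
      + a 3 0 * a 1 1,
    a 0 0 * a 2 2 - a 1 0 * a 2 1 + a 1 0 * a 3 0 - a 2 0 ^ 2 + a 2 0 * a 1 1
      - a 3 1 * a 0 0}

/-! ### The systems in the elementary symmetric functions -/

/-- Polynomials in the coefficients `a_{ij}` and in the unknowns `s_1, …, s_{d+1}`, where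
`Sum.inr k` is the index of `s_{k+1}`. -/
abbrev SymRing (d : ℕ) : Type := MvPolynomial (CoeffIdx d ⊕ Fin (d + 1)) ℂ

/-- The unknown `a_{ij}` in `SymRing d`. -/
def A {d : ℕ} (i j : Fin (d + 1)) : SymRing d := X (Sum.inl (idx i j))

/-- The unknown `s_k` in `SymRing d`, for `1 ≤ k ≤ d + 1`. -/
def s {d : ℕ} (k : ℕ) : SymRing d := X (Sum.inr (Fin.ofNat (d + 1) (k - 1)))

/-- The substitution `s_k ↦ e_k(x_1, …, x_{d+1})`. -/
def symSubst (d : ℕ) : SymRing d →ₐ[ℂ] MvPolynomial (CoeffIdx d ⊕ Fin (d + 1)) ℂ :=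
  aeval (Sum.elim (fun v => X (Sum.inl v))
    (fun k => rename Sum.inr (esymm (Fin (d + 1)) ℂ ((k : ℕ) + 1))))

/-- The ideal of `K_{d+1}` in the coefficients and the elementary symmetric functions of the
vertices: all `F(a, s)` such that `F(a, e_1(x), …, e_{d+1}(x))` lies in `𝓘(K_{d+1})`. -/
def symIdealK (d : ℕ) : Ideal (SymRing d) :=
  (graphIdeal (genericCoeff d) (⊤ : SimpleGraph (Fin (d + 1)))).comap (symSubst d)

def systemK3 (t : SymRing 2) : Set (SymRing 2) :=
  {A 0 0 - A 2 0 * s 2 + A 2 1 * t,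
    A 1 0 + A 2 0 * s 1 + A 2 2 * t,
    A 1 1 - A 2 0 + A 2 1 * s 1 + A 2 2 * s 2}

def systemK4 (t : SymRing 3) : Set (SymRing 3) :=
  {A 0 0 + A 3 0 * s 3 + A 3 1 * t,
    A 1 0 - A 3 0 * s 2 + A 3 2 * t,
    A 1 1 + A 3 0 * s 1 - A 3 1 * s 2 - A 3 2 * s 3 + A 3 3 * t,
    A 2 1 - A 3 0 + A 3 1 * s 1 - A 3 3 * s 3,
    A 2 2 - A 3 1 + A 3 2 * s 1 + A 3 3 * s 2,
    A 2 0 + A 3 0 * s 1 + A 3 3 * t}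

def systemK5 (t : SymRing 4) : Set (SymRing 4) :=
  {A 0 0 - A 4 0 * s 4 + A 4 1 * t,
    A 1 0 + A 4 0 * s 3 + A 4 2 * t,
    A 1 1 - A 4 0 * s 2 + A 4 1 * s 3 + A 4 2 * s 4 + A 4 3 * t,
    A 2 0 - A 4 0 * s 2 + A 4 3 * t,
    A 2 1 + A 4 4 * t + A 4 0 * s 1 - A 4 1 * s 2 + A 4 3 * s 4,
    A 2 2 + A 4 4 * s 4 - A 4 0 + A 4 1 * s 1 - A 4 2 * s 2 - A 4 3 * s 3,
    A 3 0 + A 4 4 * t + A 4 0 * s 1,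
    A 3 1 + A 4 4 * s 4 - A 4 0 + A 4 1 * s 1,
    A 3 2 - A 4 4 * s 3 - A 4 1 + A 4 2 * s 1,
    A 3 3 + A 4 4 * s 2 - A 4 2 + A 4 3 * s 1}

def systemK6 (t : SymRing 5) : Set (SymRing 5) :=
  {A 0 0 + A 5 0 * s 5 + A 5 1 * t,
    A 1 0 - A 5 0 * s 4 + A 5 2 * t,
    A 1 1 + A 5 0 * s 3 - A 5 1 * s 4 - A 5 2 * s 5 + A 5 3 * t,
    A 2 0 + A 5 0 * s 3 + A 5 3 * t,
    A 2 1 - A 5 0 * s 2 + A 5 1 * s 3 - A 5 3 * s 5 + A 5 4 * t,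
    A 2 2 + A 5 0 * s 1 - A 5 1 * s 2 + A 5 2 * s 3 + A 5 3 * s 4 - A 5 4 * s 5 + A 5 5 * t,
    A 3 0 - A 5 0 * s 2 + A 5 4 * t,
    A 3 1 + A 5 0 * s 1 - A 5 1 * s 2 - A 5 4 * s 5 + A 5 5 * t,
    A 3 2 - A 5 0 + A 5 1 * s 1 - A 5 2 * s 2 + A 5 4 * s 4 - A 5 5 * s 5,
    A 3 3 - A 5 1 + A 5 2 * s 1 - A 5 3 * s 2 - A 5 4 * s 3 + A 5 5 * s 4,
    A 4 0 + A 5 0 * s 1 + A 5 5 * t,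
    A 4 1 - A 5 0 + A 5 1 * s 1 - A 5 5 * s 5,
    A 4 2 - A 5 1 + A 5 2 * s 1 + A 5 5 * s 4,
    A 4 3 - A 5 2 + A 5 3 * s 1 - A 5 5 * s 3,
    A 4 4 - A 5 3 + A 5 4 * s 1 + A 5 5 * s 2}

/-- `J ∩ ℂ[a]`. -/
def elimCoeff {d : ℕ} (J : Ideal (SymRing d)) : Ideal (MvPolynomial (CoeffIdx d) ℂ) :=
  J.comap (rename Sum.inl)

/-- `J ∩ ℂ[a, s_{d+1}]`. -/
def elimCoeffTop {d : ℕ} (J : Ideal (SymRing d)) :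
    Ideal (MvPolynomial (CoeffIdx d ⊕ Unit) ℂ) :=
  J.comap (rename (Sum.map id (fun _ => Fin.last d)))

/-- The unknown `s_{d+1}` is free for `J`: the elimination ideal `J ∩ ℂ[a, s_{d+1}]` is generated by
`J ∩ ℂ[a]`; and `J` has exactly one degree of freedom more than `J ∩ ℂ[a]`. -/
def TopFree {d : ℕ} (J : Ideal (SymRing d)) : Prop :=
  elimCoeffTop J = (elimCoeff J).map (rename Sum.inl) ∧
    ringKrullDim (SymRing d ⧸ J) =
      ringKrullDim (MvPolynomial (CoeffIdx d) ℂ ⧸ elimCoeff J) + 1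

/-- For a system `S(t)` containing a place holder `t`:
* with `t = (-1)^{d+1} s_{d+1}` it generates the ideal of `K_{d+1}` in the coefficients and the
  elementary symmetric functions;
* with `t = t₀` no member of it involves `s_{d+1}`, and it defines the same elimination ideal
  in the coefficients, the characteristic ideal;
* in both cases `s_{d+1}` is free. -/
def ReducesTo {d : ℕ} (S : SymRing d → Set (SymRing d)) (t₀ : SymRing d) : Prop :=
  symIdealK d = Ideal.span (S ((-1) ^ (d + 1) * s (d + 1))) ∧
  elimCoeff (symIdealK d) = charIdealK d ∧
  TopFree (symIdealK d) ∧
  (∀ f ∈ S t₀, Sum.inr (Fin.last d) ∉ f.vars) ∧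
  elimCoeff (Ideal.span (S t₀)) = charIdealK d ∧
  TopFree (Ideal.span (S t₀))

/-! ### The graph of a symmetric polynomial and the conjecture -/

/-- The polynomial `Φ_c(u, y)` in `y`, for a coefficient vector `c` and a number `u`. -/
def phiAt {d : ℕ} (c : CoeffIdx d → ℂ) (u : ℂ) : Polynomial ℂ :=
  ∑ i : Fin (d + 1), ∑ j : Fin (d + 1),
    Polynomial.C (c (idx i j) * u ^ (i : ℕ)) * Polynomial.X ^ (j : ℕ)

/-- `Φ_c` has partial degree exactly `d`. -/
def HasPartialDegree {d : ℕ} (c : CoeffIdx d → ℂ) : Prop := ∃ j, c (idx (Fin.last d) j) ≠ 0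

/-- The graph `G(Φ_c)`: vertex set `ℂ`, edges the zeros of `Φ_c`. Loops and multiple
arcs, which do not influence the connected components, are recorded in `IsSingularVertex`. -/
def polyGraph {d : ℕ} (c : CoeffIdx d → ℂ) : SimpleGraph ℂ :=
  SimpleGraph.fromRel fun u v => (phiAt c u).IsRoot v

/-- `u` carries a loop, is the origin of a multiple arc, or is defective (`Φ_c(u, y)` has degree
less than `d`). -/
def IsSingularVertex {d : ℕ} (c : CoeffIdx d → ℂ) (u : ℂ) : Prop :=
  (phiAt c u).IsRoot u ∨ ¬ (phiAt c u).roots.Nodup ∨ (phiAt c u).natDegree < d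

/-- The components of `G(Φ_c)^*`: the connected components of `G(Φ_c)` without singular vertices. -/
def nonsingularComponents {d : ℕ} (c : CoeffIdx d → ℂ) : Set (polyGraph c).ConnectedComponent :=
  {C | ∀ u ∈ C.supp, ¬ IsSingularVertex c u}

/-- The conjecture for the `d`-regular graph `H`: for every symmetric polynomial of partial degree
`d`, if some component of `G(Φ)^*` is isomorphic to `H`, then all of them are. -/
def ConjectureFor (d : ℕ) {n : ℕ} (H : SimpleGraph (Fin n)) : Prop :=
  ∀ c : CoeffIdx d → ℂ, HasPartialDegree c →
    (∃ C ∈ nonsingularComponents c, Nonempty (C.toSimpleGraph ≃g H)) →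
      ∀ C ∈ nonsingularComponents c, Nonempty (C.toSimpleGraph ≃g H)

end PolyGraph

end

namespace PolyGraph

/-! ### Bezoutians -/

section Bezout

variable {R : Type*} [CommRing R]

/-! Everything rests on one identity. If a symmetric `Φ` of partial degree at most `d` vanishes on a
clique of `d + 1` distinct points, then interpolation gives `(u - y) Φ(u, y) = P(u) Q(y) - P(y)
Q(u)`, where `P` is monic with the clique as its roots and `Q` is the coefficient of `u^d` in `Φ`
(`sub_mul_phiVal_of_clique`); conversely every such Bezoutian vanishes on the clique (`clique_iff`).
The condition that the points are distinct disappears by Zariski density. Thus `J_n` is the ideal of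
all pairs (Bezoutian, elementary symmetric functions of `P`), and the characteristic ideal is the
ideal of all Bezoutians (`mem_symIdealK`, `mem_charIdealK`).

The conjecture: by the identity, adjacency means that `P/Q` takes the same value. This is transitive
as long as `P` and `Q` have no common zero, so every nonsingular component is a clique
(`conjectureFor_top`).

The systems: the top row of a Bezoutian is `Q`, and the listed equations express the other
coefficients by `Q` and the `s_k`. They therefore define a polynomial ring in `2d + 2` variables
(`span_bezSystem`). Replacing `P` by `P + λQ` does not change the Bezoutian (`exists_bezPoint_eq`).
This freedom either moves `s_n` to any value, or is spent on the normalization of the constant term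
by `s_1`, after which `s_n` no longer occurs. The Bezoutians form a variety of dimension `2d + 1`.

The generators: the coefficients `D_ij` of `(u - y) Φ` are linear coordinates for `Φ`, and on
Bezoutians they are the `2 × 2` minors of the coefficient matrix of `P` and `Q`. So the
characteristic ideal is a Plücker ideal (`charIdealK_eq_span`), generated by the three-term
relations (`ker_plParam`). The listed generators are these relations, sums of two of them, and
redundant cubics.

`K_6` with `a_54 = 0`: this condition is `D_46 = 0`. The 35 Plücker relations and 13 of the `3 × 3`
minors of the skew matrix `D`, which has rank at most two, have explicit leading exponents. That
these generate all leading exponents follows from a count (`exists_le_degree_of_card_le`). The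
generic Bezoutian with `Q_4 = Q_6 = 0` makes the monomials without nested pairs, for a suitable
order of the labels, linearly independent. In every degree they are as many as the standard
monomials, because the two underlying simplicial complexes have equal face numbers
(`faceCount_leadList_eq`). -/

/-- The coefficient of `u ^ i * y ^ j`, `j ≤ i`, in the Bezoutian
`(P(u) Q(y) - P(y) Q(u)) / (u - y)` of the polynomials with coefficients `p` and `q`. -/
def bez (p q : ℕ → R) (i j : ℕ) : R :=
  ∑ k ∈ Finset.range (j + 1), (p (i + 1 + k) * q (j - k) - p (j - k) * q (i + 1 + k))

/-- The coefficient vector of a Bezoutian. -/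
def bezCoeff (d : ℕ) (p q : ℕ → R) : CoeffIdx d → R :=
  fun v => bez p q (ofLex v.1).1 (ofLex v.1).2

theorem bez_zero_right (p q : ℕ → R) (i : ℕ) :
    bez p q i 0 = p (i + 1) * q 0 - p 0 * q (i + 1) := by
  simp [bez]

/-- The summand `k = 0` is split off, and what remains is the sum for the next entry on the
antidiagonal. This recursion is the coefficient form of multiplication by `u - y`. -/
theorem bez_succ_right (p q : ℕ → R) (i j : ℕ) :
    bez p q i (j + 1) =
      p (i + 1) * q (j + 1) - p (j + 1) * q (i + 1) + bez p q (i + 1) j := by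
  rw [bez, Finset.sum_range_succ', bez, add_comm]
  congr 1
  refine Finset.sum_congr rfl fun k _ => ?_
  have h1 : i + 1 + (k + 1) = i + 1 + 1 + k := by omega
  have h2 : j + 1 - (k + 1) = j - k := by omega
  rw [h1, h2]

theorem bez_eq_zero {p q : ℕ → R} {N : ℕ} (hp : ∀ k, N < k → p k = 0) (hq : ∀ k, N < k → q k = 0)
    {i : ℕ} (hi : N ≤ i) (j : ℕ) : bez p q i j = 0 :=
  Finset.sum_eq_zero fun k _ => by
    rw [hp (i + 1 + k) (by omega), hq (i + 1 + k) (by omega)]; ring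

theorem map_bez {S F : Type*} [CommRing S] [FunLike F R S] [RingHomClass F R S] (f : F)
    (p q : ℕ → R) (i j : ℕ) : f (bez p q i j) = bez (fun k => f (p k)) (fun k => f (q k)) i j := by
  simp [bez, map_sum]

theorem bez_top {p q : ℕ → R} {d : ℕ} (hp1 : p (d + 1) = 1) (hp : ∀ k, d + 1 < k → p k = 0)
    (hq : ∀ k, d < k → q k = 0) (j : ℕ) : bez p q d j = q j := by
  rw [bez, Finset.sum_range_succ', Finset.sum_eq_zero]
  · simp [hp1, hq (d + 1) (by omega)]
  · intro k _
    rw [hp (d + 1 + (k + 1)) (by omega), hq (d + 1 + (k + 1)) (by omega)]; ring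

/-- A Bezoutian depends only on the exterior product of its arguments. -/
theorem bez_add_smul (p q : ℕ → R) (t : R) (i j : ℕ) :
    bez (fun k => p k + t * q k) q i j = bez p q i j :=
  Finset.sum_congr rfl fun k _ => by ring

theorem bez_smul_right (p q : ℕ → R) (t : R) (i j : ℕ) :
    bez p (fun k => t * q k) i j = t * bez p q i j := by
  rw [bez, bez, Finset.mul_sum]
  exact Finset.sum_congr rfl fun k _ => by ring

/-- The value at `(u, y)` of the symmetric polynomial with coefficients `c`. -/
def phiVal {d : ℕ} (c : CoeffIdx d → R) (u y : R) : R :=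
  ∑ i : Fin (d + 1), ∑ j : Fin (d + 1), c (idx i j) * u ^ (i : ℕ) * y ^ (j : ℕ)

theorem idx_comm {d : ℕ} (i j : Fin (d + 1)) : idx i j = idx j i := by
  simp [idx, max_comm, min_comm]

theorem idx_eta {d : ℕ} (v : CoeffIdx d) : idx (ofLex v.1).1 (ofLex v.1).2 = v :=
  Subtype.ext (congrArg toLex (Prod.ext (max_eq_left v.2) (min_eq_right v.2)))

theorem phiVal_comm {d : ℕ} (c : CoeffIdx d → R) (u y : R) : phiVal c u y = phiVal c y u := by
  unfold phiVal
  rw [Finset.sum_comm]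
  refine Finset.sum_congr rfl fun i _ => Finset.sum_congr rfl fun j _ => ?_
  rw [idx_comm]; ring

/-- Multiplication by `u` and by `y` shifts the coefficients, so both products are written over the
common box `range (d + 2)` and compared term by term; each comparison is `bez_succ_right`. -/
theorem sub_mul_phiVal_bezCoeff {d : ℕ} {p q : ℕ → R} (hp : ∀ k, d + 1 < k → p k = 0)
    (hq : ∀ k, d + 1 < k → q k = 0) (u y : R) :
    (u - y) * phiVal (bezCoeff d p q) u y =
      (∑ k ∈ Finset.range (d + 2), p k * u ^ k) * (∑ k ∈ Finset.range (d + 2), q k * y ^ k) -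
      (∑ k ∈ Finset.range (d + 2), p k * y ^ k) * (∑ k ∈ Finset.range (d + 2), q k * u ^ k) := by
  set b : ℕ → ℕ → R := fun i j => bez p q (max i j) (min i j) with hb
  have hb0 : ∀ i j, d + 1 ≤ max i j → b i j = 0 := fun i j h => bez_eq_zero hp hq h _
  have hphi : phiVal (bezCoeff d p q) u y =
      ∑ i ∈ Finset.range (d + 1), ∑ j ∈ Finset.range (d + 1), b i j * u ^ i * y ^ j := by
    rw [phiVal, Finset.sum_range]
    refine Finset.sum_congr rfl fun i _ => ?_
    rw [Finset.sum_range]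
    refine Finset.sum_congr rfl fun j _ => ?_
    simp [bezCoeff, idx, hb]
  have hu : u * phiVal (bezCoeff d p q) u y = ∑ i ∈ Finset.range (d + 2),
      ∑ j ∈ Finset.range (d + 2), (if i = 0 then 0 else b (i - 1) j) * u ^ i * y ^ j := by
    rw [Finset.sum_range_succ' _ (d + 1), hphi, Finset.mul_sum]
    simp only [if_true, zero_mul, Finset.sum_const_zero, add_zero]
    refine Finset.sum_congr rfl fun i _ => ?_
    rw [Finset.sum_range_succ _ (d + 1), Finset.mul_sum]
    simp only [Nat.add_one_ne_zero, if_false, Nat.add_sub_cancel]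
    rw [hb0 i (d + 1) (le_max_right _ _), zero_mul, zero_mul, add_zero]
    exact Finset.sum_congr rfl fun j _ => by ring
  have hy : y * phiVal (bezCoeff d p q) u y = ∑ i ∈ Finset.range (d + 2),
      ∑ j ∈ Finset.range (d + 2), (if j = 0 then 0 else b i (j - 1)) * u ^ i * y ^ j := by
    rw [Finset.sum_range_succ _ (d + 1), hphi, Finset.mul_sum]
    rw [Finset.sum_eq_zero (s := Finset.range (d + 2)), add_zero]
    · refine Finset.sum_congr rfl fun i _ => ?_
      rw [Finset.sum_range_succ' _ (d + 1), Finset.mul_sum]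
      simp only [if_true, zero_mul, add_zero, Nat.add_one_ne_zero, if_false, Nat.add_sub_cancel]
      exact Finset.sum_congr rfl fun j _ => by ring
    · intro j _
      split_ifs
      · ring
      · rw [hb0 _ _ (le_max_left _ _)]; ring
  rw [sub_mul, hu, hy, ← Finset.sum_sub_distrib, Finset.sum_mul_sum, Finset.sum_mul_sum,
    Finset.sum_comm (s := Finset.range (d + 2)) (t := Finset.range (d + 2))
      (f := fun i j => p i * y ^ i * (q j * u ^ j)), ← Finset.sum_sub_distrib]
  refine Finset.sum_congr rfl fun i _ => ?_
  rw [← Finset.sum_sub_distrib, ← Finset.sum_sub_distrib]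
  refine Finset.sum_congr rfl fun j _ => ?_
  have key : (if i = 0 then 0 else b (i - 1) j) - (if j = 0 then 0 else b i (j - 1)) =
      p i * q j - p j * q i := by
    -- Both sides are antisymmetric in `i` and `j`, so one of the two triangles suffices.
    have low : ∀ i j : ℕ, j < i →
        (if i = 0 then 0 else b (i - 1) j) - (if j = 0 then 0 else b i (j - 1)) =
          p i * q j - p j * q i := by
      intro i j hij
      obtain ⟨i, rfl⟩ : ∃ k, i = k + 1 := ⟨i - 1, by omega⟩
      simp only [Nat.add_one_ne_zero, if_false, Nat.add_sub_cancel, hb]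
      rw [max_eq_left (by omega : j ≤ i), min_eq_right (by omega : j ≤ i)]
      cases j with
      | zero => simp [bez_zero_right]
      | succ j =>
        simp only [Nat.add_one_ne_zero, if_false, Nat.add_sub_cancel]
        rw [max_eq_left (by omega : j ≤ i + 1), min_eq_right (by omega : j ≤ i + 1),
          bez_succ_right]
        ring
    rcases lt_trichotomy j i with h | h | h
    · exact low i j h
    · subst h
      simp [hb]
    · have := low j i h
      simp only [hb] at this ⊢
      rw [max_comm i, min_comm i, max_comm (i - 1), min_comm (i - 1)]
      linear_combination -this
  linear_combination u ^ i * y ^ j * key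

end Bezout

/-! ### Interpolation at the vertices of a clique -/

theorem eval_phiAt {d : ℕ} (c : CoeffIdx d → ℂ) (u y : ℂ) :
    (phiAt c u).eval y = phiVal c u y := by
  simp [phiAt, phiVal, Polynomial.eval_finsetSum]

theorem natDegree_phiAt_le {d : ℕ} (c : CoeffIdx d → ℂ) (u : ℂ) : (phiAt c u).natDegree ≤ d :=
  Polynomial.natDegree_sum_le_of_forall_le _ _ fun i _ =>
    Polynomial.natDegree_sum_le_of_forall_le _ _ fun j _ =>
      (Polynomial.natDegree_C_mul_X_pow_le _ _).trans (by omega)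

theorem coeff_phiAt {d : ℕ} (c : CoeffIdx d → ℂ) (u : ℂ) (j : Fin (d + 1)) :
    (phiAt c u).coeff j = ∑ i : Fin (d + 1), c (idx i j) * u ^ (i : ℕ) := by
  simp only [phiAt, Polynomial.finsetSum_coeff, Polynomial.coeff_C_mul_X_pow]
  refine Finset.sum_congr rfl fun i _ => ?_
  rw [Finset.sum_eq_single j]
  · simp
  · intro b _ hb
    rw [if_neg (fun h => hb (Fin.ext h).symm)]
  · simp

/-- Cancelling the factor `u - y` only gives equality off the diagonal. For each `u` this still
leaves infinitely many values of `y`. -/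
theorem eq_of_phiVal_eq {d : ℕ} {c c' : CoeffIdx d → ℂ}
    (h : ∀ u y, u ≠ y → phiVal c u y = phiVal c' u y) : c = c' := by
  have h1 : ∀ u, phiAt c u = phiAt c' u := fun u => by
    refine Polynomial.eq_of_infinite_eval_eq _ _ ?_
    refine Set.Infinite.mono (s := {u}ᶜ) ?_ (Set.finite_singleton u).infinite_compl
    intro y hy
    simp only [Set.mem_ofPred_eq, eval_phiAt]
    exact h u y fun h => hy h.symm
  funext v
  rw [← idx_eta v]
  set i := (ofLex v.1).1
  set j := (ofLex v.1).2
  have h2 : (∑ i : Fin (d + 1), Polynomial.C (c (idx i j)) * Polynomial.X ^ (i : ℕ)) =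
      ∑ i : Fin (d + 1), Polynomial.C (c' (idx i j)) * Polynomial.X ^ (i : ℕ) := by
    refine Polynomial.funext fun u => ?_
    have := congrArg (fun f => f.coeff (j : ℕ)) (h1 u)
    simp only [coeff_phiAt] at this
    simpa [Polynomial.eval_finsetSum] using this
  have h3 := congrArg (fun f => Polynomial.coeff f (i : ℕ)) h2
  simp only [Polynomial.finsetSum_coeff, Polynomial.coeff_C_mul_X_pow] at h3
  simpa [Fin.val_inj] using h3

/-- The polynomial with coefficients `c_{d0}, …, c_{dd}`. -/
noncomputable def topPoly {d : ℕ} (c : CoeffIdx d → ℂ) : Polynomial ℂ :=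
  ∑ j : Fin (d + 1), Polynomial.C (c (idx (Fin.last d) j)) * Polynomial.X ^ (j : ℕ)

theorem natDegree_topPoly_le {d : ℕ} (c : CoeffIdx d → ℂ) : (topPoly c).natDegree ≤ d :=
  Polynomial.natDegree_sum_le_of_forall_le _ _ fun j _ =>
      (Polynomial.natDegree_C_mul_X_pow_le _ _).trans (by omega)

theorem coeff_topPoly {d : ℕ} (c : CoeffIdx d → ℂ) (j : Fin (d + 1)) :
    (topPoly c).coeff j = c (idx (Fin.last d) j) := by
  simp only [topPoly, Polynomial.finsetSum_coeff, Polynomial.coeff_C_mul_X_pow]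
  simp [Fin.val_inj]

/-- The monic polynomial with roots `x_v`. -/
noncomputable def nodePoly {n : ℕ} (x : Fin n → ℂ) : Polynomial ℂ :=
  ∏ v, (Polynomial.X - Polynomial.C (x v))

theorem monic_nodePoly {n : ℕ} (x : Fin n → ℂ) : (nodePoly x).Monic :=
  Polynomial.monic_prod_of_monic _ _ fun _ _ => Polynomial.monic_X_sub_C _

theorem natDegree_nodePoly {n : ℕ} (x : Fin n → ℂ) : (nodePoly x).natDegree = n := by
  rw [nodePoly, Polynomial.natDegree_prod_of_monic _ _ fun _ _ => Polynomial.monic_X_sub_C _]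
  simp

theorem eval_nodePoly {n : ℕ} (x : Fin n → ℂ) (v : Fin n) : (nodePoly x).eval (x v) = 0 := by
  rw [nodePoly, Polynomial.eval_prod]
  exact Finset.prod_eq_zero (Finset.mem_univ v) (by simp)

theorem degree_lt_of_coeff_eq_zero {f : Polynomial ℂ} {n : ℕ} (h1 : f.natDegree ≤ n)
    (h2 : f.coeff n = 0) : f.degree < n := by
  rw [Polynomial.degree_lt_iff_coeff_zero]
  intro m hm
  rcases hm.eq_or_lt with rfl | hm
  · exact h2
  · exact Polynomial.coeff_eq_zero_of_natDegree_lt (by omega)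

/-- Used to see that top coefficients cancel in the interpolation. By symmetry the coefficient of
`y^d` in `Φ(u, y)` is the top-row polynomial at `u`. -/
theorem coeff_linear_mul_phiAt {d : ℕ} (c : CoeffIdx d → ℂ) (u a b : ℂ) :
    ((Polynomial.C a * Polynomial.X + Polynomial.C b) * phiAt c u).coeff (d + 1) =
      a * (topPoly c).eval u := by
  rw [add_mul, Polynomial.coeff_add, mul_assoc, Polynomial.coeff_C_mul, Polynomial.coeff_X_mul,
    Polynomial.coeff_C_mul,
    Polynomial.coeff_eq_zero_of_natDegree_lt (Nat.lt_succ_of_le (natDegree_phiAt_le c u)),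
    mul_zero, add_zero]
  have := coeff_phiAt c u (Fin.last d)
  rw [Fin.val_last] at this
  rw [this, topPoly, Polynomial.eval_finsetSum]
  congr 1
  refine Finset.sum_congr rfl fun i _ => ?_
  simp [idx_comm i]

/-- A symmetric polynomial of partial degree `d` that vanishes on a `(d+1)`-clique is a
Bezoutian. -/
theorem sub_mul_phiVal_of_clique {d : ℕ} {c : CoeffIdx d → ℂ} {x : Fin (d + 1) → ℂ}
    (hx : Function.Injective x) (h : ∀ v w, v ≠ w → phiVal c (x v) (x w) = 0) (u y : ℂ) :
    (u - y) * phiVal c u y = (nodePoly x).eval u * (topPoly c).eval y -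
      (nodePoly x).eval y * (topPoly c).eval u := by
  have hdeg : ∀ u a b : ℂ,
      ((Polynomial.C a * Polynomial.X + Polynomial.C b) * phiAt c u).natDegree ≤ d + 1 := by
    intro u a b
    refine Polynomial.natDegree_mul_le.trans ?_
    have := natDegree_phiAt_le c u
    have := Polynomial.natDegree_linear_le (a := a) (b := b)
    omega
  have hP : (nodePoly x).coeff (d + 1) = 1 := by
    have := (monic_nodePoly x).coeff_natDegree
    rwa [natDegree_nodePoly] at this
  have hPd : ∀ a, (Polynomial.C a * nodePoly x).natDegree ≤ d + 1 := fun a =>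
    (Polynomial.natDegree_C_mul_le _ _).trans (natDegree_nodePoly x).le
  have hsub : ∀ f g : Polynomial ℂ, f.natDegree ≤ d + 1 → g.natDegree ≤ d + 1 →
      (f - g).natDegree ≤ d + 1 := fun f g hf hg =>
    (Polynomial.natDegree_sub_le_of_le hf hg).trans_eq (max_self _)
  -- For a fixed vertex `x w` the difference of the two sides has degree at most `d`, since the
  -- coefficients of degree `d + 1` agree, and it vanishes at all `d + 1` vertices.
  have h1 : ∀ w u, (u - x w) * phiVal c u (x w) =
      (topPoly c).eval (x w) * (nodePoly x).eval u := by
    intro w u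
    have h0 : (Polynomial.C 1 * Polynomial.X + Polynomial.C (-x w)) * phiAt c (x w) -
        Polynomial.C ((topPoly c).eval (x w)) * nodePoly x = 0 := by
      refine Polynomial.eq_zero_of_degree_lt_of_eval_index_eq_zero (s := Finset.univ) (v := x)
        hx.injOn ?_ ?_
      · rw [Finset.card_univ, Fintype.card_fin]
        refine degree_lt_of_coeff_eq_zero ?_ ?_
        · exact hsub _ _ (hdeg _ _ _) (hPd _)
        · rw [Polynomial.coeff_sub, coeff_linear_mul_phiAt, Polynomial.coeff_C_mul, hP]; ring
      · intro v _
        simp only [Polynomial.eval_sub, Polynomial.eval_mul, eval_phiAt, eval_nodePoly]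
        by_cases hvw : v = w
        · subst hvw; simp
        · rw [h w v (Ne.symm hvw)]; simp
    have := congrArg (Polynomial.eval u) h0
    simp only [Polynomial.eval_sub, Polynomial.eval_mul, eval_phiAt, Polynomial.eval_add,
      Polynomial.eval_C, Polynomial.eval_X, Polynomial.eval_zero] at this
    rw [phiVal_comm]
    linear_combination this
  -- The same argument in the second variable, now for arbitrary `u`: the top coefficients `-Q(u)`
  -- cancel, and `h1` supplies the zeros at the vertices.
  have h0 : (Polynomial.C (-1) * Polynomial.X + Polynomial.C u) * phiAt c u -
      (Polynomial.C ((nodePoly x).eval u) * topPoly c -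
        Polynomial.C ((topPoly c).eval u) * nodePoly x) = 0 := by
    refine Polynomial.eq_zero_of_degree_lt_of_eval_index_eq_zero (s := Finset.univ) (v := x)
      hx.injOn ?_ ?_
    · rw [Finset.card_univ, Fintype.card_fin]
      refine degree_lt_of_coeff_eq_zero ?_ ?_
      · refine hsub _ _ (hdeg _ _ _) (hsub _ _ ?_ (hPd _))
        have := natDegree_topPoly_le c
        exact (Polynomial.natDegree_C_mul_le _ _).trans (by omega)
      · rw [Polynomial.coeff_sub, coeff_linear_mul_phiAt, Polynomial.coeff_sub,
          Polynomial.coeff_C_mul, Polynomial.coeff_C_mul, hP,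
          Polynomial.coeff_eq_zero_of_natDegree_lt
            (Nat.lt_succ_of_le (natDegree_topPoly_le c))]
        ring
    · intro w _
      simp only [Polynomial.eval_sub, Polynomial.eval_mul, eval_phiAt, Polynomial.eval_add,
        Polynomial.eval_C, Polynomial.eval_X, eval_nodePoly]
      linear_combination h1 w u
  have := congrArg (Polynomial.eval y) h0
  simp only [Polynomial.eval_sub, Polynomial.eval_mul, eval_phiAt, Polynomial.eval_add,
    Polynomial.eval_C, Polynomial.eval_X, Polynomial.eval_zero] at this
  linear_combination this

/-- The points of `W(K_{d+1}) \ Z(K_{d+1})` are the Bezoutians. -/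
theorem clique_iff {d : ℕ} {c : CoeffIdx d → ℂ} {x : Fin (d + 1) → ℂ}
    (hx : Function.Injective x) :
    (∀ v w, v ≠ w → phiVal c (x v) (x w) = 0) ↔
      c = bezCoeff d (nodePoly x).coeff (topPoly c).coeff := by
  have hp : ∀ k, d + 1 < k → (nodePoly x).coeff k = 0 := fun k hk =>
    Polynomial.coeff_eq_zero_of_natDegree_lt (by rwa [natDegree_nodePoly])
  have hq : ∀ k, d + 1 < k → (topPoly c).coeff k = 0 := fun k hk =>
    Polynomial.coeff_eq_zero_of_natDegree_lt
      (lt_of_le_of_lt (natDegree_topPoly_le c) (by omega))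
  have hpe : ∀ u, ∑ k ∈ Finset.range (d + 2), (nodePoly x).coeff k * u ^ k =
      (nodePoly x).eval u := fun u =>
    (Polynomial.eval_eq_sum_range' (by rw [natDegree_nodePoly]; omega) u).symm
  have hqe : ∀ u, ∑ k ∈ Finset.range (d + 2), (topPoly c).coeff k * u ^ k =
      (topPoly c).eval u := fun u =>
    (Polynomial.eval_eq_sum_range' (lt_of_le_of_lt (natDegree_topPoly_le c) (by omega)) u).symm
  have hb := sub_mul_phiVal_bezCoeff hp hq
  simp only [hpe, hqe] at hb
  constructor
  · intro h
    refine eq_of_phiVal_eq fun u y huy => ?_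
    have h1 := sub_mul_phiVal_of_clique hx h u y
    exact mul_left_cancel₀ (sub_ne_zero.2 huy) (h1.trans (hb u y).symm)
  · intro h v w hvw
    have h1 := hb (x v) (x w)
    rw [← h, eval_nodePoly, eval_nodePoly] at h1
    refine (mul_eq_zero.1 (h1.trans (by ring))).resolve_left (sub_ne_zero.2 fun h => hvw (hx h))

/-! ### Points of the varieties -/

section Coefficients

variable {R : Type*} [CommRing R] {n : ℕ}

/-- The coefficients of the monic polynomial of degree `n` whose roots have the elementary
symmetric functions `s_1, …, s_n`, where `s k` is `s_{k+1}`. -/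
def symCoeff (s : Fin n → R) (k : ℕ) : R :=
  if k = n then 1 else if h : k < n then (-1) ^ (n - k) * s ⟨n - k - 1, by omega⟩ else 0

/-- The coefficients of a polynomial of degree less than `n`. -/
def lowCoeff (q : Fin n → R) (k : ℕ) : R := if h : k < n then q ⟨k, h⟩ else 0

theorem symCoeff_self (s : Fin n → R) : symCoeff s n = 1 := by simp [symCoeff]

theorem symCoeff_of_lt (s : Fin n → R) {k : ℕ} (hk : n < k) : symCoeff s k = 0 := by
  rw [symCoeff, if_neg (by omega), dif_neg (by omega)]

theorem symCoeff_val (s : Fin n → R) (k : Fin n) :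
    symCoeff s k = (-1) ^ (n - (k : ℕ)) * s k.rev := by
  rw [symCoeff, if_neg (by omega), dif_pos k.2]
  congr 2

theorem lowCoeff_val (q : Fin n → R) (k : Fin n) : lowCoeff q k = q k := by
  simp [lowCoeff]

theorem lowCoeff_of_le (q : Fin n → R) {k : ℕ} (hk : n ≤ k) : lowCoeff q k = 0 := by
  rw [lowCoeff, dif_neg (by omega)]

variable {S F : Type*} [CommRing S] [FunLike F R S] [RingHomClass F R S]

theorem map_symCoeff (f : F) (s : Fin n → R) (k : ℕ) :
    f (symCoeff s k) = symCoeff (fun i => f (s i)) k := by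
  unfold symCoeff
  split_ifs <;> simp

theorem map_lowCoeff (f : F) (q : Fin n → R) (k : ℕ) :
    f (lowCoeff q k) = lowCoeff (fun i => f (q i)) k := by
  unfold lowCoeff
  split_ifs <;> simp

theorem map_bezCoeff {d : ℕ} (f : F) (p q : ℕ → R) (v : CoeffIdx d) :
    f (bezCoeff d p q v) = bezCoeff d (fun k => f (p k)) (fun k => f (q k)) v :=
  map_bez f p q _ _

theorem bezCoeff_top {d : ℕ} {p : ℕ → R} (hp1 : p (d + 1) = 1) (hp : ∀ k, d + 1 < k → p k = 0)
    (q : Fin (d + 1) → R) (j : Fin (d + 1)) :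
    bezCoeff d p (lowCoeff q) (idx (Fin.last d) j) = q j := by
  have h1 : max (Fin.last d) j = Fin.last d := max_eq_left (Fin.le_last j)
  have h2 : min (Fin.last d) j = j := min_eq_right (Fin.le_last j)
  simp only [bezCoeff, idx, ofLex_toLex, h1, h2, Fin.val_last]
  rw [bez_top hp1 hp fun k hk => lowCoeff_of_le q (by omega), lowCoeff_val]

end Coefficients

/-! ### The ideals as vanishing ideals of Bezoutians -/

/-- The elementary symmetric functions of the nodes `x_v`. -/
noncomputable def nodeSym {n : ℕ} (x : Fin n → ℂ) (k : Fin n) : ℂ :=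
  aeval x (esymm (Fin n) ℂ ((k : ℕ) + 1))

theorem coeff_nodePoly {n : ℕ} (x : Fin n → ℂ) :
    (nodePoly x).coeff = symCoeff (nodeSym x) := by
  funext k
  rcases lt_trichotomy k n with h | h | h
  · have h0 : nodePoly x =
        ((Finset.univ.val.map x).map fun t => Polynomial.X - Polynomial.C t).prod := by
      rw [nodePoly, Finset.prod_eq_multiset_prod, Multiset.map_map]; rfl
    have hc : Multiset.card (Finset.univ.val.map x) = n := by simp
    rw [symCoeff, if_neg (by omega), dif_pos h, h0, Multiset.prod_X_sub_C_coeff _ (by omega), hc,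
      nodeSym, aeval_esymm_eq_multiset_esymm]
    congr 3
    simp only; omega
  · subst h
    rw [symCoeff_self]
    have := (monic_nodePoly x).coeff_natDegree
    rwa [natDegree_nodePoly] at this
  · rw [symCoeff_of_lt _ h]
    exact Polynomial.coeff_eq_zero_of_natDegree_lt (by rwa [natDegree_nodePoly])

theorem coeff_topPoly_eq {d : ℕ} (c : CoeffIdx d → ℂ) :
    (topPoly c).coeff = lowCoeff fun j => c (idx (Fin.last d) j) := by
  funext k
  by_cases h : k < d + 1
  · rw [lowCoeff, dif_pos h]; exact coeff_topPoly c ⟨k, h⟩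
  · rw [lowCoeff, dif_neg h]
    exact Polynomial.coeff_eq_zero_of_natDegree_lt
      (lt_of_le_of_lt (natDegree_topPoly_le c) (by omega))

theorem aeval_phi {d n : ℕ} {τ : Type} (A : CoeffIdx d → MvPolynomial τ ℂ) (v w : Fin n)
    (pt : τ ⊕ Fin n → ℂ) :
    aeval pt (phi A v w) =
      phiVal (fun u => aeval (pt ∘ Sum.inl) (A u)) (pt (Sum.inr v)) (pt (Sum.inr w)) := by
  simp [phi, phiVal, eval_rename]

theorem mem_varietyW {d : ℕ} {τ : Type} (A : CoeffIdx d → MvPolynomial τ ℂ)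
    (pt : τ ⊕ Fin (d + 1) → ℂ) :
    pt ∈ varietyW A (⊤ : SimpleGraph (Fin (d + 1))) ↔ ∀ v w, v ≠ w →
      phiVal (fun u => aeval (pt ∘ Sum.inl) (A u)) (pt (Sum.inr v)) (pt (Sum.inr w)) = 0 := by
  rw [varietyW, zeroLocus_span]
  constructor
  · intro h v w hvw
    rw [← aeval_phi]
    exact h _ ⟨v, w, hvw, rfl⟩
  · rintro h _ ⟨v, w, hvw, rfl⟩
    rw [aeval_phi]
    exact h v w hvw

theorem mem_graphIdeal {d : ℕ} {τ : Type} (A : CoeffIdx d → MvPolynomial τ ℂ)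
    (f : MvPolynomial (τ ⊕ Fin (d + 1)) ℂ) :
    f ∈ graphIdeal A (⊤ : SimpleGraph (Fin (d + 1))) ↔
      ∀ (b : τ → ℂ) (x : Fin (d + 1) → ℂ), Function.Injective x →
        (fun u => aeval b (A u)) = bezCoeff d (symCoeff (nodeSym x))
          (lowCoeff fun j => aeval b (A (idx (Fin.last d) j))) →
        aeval (Sum.elim b x) f = 0 := by
  -- Passing to the Zariski closure does not change the vanishing ideal.
  have h0 : f ∈ graphIdeal A (⊤ : SimpleGraph (Fin (d + 1))) ↔
      f ∈ vanishingIdeal ℂ (varietyW A (⊤ : SimpleGraph (Fin (d + 1))) \ varietyZ A ⊤) := by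
    rw [graphIdeal, varietyU]
    exact ⟨fun h => vanishingIdeal_anti_mono (zeroLocus_vanishingIdeal_le _) h,
      fun h => le_vanishingIdeal_zeroLocus _ h⟩
  rw [h0, mem_vanishingIdeal_iff]
  constructor
  · intro h b x hx hb
    refine h _ ⟨?_, ?_⟩
    · rw [mem_varietyW]
      simp only [Sum.elim_comp_inl, Sum.elim_inr]
      rw [clique_iff hx, coeff_nodePoly, coeff_topPoly_eq]
      exact hb
    · rintro ⟨-, v, w, hvw, h⟩
      exact hvw (hx h)
  · intro h pt hpt
    have hx : Function.Injective (pt ∘ Sum.inr) := fun v w hvw => by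
      by_contra hne
      exact hpt.2 ⟨hpt.1, v, w, hne, hvw⟩
    have := h (pt ∘ Sum.inl) (pt ∘ Sum.inr) hx (by
      have h1 := (clique_iff hx).1 ((mem_varietyW A pt).1 hpt.1)
      rwa [coeff_nodePoly, coeff_topPoly_eq] at h1)
    rwa [Sum.elim_comp_inl_inr] at this

/-- A polynomial that vanishes wherever a nonzero polynomial does not vanish is zero. -/
theorem eq_zero_of_aeval_eq_zero_of_ne {σ : Type*} {F H : MvPolynomial σ ℂ} (hH : H ≠ 0)
    (h : ∀ x : σ → ℂ, aeval x H ≠ 0 → aeval x F = 0) : F = 0 := by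
  have : H * F = 0 := by
    refine MvPolynomial.funext fun x => ?_
    rw [map_mul, map_zero]
    by_cases hx : aeval x H = 0
    · exact mul_eq_zero_of_left hx _
    · exact mul_eq_zero_of_right _ (h x hx)
  exact (mul_eq_zero.1 this).resolve_left hH

/-- Nodes are distinct where the nonzero product of their differences does not vanish. Hence
substituting the elementary symmetric polynomials in `F` gives the zero polynomial, and these are
algebraically independent. -/
theorem eq_zero_of_forall_nodeSym {n : ℕ} {F : MvPolynomial (Fin n) ℂ}
    (h : ∀ x : Fin n → ℂ, Function.Injective x → aeval (nodeSym x) F = 0) : F = 0 := by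
  have h1 : aeval (fun k : Fin n => esymm (Fin n) ℂ ((k : ℕ) + 1)) F = 0 := by
    refine eq_zero_of_aeval_eq_zero_of_ne
      (H := ∏ v : Fin n, ∏ w ∈ Finset.univ.erase v, (X v - X w)) ?_ ?_
    · refine Finset.prod_ne_zero_iff.2 fun v _ => Finset.prod_ne_zero_iff.2 fun w hw => ?_
      exact sub_ne_zero.2 fun h => (Finset.ne_of_mem_erase hw).symm (X_injective h)
    · intro x hx
      rw [← h x]
      · rw [← AlgHom.comp_apply, comp_aeval]; rfl
      · intro v w hvw
        by_contra hne
        refine hx ?_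
        rw [map_prod]
        refine Finset.prod_eq_zero (Finset.mem_univ v) ?_
        rw [map_prod]
        refine Finset.prod_eq_zero (Finset.mem_erase.2 ⟨Ne.symm hne, Finset.mem_univ w⟩) ?_
        simp [hvw]
  refine (esymmAlgHom_injective (σ := Fin n) (R := ℂ) (n := n) (by simp)) ?_
  rw [map_zero]
  refine Subtype.ext ?_
  rw [esymmAlgHom_apply, h1]; rfl

/-- The coefficient vector with top row `q` of the Bezoutian of the polynomial with
elementary symmetric functions `s`. -/
def bezPoint {R : Type*} [CommRing R] (d : ℕ) (q s : Fin (d + 1) → R) : CoeffIdx d → R :=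
  bezCoeff d (symCoeff s) (lowCoeff q)

theorem bezPoint_top {R : Type*} [CommRing R] {d : ℕ} (q s : Fin (d + 1) → R)
    (j : Fin (d + 1)) : bezPoint d q s (idx (Fin.last d) j) = q j :=
  bezCoeff_top (symCoeff_self s) (fun _ hk => symCoeff_of_lt s hk) q j

theorem map_bezPoint {R S F : Type*} [CommRing R] [CommRing S] [FunLike F R S]
    [RingHomClass F R S] {d : ℕ} (f : F) (q s : Fin (d + 1) → R) (v : CoeffIdx d) :
    f (bezPoint d q s v) = bezPoint d (fun i => f (q i)) (fun i => f (s i)) v := by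
  simp only [bezPoint, map_bezCoeff, map_symCoeff, map_lowCoeff]

/-- For fixed `q` the value of `F` is a polynomial in `s` that vanishes whenever `s` comes from
distinct nodes, hence identically. The points to be tested are thereby parametrized by an affine
space. -/
theorem mem_symIdealK {d : ℕ} (F : SymRing d) :
    F ∈ symIdealK d ↔ ∀ q s : Fin (d + 1) → ℂ, aeval (Sum.elim (bezPoint d q s) s) F = 0 := by
  have hsub : ∀ (b : CoeffIdx d → ℂ) (x : Fin (d + 1) → ℂ),
      aeval (Sum.elim b x) (symSubst d F) = aeval (Sum.elim b (nodeSym x)) F := by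
    intro b x
    rw [symSubst, ← AlgHom.comp_apply, comp_aeval]
    congr 2
    funext i
    rcases i with v | k
    · simp
    · simp [aeval_rename, nodeSym]
  rw [symIdealK, Ideal.mem_comap]
  refine Iff.trans (mem_graphIdeal _ _) ?_
  simp only [hsub, genericCoeff, aeval_X]
  constructor
  · intro h q s
    have h0 : aeval (Sum.elim (bezPoint d (fun j => C (q j)) X) X : _ → MvPolynomial _ ℂ) F =
        0 := by
      refine eq_zero_of_forall_nodeSym fun x hx => ?_
      have := h (bezPoint d q (nodeSym x)) x hx (by simp only [bezPoint_top]; rfl)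
      rw [← this, ← AlgHom.comp_apply, comp_aeval]
      congr 2
      funext i
      rcases i with v | k
      · simp [map_bezPoint]
      · simp
    have := congrArg (aeval s) h0
    rw [← AlgHom.comp_apply, comp_aeval, map_zero] at this
    rw [← this]
    congr 2
    funext i
    rcases i with v | k
    · simp [map_bezPoint]
    · simp
  · intro h b x _ hb
    rw [show b = bezPoint d _ (nodeSym x) from hb]
    exact h _ _

theorem elimCoeff_symIdealK (d : ℕ) : elimCoeff (symIdealK d) = charIdealK d := by
  have : (symSubst d).toRingHom.comp (rename Sum.inl).toRingHom =
      (rename Sum.inl : MvPolynomial (CoeffIdx d) ℂ →ₐ[ℂ] _).toRingHom := by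
    have : (symSubst d).comp (rename Sum.inl) =
      (rename Sum.inl : MvPolynomial (CoeffIdx d) ℂ →ₐ[ℂ] _) := by
      ext v; simp [symSubst]
    exact congrArg AlgHom.toRingHom this
  ext f
  simp only [elimCoeff, symIdealK, charIdealK, charIdeal, Ideal.mem_comap]
  rw [show symSubst d (rename Sum.inl f) = rename Sum.inl f from
    congrArg (fun g => g f) this]

theorem mem_charIdealK {d : ℕ} (f : MvPolynomial (CoeffIdx d) ℂ) :
    f ∈ charIdealK d ↔ ∀ q s : Fin (d + 1) → ℂ, aeval (bezPoint d q s) f = 0 := by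
  rw [← elimCoeff_symIdealK, elimCoeff, Ideal.mem_comap]
  refine (mem_symIdealK _).trans ?_
  simp [aeval_rename]

/-- The top row of the Bezoutian is `q`, so the vanishing of a top-row coefficient is a condition on
`q` alone. Density is applied in `s` with `q` fixed and is not affected by it. -/
theorem mem_charIdealKReduced {d : ℕ} (j : Fin (d + 1))
    (f : MvPolynomial {v : CoeffIdx d // v ≠ idx (Fin.last d) j} ℂ) :
    f ∈ charIdealKReduced d (idx (Fin.last d) j) ↔ ∀ q s : Fin (d + 1) → ℂ, q j = 0 →
      aeval (fun v : {v : CoeffIdx d // v ≠ idx (Fin.last d) j} => bezPoint d q s v) f = 0 := by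
  have hA : ∀ (b : {v : CoeffIdx d // v ≠ idx (Fin.last d) j} → ℂ) (u : CoeffIdx d),
      aeval b (reducedCoeff d (idx (Fin.last d) j) u) =
        if h : u = idx (Fin.last d) j then 0 else b ⟨u, h⟩ := by
    intro b u
    rw [reducedCoeff]
    split_ifs <;> simp
  rw [charIdealKReduced, charIdeal, Ideal.mem_comap]
  refine Iff.trans (mem_graphIdeal _ _) ?_
  simp only [hA, aeval_rename, Sum.elim_comp_inl]
  constructor
  · intro h q s hq
    have h0 : aeval (fun v : {v : CoeffIdx d // v ≠ idx (Fin.last d) j} =>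
        bezPoint d (fun j => C (q j)) X v.1 : _ → MvPolynomial (Fin (d + 1)) ℂ) f = 0 := by
      refine eq_zero_of_forall_nodeSym fun x hx => ?_
      -- Filling in zero at the omitted coefficient gives back the full Bezoutian, because `q j =
      -- 0`.
      have hrow : ∀ u : CoeffIdx d, (if _h : u = idx (Fin.last d) j then (0 : ℂ) else
          bezPoint d q (nodeSym x) u) = bezPoint d q (nodeSym x) u := by
        intro u
        split_ifs with hu
        · rw [hu, bezPoint_top, hq]
        · rfl
      have := h (fun v => bezPoint d q (nodeSym x) v) x hx
        ((funext hrow).trans (congrArg (fun r => bezCoeff d (symCoeff (nodeSym x)) (lowCoeff r))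
          (funext fun i => ((hrow _).trans (bezPoint_top q _ i)).symm)))
      rw [← this, ← AlgHom.comp_apply, comp_aeval]
      congr 2
      funext i
      simp [map_bezPoint]
    have := congrArg (aeval s) h0
    rw [← AlgHom.comp_apply, comp_aeval, map_zero] at this
    rw [← this]
    congr 2
    funext i
    simp [map_bezPoint]
  · intro h b x _ hb
    have hb' : b = fun v => bezPoint d (fun i => if h : idx (Fin.last d) i = idx (Fin.last d) j
        then 0 else b ⟨idx (Fin.last d) i, h⟩) (nodeSym x) v.1 := by
      funext v
      have := congrFun hb v.1
      rw [dif_neg v.2] at this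
      exact this
    rw [hb']
    exact h _ _ (by simp)

/-! ### The conjecture for complete graphs -/

theorem polyGraph_adj {d : ℕ} {c : CoeffIdx d → ℂ} {u v : ℂ} :
    (polyGraph c).Adj u v ↔ u ≠ v ∧ phiVal c u v = 0 := by
  simp only [polyGraph, SimpleGraph.fromRel_adj, Polynomial.IsRoot, eval_phiAt]
  rw [phiVal_comm c v u, or_self]

/-- One clique of size `d + 1` puts `Φ` in Bezoutian form. Adjacency then says that the vectors `(P,
Q)` at two points are proportional, an equivalence relation away from common zeros. -/
theorem conjectureFor_top {d : ℕ} (hd : 0 < d) :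
    ConjectureFor d (⊤ : SimpleGraph (Fin (d + 1))) := by
  rintro c - ⟨C₀, -, ⟨e⟩⟩ C hC
  set x : Fin (d + 1) → ℂ := fun v => (e.symm v).1 with hxdef
  have hx : Function.Injective x := fun v w h => e.symm.injective (Subtype.ext h)
  have hclique : ∀ v w, v ≠ w → phiVal c (x v) (x w) = 0 := by
    intro v w hvw
    have h1 : (⊤ : SimpleGraph (Fin (d + 1))).Adj v w := hvw
    have h2 := e.symm.map_rel_iff.2 h1
    have h3 : (polyGraph c).Adj (x v) (x w) := h2
    exact (polyGraph_adj.1 h3).2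
  have hB := sub_mul_phiVal_of_clique hx hclique
  set P := nodePoly x
  set Q := topPoly c
  -- At a common zero of `P` and `Q` the polynomial `Φ(w, y)` is identically zero, so `w` is
  -- defective; here `0 < d` matters.
  have hns : ∀ w, ¬ IsSingularVertex c w → P.eval w ≠ 0 ∨ Q.eval w ≠ 0 := by
    intro w hw
    by_contra! h
    refine hw (Or.inr (Or.inr ?_))
    have h0 : phiAt c w = 0 := by
      refine Polynomial.eq_of_infinite_eval_eq _ _ ?_
      refine Set.Infinite.mono (s := {w}ᶜ) ?_ (Set.finite_singleton w).infinite_compl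
      intro y hy
      have h1 := hB w y
      rw [h.1, h.2] at h1
      simp only [Set.mem_ofPred_eq, eval_phiAt, Polynomial.eval_zero]
      exact (mul_eq_zero.1 (h1.trans (by ring))).resolve_left
        (sub_ne_zero.2 fun h => hy h.symm)
    rwa [h0, Polynomial.natDegree_zero]
  have hadj : ∀ {u w}, (polyGraph c).Adj u w ↔
      u ≠ w ∧ P.eval u * Q.eval w - P.eval w * Q.eval u = 0 := by
    intro u w
    rw [polyGraph_adj, ← hB]
    refine and_congr_right fun h => ?_
    rw [mul_eq_zero, sub_eq_zero]
    exact ⟨Or.inr, fun h' => h'.resolve_left h⟩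
  -- Proportionality passes along a walk, since the vector `(P, Q)` at the intermediate vertex is
  -- nonzero.
  have hwalk : ∀ {u w : ℂ} (_ : (polyGraph c).Walk u w),
      (∀ z, (polyGraph c).Reachable u z → ¬ IsSingularVertex c z) →
        P.eval u * Q.eval w - P.eval w * Q.eval u = 0 := by
    intro u w p
    induction p with
    | nil => intro _; ring
    | @cons u v w h p ih =>
      intro hz
      have h1 := ih fun z hvz => hz z (h.reachable.trans hvz)
      have h2 := (hadj.1 h).2
      rcases hns v (hz v h.reachable) with h3 | h3
      · refine (mul_eq_zero.1 (?_ : P.eval v * _ = 0)).resolve_left h3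
        linear_combination P.eval u * h1 + P.eval w * h2
      · refine (mul_eq_zero.1 (?_ : Q.eval v * _ = 0)).resolve_left h3
        linear_combination Q.eval u * h1 + Q.eval w * h2
  obtain ⟨u, rfl⟩ := C.exists_rep
  have hreach : ∀ {w}, w ∈ ((polyGraph c).connectedComponentMk u).supp ↔
      (polyGraph c).Reachable u w := by
    intro w
    rw [SimpleGraph.ConnectedComponent.mem_supp_iff, SimpleGraph.ConnectedComponent.eq]
    exact ⟨fun h => h.symm, fun h => h.symm⟩
  have hall : ∀ {v w}, (polyGraph c).Reachable u v → (polyGraph c).Reachable u w → v ≠ w →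
      (polyGraph c).Adj v w := by
    intro v w hv hw hvw
    obtain ⟨p⟩ := hv.symm.trans hw
    exact hadj.2 ⟨hvw, hwalk p fun z hz => hC z (hreach.2 (hv.trans hz))⟩
  have hu : ¬ IsSingularVertex c u := hC u (hreach.2 (SimpleGraph.Reachable.refl u))
  simp only [IsSingularVertex, not_or, not_not, not_lt] at hu
  have hne : phiAt c u ≠ 0 := by
    intro h
    rw [h, Polynomial.natDegree_zero] at hu
    omega
  have hsupp : ((polyGraph c).connectedComponentMk u).supp =
      ((insert u (phiAt c u).roots.toFinset : Finset ℂ) : Set ℂ) := by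
    ext w
    rw [hreach, Finset.mem_coe, Finset.mem_insert, Multiset.mem_toFinset,
      Polynomial.mem_roots hne, Polynomial.IsRoot, eval_phiAt]
    constructor
    · intro h
      by_cases hw : w = u
      · exact Or.inl hw
      · exact Or.inr (polyGraph_adj.1 (hall (SimpleGraph.Reachable.refl u) h (Ne.symm hw))).2
    · rintro (rfl | h)
      · exact SimpleGraph.Reachable.refl _
      · by_cases hw : u = w
        · rw [hw]
        · exact (polyGraph_adj.2 ⟨hw, h⟩).reachable
  -- The vertex `u` together with the roots of `Φ(u, y)`: these are `d` in number (not defective),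
  -- distinct (no multiple arc) and different from `u` (no loop).
  have hcard : Nat.card ((polyGraph c).connectedComponentMk u).supp = d + 1 := by
    rw [hsupp, Nat.card_coe_set_eq, Set.ncard_coe_finset, Finset.card_insert_of_notMem,
      Multiset.toFinset_card_of_nodup hu.2.1,
      ← (IsAlgClosed.splits (phiAt c u)).natDegree_eq_card_roots]
    · have := natDegree_phiAt_le c u
      omega
    · rw [Multiset.mem_toFinset, Polynomial.mem_roots hne]
      exact hu.1
  have hfin : Finite ((polyGraph c).connectedComponentMk u).supp := by
    rw [hsupp]; infer_instance
  set E : ((polyGraph c).connectedComponentMk u).supp ≃ Fin (d + 1) :=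
    (Finite.equivFin _).trans (finCongr hcard)
  refine ⟨⟨E, ?_⟩⟩
  intro v w
  constructor
  · intro h
    exact hall (hreach.1 v.2) (hreach.1 w.2) fun hvw => h (by rw [Subtype.ext hvw])
  · intro h
    have h' : (polyGraph c).Adj v.1 w.1 := h
    exact fun heq => h'.ne (congrArg Subtype.val (E.injective heq))

/-! ### Krull dimension -/

section Dimension

theorem ringKrullDim_mvPolynomial_complex (ι : Type*) [Finite ι] :
    ringKrullDim (MvPolynomial ι ℂ) = (Nat.card ι : ℕ) := by
  rw [MvPolynomial.ringKrullDim_of_isNoetherianRing, ringKrullDim_eq_zero_of_field, zero_add]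

/-- Incomparability: contraction along an integral homomorphism is strictly monotone on primes. -/
theorem ringKrullDim_le_of_integral {A B : Type*} [CommRing A] [CommRing B] (f : A →+* B)
    (hf : f.IsIntegral) : ringKrullDim B ≤ ringKrullDim A := by
  algebraize [f]
  have : Algebra.IsIntegral A B := ⟨hf⟩
  refine Order.krullDim_le_of_strictMono (PrimeSpectrum.comap f) fun I J hIJ => ?_
  have h : I.asIdeal < J.asIdeal := hIJ
  exact Ideal.IsIntegral.comap_lt_comap (R := A) h

/-- The dimension of a finitely generated subalgebra of a polynomial ring in `m` variables is at
most `m`. -/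
theorem ringKrullDim_le_of_injective {R : Type} [CommRing R] [Algebra ℂ R] [Nontrivial R]
    [Algebra.FiniteType ℂ R] {ι : Type} [Finite ι] (f : R →ₐ[ℂ] MvPolynomial ι ℂ)
    (hf : Function.Injective f) : ringKrullDim R ≤ (Nat.card ι : ℕ) := by
  -- Noether normalization: `R` is integral over a polynomial ring in `s` variables, and its
  -- embedding into the target bounds `s` by transcendence degree.
  obtain ⟨s, g, hg, hgi⟩ := exists_integral_inj_algHom_of_fg ℂ R
  have h1 := trdeg_le_of_injective (f.comp g) (hf.comp hg)
  rw [MvPolynomial.trdeg_of_isDomain, MvPolynomial.trdeg_of_isDomain] at h1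
  simp only [Cardinal.mk_fin, Cardinal.lift_id] at h1
  rw [← Nat.cast_card (α := ι), Nat.cast_le] at h1
  refine (ringKrullDim_le_of_integral g.toRingHom hgi).trans ?_
  rw [ringKrullDim_mvPolynomial_complex, Nat.card_fin]
  exact_mod_cast h1

end Dimension

/-! ### Normalized representatives of a Bezoutian -/

section Normalize

variable {R : Type*} [CommRing R] {n : ℕ}

/-- The coefficients `symCoeff s`, with the constant term replaced by `t`. -/
def tCoeff (t : R) (s : Fin n → R) (k : ℕ) : R := if k = 0 then t else symCoeff s k

theorem map_tCoeff {S F : Type*} [CommRing S] [FunLike F R S] [RingHomClass F R S] (f : F)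
    (t : R) (s : Fin n → R) (k : ℕ) :
    f (tCoeff t s k) = tCoeff (f t) (fun i => f (s i)) k := by
  unfold tCoeff
  split_ifs
  · rfl
  · exact map_symCoeff f s k

theorem exists_eq_symCoeff {p : ℕ → R} (h1 : p n = 1) (h2 : ∀ k, n < k → p k = 0) :
    ∃ s : Fin n → R, p = symCoeff s := by
  refine ⟨fun k => (-1) ^ ((k : ℕ) + 1) * p (n - 1 - k), ?_⟩
  funext k
  rcases lt_trichotomy k n with h | h | h
  · rw [symCoeff, if_neg (by omega), dif_pos h, ← mul_assoc]
    have e1 : n - k - 1 + 1 = n - k := by omega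
    have e2 : n - 1 - (n - k - 1) = k := by omega
    simp only [e1, e2]
    rw [← mul_pow]; simp
  · rw [h, h1, symCoeff_self]
  · rw [h2 k h, symCoeff_of_lt _ h]

theorem tCoeff_congr {d : ℕ} {t : R} {s s' : Fin (d + 1) → R}
    (h : ∀ k, k ≠ Fin.last d → s k = s' k) : tCoeff t s = tCoeff t s' := by
  funext k
  unfold tCoeff symCoeff
  split_ifs with h0 h1 h2
  · rfl
  · rfl
  · rw [h _ fun h => by have := congrArg Fin.val h; simp at this; omega]
  · rfl

theorem symCoeff_zero {d : ℕ} (s : Fin (d + 1) → R) :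
    symCoeff s 0 = (-1) ^ (d + 1) * s (Fin.last d) := by
  have := symCoeff_val s 0
  simpa using this

theorem symCoeff_last {d : ℕ} (s : Fin (d + 1) → R) : symCoeff s d = - s 0 := by
  have := symCoeff_val s (Fin.last d)
  simpa using this

theorem tCoeff_eq_symCoeff {d : ℕ} (s : Fin (d + 1) → R) :
    tCoeff ((-1) ^ (d + 1) * s (Fin.last d)) s = symCoeff s := by
  funext k
  unfold tCoeff
  split_ifs with h
  · rw [h, symCoeff_zero]
  · rfl

theorem exists_tCoeff_eq {d : ℕ} (t : R) (s : Fin (d + 1) → R) :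
    ∃ s' : Fin (d + 1) → R, tCoeff t s = symCoeff s' := by
  refine exists_eq_symCoeff ?_ ?_
  · rw [tCoeff, if_neg (Nat.succ_ne_zero d), symCoeff_self]
  · intro k hk
    rw [tCoeff, if_neg (by omega), symCoeff_of_lt _ hk]

/-- `P + tQ` is again monic of degree `d + 1`, and the Bezoutian is alternating. These families of
`s` over one coefficient vector are the reason why the top variable is free. -/
theorem exists_bezPoint_eq {d : ℕ} (q s : Fin (d + 1) → R) (t : R) :
    ∃ s', (∀ k, symCoeff s' k = symCoeff s k + t * lowCoeff q k) ∧
      bezPoint d q s' = bezPoint d q s := by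
  obtain ⟨s', hs'⟩ := exists_eq_symCoeff (n := d + 1)
    (p := fun k => symCoeff s k + t * lowCoeff q k)
    (by rw [symCoeff_self, lowCoeff_of_le q le_rfl]; ring)
    (fun k hk => by rw [symCoeff_of_lt s hk, lowCoeff_of_le q hk.le]; ring)
  refine ⟨s', fun k => (congrFun hs' k).symm, ?_⟩
  funext v
  rw [bezPoint, ← hs', bezPoint, bezCoeff, bez_add_smul, bezCoeff]

end Normalize

/-! ### Primality and dimension of the characteristic ideal -/

/-- Density in `q` with `s` fixed. It allows division by a nonzero polynomial in the top row when
`P` is normalized. -/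
theorem mem_charIdealK_of_ne {d : ℕ} {H : MvPolynomial (Fin (d + 1)) ℂ} (hH : H ≠ 0)
    {f : MvPolynomial (CoeffIdx d) ℂ}
    (h : ∀ q s : Fin (d + 1) → ℂ, aeval q H ≠ 0 → aeval (bezPoint d q s) f = 0) :
    f ∈ charIdealK d := by
  rw [mem_charIdealK]
  intro q s
  have h0 : aeval (bezPoint d X fun k => C (s k) : _ → MvPolynomial (Fin (d + 1)) ℂ) f = 0 := by
    refine eq_zero_of_aeval_eq_zero_of_ne hH fun q hq => ?_
    rw [← h q s hq, ← AlgHom.comp_apply, comp_aeval]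
    congr 2
    funext i
    simp [map_bezPoint]
  have := congrArg (aeval q) h0
  rw [← AlgHom.comp_apply, comp_aeval, map_zero] at this
  rw [← this]
  congr 2
  funext i
  simp [map_bezPoint]

/-- The characteristic ideal vanishes at all Bezoutians with values in a polynomial ring. -/
theorem aeval_bezPoint_of_mem {d : ℕ} {f : MvPolynomial (CoeffIdx d) ℂ} (hf : f ∈ charIdealK d)
    {σ : Type*} (q s : Fin (d + 1) → MvPolynomial σ ℂ) : aeval (bezPoint d q s) f = 0 := by
  refine MvPolynomial.funext fun x => ?_
  have := (mem_charIdealK f).1 hf (fun i => aeval x (q i)) (fun i => aeval x (s i))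
  rw [map_zero, ← this]
  change aeval x _ = _
  rw [← AlgHom.comp_apply, comp_aeval]
  congr 2
  funext i
  simp [map_bezPoint]

theorem charIdealK_isPrime (d : ℕ) : (charIdealK d).IsPrime := by
  have : charIdealK d = RingHom.ker (aeval (bezPoint d (fun i => X (Sum.inl i))
      (fun i => X (Sum.inr i))) : MvPolynomial (CoeffIdx d) ℂ →ₐ[ℂ]
        MvPolynomial (Fin (d + 1) ⊕ Fin (d + 1)) ℂ) := by
    ext f
    rw [RingHom.mem_ker]
    refine ⟨fun h => aeval_bezPoint_of_mem h _ _, fun h => (mem_charIdealK f).2 fun q s => ?_⟩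
    have := congrArg (aeval (Sum.elim q s)) h
    rw [← AlgHom.comp_apply, comp_aeval, map_zero] at this
    rw [← this]
    congr 2
    funext i
    simp [map_bezPoint]
  rw [this]
  exact RingHom.ker_isPrime _

theorem bez_col_zero {R : Type*} [CommRing R] {d : ℕ} (p q : ℕ → R) (k : Fin (d + 1)) :
    bezCoeff d p q (idx k 0) = p (k + 1) * q 0 - p 0 * q (k + 1) := by
  have h1 : max k 0 = k := max_eq_left (Fin.zero_le k)
  have h2 : min k 0 = 0 := min_eq_right (Fin.zero_le k)
  simp only [bezCoeff, idx, ofLex_toLex, h1, h2]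
  exact bez_zero_right p q k

/-- There are `2d + 2` parameters for `(P, Q)`, one of which is lost to `P ↦ P + λQ`. The upper
bound comes from the normalization `P(0) = 0`, the lower bound from the slice `a_{d0} = 1`. -/
theorem ringKrullDim_quotient_charIdealK (d : ℕ) :
    ringKrullDim (MvPolynomial (CoeffIdx d) ℂ ⧸ charIdealK d) = (2 * d + 1 : ℕ) := by
  have hprime := charIdealK_isPrime d
  apply le_antisymm
  · set s : Fin (d + 1) → MvPolynomial (Fin (d + 1) ⊕ Fin d) ℂ :=
      fun k => if h : (k : ℕ) < d then X (Sum.inr ⟨k, h⟩) else 0 with hs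
    set q : Fin (d + 1) → MvPolynomial (Fin (d + 1) ⊕ Fin d) ℂ := fun k => X (Sum.inl k) with hq
    set F : MvPolynomial (CoeffIdx d) ℂ →ₐ[ℂ] MvPolynomial (Fin (d + 1) ⊕ Fin d) ℂ :=
      aeval (bezCoeff d (tCoeff 0 s) (lowCoeff q)) with hF
    have hker : ∀ f, f ∈ charIdealK d ↔ F f = 0 := by
      intro f
      obtain ⟨s', hs'⟩ := exists_tCoeff_eq 0 s
      constructor
      · intro h
        rw [hF, hs']
        exact aeval_bezPoint_of_mem h q s'
      · intro h
        refine mem_charIdealK_of_ne (H := X 0) (X_ne_zero _) fun q₁ s₁ hq₁ => ?_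
        rw [aeval_X] at hq₁
        -- This multiple of `Q` kills the constant term of `P`.
        obtain ⟨s₂, h2, h3⟩ := exists_bezPoint_eq q₁ s₁ (- symCoeff s₁ 0 / q₁ 0)
        have h4 : symCoeff s₂ 0 = 0 := by
          have : lowCoeff q₁ 0 = q₁ 0 := lowCoeff_val q₁ 0
          rw [h2, this]; field_simp; ring
        have := congrArg (aeval (Sum.elim q₁ fun k => s₂ k.castSucc)) h
        rw [hF, ← AlgHom.comp_apply, comp_aeval, map_zero] at this
        rw [← h3, ← this]
        congr 2
        funext v
        rw [map_bezCoeff, bezPoint]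
        congr 1
        · funext k
          rw [map_tCoeff, map_zero, tCoeff_congr (s' := s₂)]
          · unfold tCoeff
            split_ifs with h0
            · rw [h0, h4]
            · rfl
          · intro k hk
            have hkd : (k : ℕ) < d := by
              have := k.2
              have : (k : ℕ) ≠ d := fun h => hk (Fin.ext h)
              omega
            simp [hs, hkd]
        · funext k
          rw [map_lowCoeff]
          congr 1
          funext i
          simp [hq]
    have hinj : Function.Injective (Ideal.Quotient.liftₐ (charIdealK d) F
        fun f hf => (hker f).1 hf) := by
      rw [injective_iff_map_eq_zero]
      intro x hx
      obtain ⟨f, rfl⟩ := Ideal.Quotient.mk_surjective x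
      rw [Ideal.Quotient.eq_zero_iff_mem, hker]
      exact hx
    have := ringKrullDim_le_of_injective _ hinj
    refine this.trans (le_of_eq ?_)
    rw [Nat.card_sum, Nat.card_fin, Nat.card_fin]
    congr 1; omega
  · set q : Fin (d + 1) → MvPolynomial (Fin d ⊕ Fin d) ℂ :=
      Fin.cons 1 fun k => X (Sum.inl k) with hq
    set s : Fin (d + 1) → MvPolynomial (Fin d ⊕ Fin d) ℂ :=
      fun k => if h : (k : ℕ) < d then X (Sum.inr ⟨k, h⟩) else 0 with hs
    have hs0 : symCoeff s 0 = 0 := by rw [symCoeff_zero]; simp [hs]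
    have hq0 : lowCoeff q 0 = 1 := lowCoeff_val q 0
    set F : (MvPolynomial (CoeffIdx d) ℂ ⧸ charIdealK d) →ₐ[ℂ] MvPolynomial (Fin d ⊕ Fin d) ℂ :=
      Ideal.Quotient.liftₐ (charIdealK d) (aeval (bezPoint d q s))
        fun f hf => aeval_bezPoint_of_mem hf q s with hF
    have hFX : ∀ v, F (Ideal.Quotient.mk _ (X v)) = bezPoint d q s v := fun v => by
      rw [hF]; exact aeval_X _ _
    -- With `q_0 = 1` and `p_0 = 0` the column of the `a_{k0}` consists of the coefficients of `P`,
    -- and the top row of those of `Q`, so all free parameters are in the image.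
    have hsurj : Function.Surjective F := by
      rw [← AlgHom.range_eq_top, ← top_le_iff, ← MvPolynomial.adjoin_range_X, Algebra.adjoin_le_iff]
      rintro _ ⟨k | k, rfl⟩
      · refine ⟨Ideal.Quotient.mk _ (X (idx (Fin.last d) k.succ)), ?_⟩
        refine (hFX _).trans ?_
        rw [bezPoint_top]; simp [hq]
      · refine ⟨(-1) ^ ((k : ℕ) + 1) *
          Ideal.Quotient.mk _ (X (idx (⟨d - 1 - k, by omega⟩ : Fin (d + 1)) 0)), ?_⟩
        refine (map_mul F _ _).trans ?_
        rw [hFX, bezPoint, bez_col_zero, hs0, hq0]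
        have h1 : symCoeff s (d - 1 - k + 1) = (-1) ^ ((k : ℕ) + 1) * X (Sum.inr k) := by
          have hk := k.2
          rw [symCoeff, if_neg (by omega), dif_pos (by omega)]
          have e1 : d + 1 - (d - 1 - (k : ℕ) + 1) = k + 1 := by omega
          simp only [e1]
          congr 1
          simp [hs]
        simp only [h1, map_pow, map_neg, map_one]
        simp only [mul_one, zero_mul, sub_zero]
        rw [← mul_assoc, ← mul_pow]
        simp
    -- The element `a_{d0} - 1` is nonzero in the quotient domain and lies in the kernel of `F`, so
    -- the dimension exceeds `2d`.
    have h := ringKrullDim_succ_le_of_surjective F.toRingHom hsurj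
      (r := Ideal.Quotient.mk _ (X (idx (Fin.last d) 0) - 1)) ?_ ?_
    · rw [ringKrullDim_mvPolynomial_complex, Nat.card_sum, Nat.card_fin] at h
      refine le_trans (le_of_eq ?_) h
      rw [two_mul]; push_cast; ring
    · refine mem_nonZeroDivisors_of_ne_zero ?_
      rw [Ne, Ideal.Quotient.eq_zero_iff_mem, mem_charIdealK]
      intro h
      have := h 0 0
      rw [map_sub, aeval_X, bezPoint_top] at this
      simp at this
    · change F _ = 0
      rw [map_sub, map_sub, hFX, bezPoint_top, map_one, map_one]
      simp [hq]

/-! ### The systems in the elementary symmetric functions -/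

theorem aeval_X_comp {σ τ : Type*} (f : σ → τ) (p : MvPolynomial σ ℂ) :
    aeval (fun i => (X (f i) : MvPolynomial τ ℂ)) p = rename f p := by
  rw [← aeval_X_left_apply (rename f p), aeval_rename]; rfl

/-- The coefficient vector, with top row `a_{d0}, …, a_{dd}`, of the Bezoutian of the monic
polynomial with elementary symmetric functions `s_k` and with constant term replaced by `t`. -/
noncomputable def bezVec {d : ℕ} (t : SymRing d) : CoeffIdx d → SymRing d :=
  bezCoeff d (tCoeff t fun k => X (Sum.inr k)) (lowCoeff fun j => X (Sum.inl (idx (Fin.last d) j)))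

/-- The equations for the coefficients of a Bezoutian outside the top row. -/
def bezSystem {d : ℕ} (t : SymRing d) : Set (SymRing d) :=
  {f | ∃ v : CoeffIdx d, (ofLex v.1).1 ≠ Fin.last d ∧ f = X (Sum.inl v) - bezVec t v}

theorem tCoeff_top {R : Type*} [CommRing R] {d : ℕ} (t : R) (s : Fin (d + 1) → R)
    (q : Fin (d + 1) → R) (j : Fin (d + 1)) :
    bezCoeff d (tCoeff t s) (lowCoeff q) (idx (Fin.last d) j) = q j := by
  obtain ⟨s', hs'⟩ := exists_tCoeff_eq t s
  rw [hs']
  exact bezPoint_top q s' j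

/-- The parametrization of the zero set of `bezSystem t` by the top row and the `s_k`. -/
noncomputable def bezParam {d : ℕ} (T : MvPolynomial (Fin (d + 1)) ℂ) :
    SymRing d →ₐ[ℂ] MvPolynomial (Fin (d + 1) ⊕ Fin (d + 1)) ℂ :=
  aeval (Sum.elim (bezCoeff d (tCoeff (rename Sum.inr T) fun k => X (Sum.inr k))
    (lowCoeff fun j => X (Sum.inl j))) fun k => X (Sum.inr k))

theorem bezParam_top {d : ℕ} (T : MvPolynomial (Fin (d + 1)) ℂ) (j : Fin (d + 1)) :
    bezParam T (X (Sum.inl (idx (Fin.last d) j))) = X (Sum.inl j) := by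
  rw [bezParam, aeval_X, Sum.elim_inl, tCoeff_top]

theorem bezParam_sym {d : ℕ} (T : MvPolynomial (Fin (d + 1)) ℂ) (k : Fin (d + 1)) :
    bezParam T (X (Sum.inr k)) = X (Sum.inr k) := by
  rw [bezParam, aeval_X, Sum.elim_inr]

theorem bezParam_surjective {d : ℕ} (T : MvPolynomial (Fin (d + 1)) ℂ) :
    Function.Surjective (bezParam T) := by
  rw [← AlgHom.range_eq_top, ← top_le_iff, ← MvPolynomial.adjoin_range_X, Algebra.adjoin_le_iff]
  rintro _ ⟨k | k, rfl⟩
  · exact ⟨_, bezParam_top T k⟩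
  · exact ⟨_, bezParam_sym T k⟩

/-- The equations solve for the coefficients outside the top row. Modulo them, every polynomial
equals its image under `bezParam` with the free variables put back by `ψ`. -/
theorem span_bezSystem {d : ℕ} (T : MvPolynomial (Fin (d + 1)) ℂ) :
    Ideal.span (bezSystem (rename Sum.inr T)) = RingHom.ker (bezParam T) := by
  have hren : bezParam T (rename Sum.inr T) = rename Sum.inr T := by
    rw [bezParam, aeval_rename, Sum.elim_comp_inr, aeval_X_comp]
  apply le_antisymm
  · rw [Ideal.span_le]
    rintro _ ⟨v, -, rfl⟩
    rw [SetLike.mem_coe, RingHom.mem_ker, map_sub, sub_eq_zero, bezVec, map_bezCoeff]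
    simp only [map_tCoeff, map_lowCoeff, bezParam_top, bezParam_sym, hren]
    rw [bezParam, aeval_X, Sum.elim_inl]
  · set ψ : MvPolynomial (Fin (d + 1) ⊕ Fin (d + 1)) ℂ →ₐ[ℂ] SymRing d :=
      aeval (Sum.elim (fun j => X (Sum.inl (idx (Fin.last d) j))) fun k => X (Sum.inr k)) with hψ
    set π := Ideal.Quotient.mkₐ ℂ (Ideal.span (bezSystem (rename Sum.inr T : SymRing d)))
    have h0 : π.comp (ψ.comp (bezParam T)) = π := by
      refine MvPolynomial.algHom_ext fun i => ?_
      simp only [AlgHom.comp_apply]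
      rcases i with v | k
      · by_cases hv : (ofLex v.1).1 = Fin.last d
        · rw [← idx_eta v, hv, bezParam_top, hψ, aeval_X, Sum.elim_inl]
        · symm
          refine (Ideal.Quotient.mk_eq_mk_iff_sub_mem _ _).2 (Ideal.subset_span ⟨v, hv, ?_⟩)
          congr 1
          rw [bezParam, aeval_X, Sum.elim_inl, map_bezCoeff, bezVec]
          have : ψ (rename Sum.inr T) = rename Sum.inr T := by
            rw [hψ, aeval_rename, Sum.elim_comp_inr, aeval_X_comp]
          simp only [map_tCoeff, map_lowCoeff, this]
          simp [hψ]
      · rw [bezParam_sym, hψ, aeval_X, Sum.elim_inr]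
    intro f hf
    have := congrArg (fun g => g f) h0
    simp only [AlgHom.comp_apply] at this
    rw [RingHom.mem_ker.1 hf, map_zero, map_zero] at this
    exact Ideal.Quotient.eq_zero_iff_mem.1 this.symm

theorem mem_ker_bezParam {d : ℕ} (T : MvPolynomial (Fin (d + 1)) ℂ) (F : SymRing d) :
    F ∈ RingHom.ker (bezParam T) ↔ ∀ q s : Fin (d + 1) → ℂ,
      aeval (Sum.elim (bezCoeff d (tCoeff (aeval s T) s) (lowCoeff q)) s) F = 0 := by
  have h0 : ∀ q s : Fin (d + 1) → ℂ, aeval (Sum.elim q s) (bezParam T F) =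
      aeval (Sum.elim (bezCoeff d (tCoeff (aeval s T) s) (lowCoeff q)) s) F := by
    intro q s
    rw [bezParam, ← AlgHom.comp_apply, comp_aeval]
    congr 2
    funext i
    rcases i with v | k
    · simp only [Sum.elim_inl, map_bezCoeff]
      simp only [map_tCoeff, map_lowCoeff, aeval_rename, aeval_X, Sum.elim_inl, Sum.elim_inr,
        Sum.elim_comp_inr]
    · simp
  rw [RingHom.mem_ker]
  constructor
  · intro h q s
    rw [← h0, h, map_zero]
  · intro h
    refine MvPolynomial.funext fun x => ?_
    have := h (x ∘ Sum.inl) (x ∘ Sum.inr)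
    rw [← h0, Sum.elim_comp_inl_inr] at this
    rw [map_zero, ← this]; rfl

/-- Polynomials in one more variable whose specializations at all points of a set vanish are
generated by the vanishing ideal of the set. -/
theorem mem_map_rename_inl {σ : Type*} {I : Ideal (MvPolynomial σ ℂ)} {V : Set (σ → ℂ)}
    (hI : ∀ f, (∀ a ∈ V, aeval a f = 0) → f ∈ I) {F : MvPolynomial (σ ⊕ Unit) ℂ}
    (hF : ∀ a ∈ V, ∀ t : ℂ, aeval (Sum.elim a fun _ => t) F = 0) :
    F ∈ I.map (rename Sum.inl : MvPolynomial σ ℂ →ₐ[ℂ] MvPolynomial (σ ⊕ Unit) ℂ) := by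
  -- `F` is read as a polynomial in the extra variable. At a point of `V` it vanishes for all values
  -- of that variable, so each of its coefficients vanishes there.
  have hP : ∀ F : MvPolynomial (σ ⊕ Unit) ℂ, ∃ P : Polynomial (MvPolynomial σ ℂ),
      F = P.eval₂ (rename Sum.inl : MvPolynomial σ ℂ →ₐ[ℂ] _).toRingHom (X (Sum.inr ())) := by
    intro F
    induction F using MvPolynomial.induction_on with
    | C a => exact ⟨Polynomial.C (C a), by simp⟩
    | add p q hp hq =>
      obtain ⟨P, rfl⟩ := hp
      obtain ⟨Q, rfl⟩ := hq
      exact ⟨P + Q, by rw [Polynomial.eval₂_add]⟩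
    | mul_X p i hp =>
      obtain ⟨P, rfl⟩ := hp
      rcases i with i | i
      · exact ⟨P * Polynomial.C (X i), by rw [Polynomial.eval₂_mul, Polynomial.eval₂_C]; simp⟩
      · exact ⟨P * Polynomial.X, by rw [Polynomial.eval₂_mul, Polynomial.eval₂_X]⟩
  obtain ⟨P, rfl⟩ := hP F
  rw [Polynomial.eval₂_eq_sum_range]
  refine Ideal.sum_mem _ fun k _ => Ideal.mul_mem_right _ _ (Ideal.mem_map_of_mem _ ?_)
  refine hI _ fun a ha => ?_
  have h0 : P.map (aeval a : MvPolynomial σ ℂ →ₐ[ℂ] ℂ).toRingHom = 0 := by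
    refine Polynomial.funext fun t => ?_
    rw [Polynomial.eval_zero, ← hF a ha t, Polynomial.eval_map]
    have := Polynomial.hom_eval₂ P (rename Sum.inl : MvPolynomial σ ℂ →ₐ[ℂ] _).toRingHom
      (aeval (Sum.elim a fun _ => t) : MvPolynomial (σ ⊕ Unit) ℂ →ₐ[ℂ] ℂ).toRingHom (X (Sum.inr ()))
    refine Eq.trans ?_ this.symm
    congr 1
    · ext <;> simp
    · simp
  have := congrArg (fun f => Polynomial.coeff f k) h0
  simpa using this

theorem map_elimCoeff_le {d : ℕ} (J : Ideal (SymRing d)) :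
    (elimCoeff J).map (rename Sum.inl : MvPolynomial (CoeffIdx d) ℂ →ₐ[ℂ]
      MvPolynomial (CoeffIdx d ⊕ Unit) ℂ) ≤ elimCoeffTop J := by
  rw [Ideal.map_le_iff_le_comap]
  intro f hf
  rw [elimCoeffTop, Ideal.mem_comap, Ideal.mem_comap, rename_rename]
  exact hf

/-- If `s_{d+1}` takes every value over each point of a set `V` large enough to determine the
characteristic ideal, then no further relation can involve it. The dimensions are `2d + 2`, from the
surjection onto a polynomial ring, and `2d + 1`. -/
theorem topFree_of {d : ℕ} {T : MvPolynomial (Fin (d + 1)) ℂ}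
    (h1 : elimCoeff (RingHom.ker (bezParam T)) = charIdealK d) {V : Set (CoeffIdx d → ℂ)}
    (hV : ∀ f, (∀ a ∈ V, aeval a f = 0) → f ∈ charIdealK d)
    (h2 : ∀ a ∈ V, ∀ t : ℂ, ∃ q s : Fin (d + 1) → ℂ, s (Fin.last d) = t ∧
      a = bezCoeff d (tCoeff (aeval s T) s) (lowCoeff q)) :
    TopFree (RingHom.ker (bezParam T)) := by
  refine ⟨le_antisymm ?_ (map_elimCoeff_le _), ?_⟩
  · intro F hF
    rw [h1]
    refine mem_map_rename_inl hV fun a ha t => ?_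
    obtain ⟨q, s, hs, rfl⟩ := h2 a ha t
    have := (mem_ker_bezParam T _).1 hF q s
    rw [aeval_rename] at this
    rw [← this]
    congr 2
    funext i
    rcases i with v | k
    · simp
    · simp [hs]
  · rw [h1, ringKrullDim_quotient_charIdealK, ringKrullDim_eq_of_ringEquiv
      (Ideal.quotientKerAlgEquivOfSurjective (bezParam_surjective T)).toRingEquiv,
      ringKrullDim_mvPolynomial_complex, Nat.card_sum, Nat.card_fin]
    rw [show d + 1 + (d + 1) = 2 * d + 1 + 1 by omega]
    push_cast; rfl

/-- A system consisting of the equations for the coefficients of a Bezoutian reduces to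
`s_1` as soon as the constant term is normalized by a multiple of `s_1`. -/
theorem reducesTo_of_eq_bezSystem {d : ℕ} (hd : 0 < d) {S : SymRing d → Set (SymRing d)}
    (hS : ∀ t, S t = bezSystem t) (e : ℂ) : ReducesTo S (C e + s 1) := by
  have hs1 : (s 1 : SymRing d) = X (Sum.inr 0) := rfl
  have hsd : (s (d + 1) : SymRing d) = X (Sum.inr (Fin.last d)) := by
    rw [s]
    congr 2
    ext; simp
  -- The assumption `0 < d` makes `s_1` different from `s_{d+1}`.
  have h0d : (0 : Fin (d + 1)) ≠ Fin.last d := fun h => by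
    have := congrArg Fin.val h; simp at this; omega
  set T₁ : MvPolynomial (Fin (d + 1)) ℂ := (-1) ^ (d + 1) * X (Fin.last d) with hT₁
  set T₂ : MvPolynomial (Fin (d + 1)) ℂ := C e + X 0 with hT₂
  have hS₁ : Ideal.span (S ((-1) ^ (d + 1) * s (d + 1))) = RingHom.ker (bezParam T₁) := by
    rw [hS, ← span_bezSystem, hsd, hT₁]; simp
  have hS₂ : Ideal.span (S (C e + s 1)) = RingHom.ker (bezParam T₂) := by
    rw [hS, ← span_bezSystem, hs1, hT₂]; simp
  have hT₁s : ∀ s : Fin (d + 1) → ℂ, tCoeff (aeval s T₁) s = symCoeff s := fun s => by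
    rw [← tCoeff_eq_symCoeff, hT₁]; simp
  have hT₂s : ∀ s : Fin (d + 1) → ℂ, aeval s T₂ = e + s 0 := fun s => by simp [hT₂]
  have hJ : symIdealK d = RingHom.ker (bezParam T₁) := by
    ext F
    rw [mem_ker_bezParam, mem_symIdealK]
    simp only [hT₁s, bezPoint]
  have helim : elimCoeff (RingHom.ker (bezParam T₁)) = charIdealK d := by
    rw [← hJ, elimCoeff_symIdealK]
  -- the normalization by `s_1`
  have hnorm : ∀ q s : Fin (d + 1) → ℂ, q 0 + q (Fin.last d) ≠ 0 →
      ∃ s', tCoeff (e + s' 0) s' = symCoeff s' ∧ bezPoint d q s' = bezPoint d q s := by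
    intro q s hq
    -- Since `s_1 = -p_d`, the normalization `p_0 = e + s_1` reads `p_0 + p_d = e`; the quotient is
    -- the solution for the multiplier of `Q`.
    obtain ⟨s', h1, h2⟩ := exists_bezPoint_eq q s
      ((e - symCoeff s 0 - symCoeff s d) / (q 0 + q (Fin.last d)))
    refine ⟨s', ?_, h2⟩
    have e0 := h1 0
    have e1 := h1 d
    rw [show lowCoeff q 0 = q 0 from lowCoeff_val q 0] at e0
    rw [show lowCoeff q d = q (Fin.last d) from lowCoeff_val q (Fin.last d),
      symCoeff_last s'] at e1
    funext k
    unfold tCoeff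
    split_ifs with hk
    · rw [hk]
      have : symCoeff s' 0 - s' 0 = e := by
        rw [sub_eq_add_neg, e0, e1]; field_simp; ring
      linear_combination -this
    · rfl
  have hlin : (X 0 + X (Fin.last d) : MvPolynomial (Fin (d + 1)) ℂ) ≠ 0 := fun h => by
    have := congrArg (aeval fun _ => (1 : ℂ)) h
    simp at this
  have helim₂ : ∀ f, f ∈ charIdealK d ↔ ∀ q s : Fin (d + 1) → ℂ,
      aeval (bezCoeff d (tCoeff (e + s 0) s) (lowCoeff q)) f = 0 := by
    intro f
    constructor
    · intro h q s
      obtain ⟨s', hs'⟩ := exists_tCoeff_eq (e + s 0) s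
      rw [hs']
      exact (mem_charIdealK f).1 h q s'
    · intro h
      refine mem_charIdealK_of_ne hlin fun q s hq => ?_
      obtain ⟨s', h1, h2⟩ := hnorm q s (by simpa using hq)
      rw [← h2, bezPoint, ← h1]
      exact h q s'
  have helim₂' : elimCoeff (RingHom.ker (bezParam T₂)) = charIdealK d := by
    ext f
    rw [elimCoeff, Ideal.mem_comap, mem_ker_bezParam, helim₂]
    simp only [hT₂s, aeval_rename, Sum.elim_comp_inl]
  refine ⟨hJ.trans hS₁.symm, elimCoeff_symIdealK d, ?_, ?_, ?_, ?_⟩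
  · rw [hJ]
    refine topFree_of helim (V := {a | ∃ q s : Fin (d + 1) → ℂ, q 0 ≠ 0 ∧ a = bezPoint d q s})
      ?_ ?_
    · intro f hf
      exact mem_charIdealK_of_ne (H := X 0) (X_ne_zero _) fun q s hq =>
        hf _ ⟨q, s, by simpa using hq, rfl⟩
    · rintro _ ⟨q, s, hq, rfl⟩ t
      -- As `q 0 ≠ 0`, a multiple of `Q` moves the constant term of `P` to the value that
      -- corresponds to `s_{d+1} = t`.
      obtain ⟨s', h1, h2⟩ := exists_bezPoint_eq q s (((-1) ^ (d + 1) * t - symCoeff s 0) / q 0)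
      refine ⟨q, s', ?_, ?_⟩
      · have e0 := h1 0
        rw [show lowCoeff q 0 = q 0 from lowCoeff_val q 0, symCoeff_zero s',
          div_mul_cancel₀ _ hq, add_sub_cancel] at e0
        exact mul_left_cancel₀ (pow_ne_zero _ (by norm_num)) e0
      · rw [hT₁s, ← h2, bezPoint]
  · intro f hf
    rw [hS] at hf
    obtain ⟨v, hv, rfl⟩ := hf
    have hsup : X (Sum.inl v) - bezVec (C e + s 1) v ∈
        supported ℂ ({Sum.inr (Fin.last d)}ᶜ : Set (CoeffIdx d ⊕ Fin (d + 1))) := by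
      have hX : ∀ i : CoeffIdx d ⊕ Fin (d + 1), i ≠ Sum.inr (Fin.last d) →
          (X i : SymRing d) ∈ supported ℂ
            ({Sum.inr (Fin.last d)}ᶜ : Set (CoeffIdx d ⊕ Fin (d + 1))) :=
        fun i hi => X_mem_supported.2 hi
      -- `s_{d+1}` enters `P` only through its constant term, which `tCoeff` has overwritten.
      have hp : ∀ k, tCoeff (C e + s 1 : SymRing d) (fun k => X (Sum.inr k)) k ∈
          supported ℂ ({Sum.inr (Fin.last d)}ᶜ : Set (CoeffIdx d ⊕ Fin (d + 1))) := by
        intro k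
        unfold tCoeff symCoeff
        split_ifs with h0 h1 h2
        · refine add_mem (Subalgebra.algebraMap_mem _ e) ?_
          rw [hs1]
          exact hX _ fun h => h0d (Sum.inr_injective h)
        · exact one_mem _
        · refine mul_mem (pow_mem (neg_mem (one_mem _)) _) (hX _ fun h => ?_)
          have := congrArg Fin.val (Sum.inr_injective h)
          simp at this; omega
        · exact zero_mem _
      have hq : ∀ k, lowCoeff (fun j => (X (Sum.inl (idx (Fin.last d) j)) : SymRing d)) k ∈
          supported ℂ ({Sum.inr (Fin.last d)}ᶜ : Set (CoeffIdx d ⊕ Fin (d + 1))) := by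
        intro k
        unfold lowCoeff
        split_ifs
        · exact hX _ (by simp)
        · exact zero_mem _
      refine sub_mem (hX _ (by simp)) ?_
      unfold bezVec bezCoeff bez
      refine sum_mem fun k _ => sub_mem ?_ ?_ <;>
        exact mul_mem (hp _) (hq _)
    rw [mem_supported] at hsup
    exact fun h => hsup h rfl
  · rw [hS₂, helim₂']
  · rw [hS₂]
    refine topFree_of helim₂' (V := {a | ∃ q s : Fin (d + 1) → ℂ,
      a = bezCoeff d (tCoeff (e + s 0) s) (lowCoeff q)}) ?_ ?_
    · intro f hf
      exact (helim₂ f).2 fun q s => hf _ ⟨q, s, rfl⟩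
    · rintro _ ⟨q, s, rfl⟩ t
      -- After the normalization the coefficient vector does not depend on `s_{d+1}`, so this entry
      -- can be overwritten.
      refine ⟨q, Function.update s (Fin.last d) t, by simp, ?_⟩
      rw [hT₂s, Function.update_of_ne h0d]
      congr 1
      exact tCoeff_congr fun k hk => (Function.update_of_ne hk _ _).symm

/-! ### Matching the listed systems with the Bezoutian equations -/

theorem bezSystem_eq_image {d : ℕ} (t : SymRing d) : bezSystem t =
    (fun p : Fin (d + 1) × Fin (d + 1) => A p.1 p.2 - bezVec t (idx p.1 p.2)) ''
      ((Finset.univ.filter fun p : Fin (d + 1) × Fin (d + 1) =>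
        p.2 ≤ p.1 ∧ p.1 ≠ Fin.last d : Finset _) : Set (Fin (d + 1) × Fin (d + 1))) := by
  ext f
  constructor
  · rintro ⟨v, hv, rfl⟩
    refine ⟨ofLex v.1, by simpa using ⟨v.2, hv⟩, ?_⟩
    simp only [A, idx_eta]
  · rintro ⟨p, hp, rfl⟩
    simp only [Finset.coe_filter, Finset.mem_univ, true_and, Set.mem_ofPred_eq] at hp
    refine ⟨idx p.1 p.2, ?_, rfl⟩
    simpa [idx, max_eq_left hp.1] using hp.2

theorem bezVec_idx {d : ℕ} (t : SymRing d) {i j : Fin (d + 1)} (h : j ≤ i) :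
    bezVec t (idx i j) = bez (tCoeff t fun k => X (Sum.inr k))
      (lowCoeff fun j => A (Fin.last d) j) i j := by
  simp only [bezVec, bezCoeff, idx, ofLex_toLex, max_eq_left h, min_eq_right h]
  rfl

theorem tCoeff_eq_s {d : ℕ} (t : SymRing d) {k : ℕ} (h0 : k ≠ 0) (hk : k < d + 1) :
    tCoeff t (fun k => X (Sum.inr k)) k = (-1) ^ (d + 1 - k) * s (d + 1 - k) := by
  rw [tCoeff, if_neg h0, symCoeff, if_neg (by omega), dif_pos hk, s]
  congr 3
  ext
  simp only [Fin.val_ofNat]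
  rw [Nat.mod_eq_of_lt (by omega)]

theorem tCoeff_degree {d : ℕ} (t : SymRing d) :
    tCoeff t (fun k => X (Sum.inr k)) (d + 1) = 1 := by
  rw [tCoeff, if_neg (Nat.succ_ne_zero d), symCoeff_self]

theorem tCoeff_of_lt {d : ℕ} (t : SymRing d) {k : ℕ} (hk : d + 1 < k) :
    tCoeff t (fun k => X (Sum.inr k)) k = 0 := by
  rw [tCoeff, if_neg (by omega), symCoeff_of_lt _ hk]

theorem systemK3_eq (t : SymRing 2) : systemK3 t = bezSystem t := by
  have hf : (Finset.univ.filter fun p : Fin 3 × Fin 3 => p.2 ≤ p.1 ∧ p.1 ≠ Fin.last 2) =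
      {(0, 0), (1, 0), (1, 1)} := by decide
  set P : ℕ → SymRing 2 := tCoeff t fun k => X (Sum.inr k) with hP
  set Q : ℕ → SymRing 2 := lowCoeff fun j => A (Fin.last 2) j with hQ
  have p0 : P 0 = t := rfl
  have p1 : P 1 = (-1) ^ 2 * s 2 := tCoeff_eq_s t (by norm_num) (by norm_num)
  have p2 : P 2 = (-1) ^ 1 * s 1 := tCoeff_eq_s t (by norm_num) (by norm_num)
  have p3 : P 3 = 1 := tCoeff_degree t
  have q0 : Q 0 = A 2 0 := rfl
  have q1 : Q 1 = A 2 1 := rfl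
  have q2 : Q 2 = A 2 2 := rfl
  have q3 : Q 3 = 0 := rfl
  have hb : ∀ i j : Fin 3, j ≤ i → A i j - bezVec t (idx i j) = A i j - bez P Q i j :=
    fun i j h => by rw [bezVec_idx t h]
  rw [bezSystem_eq_image, hf]
  simp only [Finset.coe_insert, Finset.coe_singleton, Set.image_insert_eq, Set.image_singleton]
  rw [hb 0 0 (by decide), hb 1 0 (by decide), hb 1 1 (by decide)]
  simp only [bez, Finset.sum_range_succ, Finset.sum_range_zero, Fin.isValue,
    Fin.coe_ofNat_eq_mod, Nat.reduceMod, Nat.reduceAdd, Nat.reduceSub,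
    p0, p1, p2, p3, q0, q1, q2, q3]
  rw [systemK3]
  congr! 1 <;> ring_nf

theorem systemK4_eq (t : SymRing 3) : systemK4 t = bezSystem t := by
  -- The pairs are enumerated in the order of the listed equations, with `(2, 0)` last, so that
  -- `congr!` compares the two sets entry by entry.
  have hf : (Finset.univ.filter fun p : Fin 4 × Fin 4 => p.2 ≤ p.1 ∧ p.1 ≠ Fin.last 3) =
      {(0, 0), (1, 0), (1, 1), (2, 1), (2, 2), (2, 0)} := by decide
  set P : ℕ → SymRing 3 := tCoeff t fun k => X (Sum.inr k) with hP
  set Q : ℕ → SymRing 3 := lowCoeff fun j => A (Fin.last 3) j with hQ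
  have p0 : P 0 = t := rfl
  have p1 : P 1 = (-1) ^ 3 * s 3 := tCoeff_eq_s t (by norm_num) (by norm_num)
  have p2 : P 2 = (-1) ^ 2 * s 2 := tCoeff_eq_s t (by norm_num) (by norm_num)
  have p3 : P 3 = (-1) ^ 1 * s 1 := tCoeff_eq_s t (by norm_num) (by norm_num)
  have p4 : P 4 = 1 := tCoeff_degree t
  have p5 : P 5 = 0 := tCoeff_of_lt t (by norm_num)
  have q0 : Q 0 = A 3 0 := rfl
  have q1 : Q 1 = A 3 1 := rfl
  have q2 : Q 2 = A 3 2 := rfl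
  have q3 : Q 3 = A 3 3 := rfl
  have q4 : Q 4 = 0 := rfl
  have q5 : Q 5 = 0 := rfl
  have hb : ∀ i j : Fin 4, j ≤ i → A i j - bezVec t (idx i j) = A i j - bez P Q i j :=
    fun i j h => by rw [bezVec_idx t h]
  rw [bezSystem_eq_image, hf]
  simp only [Finset.coe_insert, Finset.coe_singleton, Set.image_insert_eq, Set.image_singleton]
  rw [hb 0 0 (by decide), hb 1 0 (by decide), hb 1 1 (by decide), hb 2 1 (by decide), hb 2 2 (by decide), hb 2 0 (by decide)]
  simp only [bez, Finset.sum_range_succ, Finset.sum_range_zero, Fin.isValue,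
    Fin.coe_ofNat_eq_mod, Nat.reduceMod, Nat.reduceAdd, Nat.reduceSub,
    p0, p1, p2, p3, p4, p5, q0, q1, q2, q3, q4, q5]
  rw [systemK4]
  congr! 1 <;> ring_nf

theorem systemK5_eq (t : SymRing 4) : systemK5 t = bezSystem t := by
  have hf : (Finset.univ.filter fun p : Fin 5 × Fin 5 => p.2 ≤ p.1 ∧ p.1 ≠ Fin.last 4) =
      {(0, 0), (1, 0), (1, 1), (2, 0), (2, 1), (2, 2), (3, 0), (3, 1), (3, 2), (3, 3)} := by decide
  set P : ℕ → SymRing 4 := tCoeff t fun k => X (Sum.inr k) with hP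
  set Q : ℕ → SymRing 4 := lowCoeff fun j => A (Fin.last 4) j with hQ
  have p0 : P 0 = t := rfl
  have p1 : P 1 = (-1) ^ 4 * s 4 := tCoeff_eq_s t (by norm_num) (by norm_num)
  have p2 : P 2 = (-1) ^ 3 * s 3 := tCoeff_eq_s t (by norm_num) (by norm_num)
  have p3 : P 3 = (-1) ^ 2 * s 2 := tCoeff_eq_s t (by norm_num) (by norm_num)
  have p4 : P 4 = (-1) ^ 1 * s 1 := tCoeff_eq_s t (by norm_num) (by norm_num)
  have p5 : P 5 = 1 := tCoeff_degree t
  have p6 : P 6 = 0 := tCoeff_of_lt t (by norm_num)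
  have p7 : P 7 = 0 := tCoeff_of_lt t (by norm_num)
  have q0 : Q 0 = A 4 0 := rfl
  have q1 : Q 1 = A 4 1 := rfl
  have q2 : Q 2 = A 4 2 := rfl
  have q3 : Q 3 = A 4 3 := rfl
  have q4 : Q 4 = A 4 4 := rfl
  have q5 : Q 5 = 0 := rfl
  have q6 : Q 6 = 0 := rfl
  have q7 : Q 7 = 0 := rfl
  have hb : ∀ i j : Fin 5, j ≤ i → A i j - bezVec t (idx i j) = A i j - bez P Q i j :=
    fun i j h => by rw [bezVec_idx t h]
  rw [bezSystem_eq_image, hf]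
  simp only [Finset.coe_insert, Finset.coe_singleton, Set.image_insert_eq, Set.image_singleton]
  rw [hb 0 0 (by decide), hb 1 0 (by decide), hb 1 1 (by decide), hb 2 0 (by decide), hb 2 1 (by decide), hb 2 2 (by decide), hb 3 0 (by decide), hb 3 1 (by decide), hb 3 2 (by decide), hb 3 3 (by decide)]
  simp only [bez, Finset.sum_range_succ, Finset.sum_range_zero, Fin.isValue,
    Fin.coe_ofNat_eq_mod, Nat.reduceMod, Nat.reduceAdd, Nat.reduceSub,
    p0, p1, p2, p3, p4, p5, p6, p7, q0, q1, q2, q3, q4, q5, q6, q7]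
  rw [systemK5]
  congr! 1 <;> ring_nf

theorem systemK6_eq (t : SymRing 5) : systemK6 t = bezSystem t := by
  have hf : (Finset.univ.filter fun p : Fin 6 × Fin 6 => p.2 ≤ p.1 ∧ p.1 ≠ Fin.last 5) =
      {(0, 0), (1, 0), (1, 1), (2, 0), (2, 1), (2, 2), (3, 0), (3, 1), (3, 2), (3, 3), (4, 0), (4, 1), (4, 2), (4, 3), (4, 4)} := by decide
  set P : ℕ → SymRing 5 := tCoeff t fun k => X (Sum.inr k) with hP
  set Q : ℕ → SymRing 5 := lowCoeff fun j => A (Fin.last 5) j with hQ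
  have p0 : P 0 = t := rfl
  have p1 : P 1 = (-1) ^ 5 * s 5 := tCoeff_eq_s t (by norm_num) (by norm_num)
  have p2 : P 2 = (-1) ^ 4 * s 4 := tCoeff_eq_s t (by norm_num) (by norm_num)
  have p3 : P 3 = (-1) ^ 3 * s 3 := tCoeff_eq_s t (by norm_num) (by norm_num)
  have p4 : P 4 = (-1) ^ 2 * s 2 := tCoeff_eq_s t (by norm_num) (by norm_num)
  have p5 : P 5 = (-1) ^ 1 * s 1 := tCoeff_eq_s t (by norm_num) (by norm_num)
  have p6 : P 6 = 1 := tCoeff_degree t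
  have p7 : P 7 = 0 := tCoeff_of_lt t (by norm_num)
  have p8 : P 8 = 0 := tCoeff_of_lt t (by norm_num)
  have p9 : P 9 = 0 := tCoeff_of_lt t (by norm_num)
  have q0 : Q 0 = A 5 0 := rfl
  have q1 : Q 1 = A 5 1 := rfl
  have q2 : Q 2 = A 5 2 := rfl
  have q3 : Q 3 = A 5 3 := rfl
  have q4 : Q 4 = A 5 4 := rfl
  have q5 : Q 5 = A 5 5 := rfl
  have q6 : Q 6 = 0 := rfl
  have q7 : Q 7 = 0 := rfl
  have q8 : Q 8 = 0 := rfl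
  have q9 : Q 9 = 0 := rfl
  have hb : ∀ i j : Fin 6, j ≤ i → A i j - bezVec t (idx i j) = A i j - bez P Q i j :=
    fun i j h => by rw [bezVec_idx t h]
  rw [bezSystem_eq_image, hf]
  simp only [Finset.coe_insert, Finset.coe_singleton, Set.image_insert_eq, Set.image_singleton]
  rw [hb 0 0 (by decide), hb 1 0 (by decide), hb 1 1 (by decide), hb 2 0 (by decide), hb 2 1 (by decide), hb 2 2 (by decide), hb 3 0 (by decide), hb 3 1 (by decide), hb 3 2 (by decide), hb 3 3 (by decide), hb 4 0 (by decide), hb 4 1 (by decide), hb 4 2 (by decide), hb 4 3 (by decide), hb 4 4 (by decide)]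
  simp only [bez, Finset.sum_range_succ, Finset.sum_range_zero, Fin.isValue,
    Fin.coe_ofNat_eq_mod, Nat.reduceMod, Nat.reduceAdd, Nat.reduceSub,
    p0, p1, p2, p3, p4, p5, p6, p7, p8, p9, q0, q1, q2, q3, q4, q5, q6, q7, q8, q9]
  rw [systemK6]
  congr! 1 <;> ring_nf

/-! ### Leading monomials -/

section Leading

variable {σ : Type*} (m : MonomialOrder σ)

/-- The polynomial `f` is monic with leading exponent `e`. -/
def MonicWith (f : MvPolynomial σ ℂ) (e : σ →₀ ℕ) : Prop :=
  m.degree f = e ∧ m.leadingCoeff f = 1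

variable {m} {f g : MvPolynomial σ ℂ} {e e' : σ →₀ ℕ}

theorem MonicWith.ne_zero (h : MonicWith m f e) : f ≠ 0 := by
  rintro rfl
  simpa using h.2

theorem monicWith_X (v : σ) : MonicWith m (X v) (Finsupp.single v 1) :=
  ⟨MonomialOrder.degree_X, MonomialOrder.leadingCoeff_X⟩

theorem monicWith_one : MonicWith m 1 0 :=
  ⟨MonomialOrder.degree_one, MonomialOrder.leadingCoeff_one⟩

theorem MonicWith.mul (hf : MonicWith m f e) (hg : MonicWith m g e') :
    MonicWith m (f * g) (e + e') :=
  ⟨by rw [MonomialOrder.degree_mul hf.ne_zero hg.ne_zero, hf.1, hg.1],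
    by rw [MonomialOrder.leadingCoeff_mul, hf.2, hg.2, one_mul]⟩

theorem MonicWith.pow (hf : MonicWith m f e) (k : ℕ) : MonicWith m (f ^ k) (k • e) := by
  induction k with
  | zero => simpa using monicWith_one
  | succ k ih =>
    rw [pow_succ, succ_nsmul]
    exact ih.mul hf

theorem MonicWith.prod {ι : Type*} {s : Finset ι} {F : ι → MvPolynomial σ ℂ} {E : ι → σ →₀ ℕ}
    (h : ∀ i ∈ s, MonicWith m (F i) (E i)) : MonicWith m (∏ i ∈ s, F i) (∑ i ∈ s, E i) := by
  classical
  induction s using Finset.induction_on with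
  | empty => simpa using monicWith_one
  | insert a s ha ih =>
    rw [Finset.prod_insert ha, Finset.sum_insert ha]
    exact (h a (Finset.mem_insert_self a s)).mul
      (ih fun i hi => h i (Finset.mem_insert_of_mem hi))

theorem MonicWith.add_of_lt (hf : MonicWith m f e) (hg : m.toSyn (m.degree g) < m.toSyn e) :
    MonicWith m (f + g) e := by
  rw [← hf.1] at hg
  exact ⟨(MonomialOrder.degree_add_of_lt hg).trans hf.1,
    (MonomialOrder.leadingCoeff_add_of_lt hg).trans hf.2⟩

/-- Polynomials with pairwise different leading exponents are linearly independent. -/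
theorem linearIndependent_of_degree_injective {ι : Type*} {F : ι → MvPolynomial σ ℂ}
    {E : ι → σ →₀ ℕ} (hF : ∀ i, MonicWith m (F i) (E i)) (hE : Function.Injective E) :
    LinearIndependent ℂ F := by
  classical
  rw [linearIndependent_iff']
  intro s c hc
  by_contra! h
  obtain ⟨i₀, hi₀, hc₀⟩ := h
  obtain ⟨i, hi, hmax⟩ := Finset.exists_max_image (s.filter fun i => c i ≠ 0)
    (fun i => m.toSyn (E i)) ⟨i₀, Finset.mem_filter.2 ⟨hi₀, hc₀⟩⟩
  rw [Finset.mem_filter] at hi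
  have h1 := congrArg (fun f => coeff (E i) f) hc
  simp only [coeff_sum, coeff_smul, coeff_zero] at h1
  rw [Finset.sum_eq_single_of_mem i hi.1] at h1
  · have h2 : coeff (E i) (F i) = 1 := by
      have := (hF i).2
      rwa [MonomialOrder.leadingCoeff, (hF i).1] at this
    rw [h2, smul_eq_mul, mul_one] at h1
    exact hi.2 h1
  · intro j hj hji
    by_cases hcj : c j = 0
    · rw [hcj, zero_smul]
    · have h2 := hmax j (Finset.mem_filter.2 ⟨hj, hcj⟩)
      rw [MonomialOrder.coeff_eq_zero_of_lt, smul_zero]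
      rw [(hF j).1]
      refine lt_of_le_of_ne h2 fun h3 => hji (hE (m.toSyn.injective h3))

end Leading

section Lex

variable {σ : Type*} [LinearOrder σ] [WellFoundedGT σ]

/-- In the lexicographic order the variables of smaller index are the larger ones. The comparison is
decided at the least index in the support of `e`; it is at most `v`, where the degree of `g` is
still zero. -/
theorem lex_degree_lt_of_supported {g : MvPolynomial σ ℂ} {v : σ} {e : σ →₀ ℕ} (he : e v ≠ 0)
    (hg : g ∈ supported ℂ (Set.Ioi v)) :
    MonomialOrder.lex.toSyn (MonomialOrder.lex.degree g) < MonomialOrder.lex.toSyn e := by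
  have h0 : ∀ u ≤ v, MonomialOrder.lex.degree g u = 0 := by
    intro u hu
    by_contra h
    have hne : g ≠ 0 := by
      rintro rfl
      simp at h
    have h1 : u ∈ g.vars := (mem_vars_iff_mem_support u).2
      ⟨_, MonomialOrder.degree_mem_support hne, Finsupp.mem_support_iff.2 h⟩
    exact absurd (mem_supported.1 hg h1) (not_lt.2 hu)
  rw [MonomialOrder.lex_lt_iff, Finsupp.Lex.lt_iff]
  have hne : e.support.Nonempty := ⟨v, Finsupp.mem_support_iff.2 he⟩
  have hmin : e.support.min' hne ≤ v := Finset.min'_le _ _ (Finsupp.mem_support_iff.2 he)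
  refine ⟨e.support.min' hne, fun j hj => ?_, ?_⟩
  · have : j ∉ e.support := fun h => absurd (Finset.min'_le _ _ h) (not_le.2 hj)
    rw [ofLex_toLex, ofLex_toLex, h0 j (hj.le.trans hmin), Finsupp.notMem_support_iff.1 this]
  · rw [ofLex_toLex, ofLex_toLex, h0 _ hmin]
    exact Nat.pos_of_ne_zero (Finsupp.mem_support_iff.1 (Finset.min'_mem _ hne))

theorem MonicWith.add_supported {f g : MvPolynomial σ ℂ} {e : σ →₀ ℕ} {v : σ}
    (hf : MonicWith MonomialOrder.lex f e) (he : e v ≠ 0) (hg : g ∈ supported ℂ (Set.Ioi v)) :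
    MonicWith MonomialOrder.lex (f + g) e :=
  hf.add_of_lt (lex_degree_lt_of_supported he hg)

end Lex

/-! ### Multisets of pairs without nested pairs -/

section Nested

variable {α β : Type*} [LinearOrder α] [LinearOrder β]

theorem mem_support_mapDomain {ι κ : Type*} {f : ι → κ} {m : ι →₀ ℕ} {y : κ} :
    y ∈ (m.mapDomain f).support ↔ ∃ x ∈ m.support, f x = y := by
  classical
  constructor
  · intro h
    simpa using Finsupp.mapDomain_support h
  · rintro ⟨x, hx, rfl⟩
    have h1 : m - Finsupp.single x 1 + Finsupp.single x 1 = m := by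
      refine tsub_add_cancel_of_le ?_
      rw [Finsupp.single_le_iff]
      exact Nat.one_le_iff_ne_zero.2 (Finsupp.mem_support_iff.1 hx)
    rw [← h1, Finsupp.mapDomain_add, Finsupp.mapDomain_single, Finsupp.mem_support_iff]
    simp

theorem mapDomain_nat_eq_zero_iff {ι κ : Type*} {f : ι → κ} {m : ι →₀ ℕ} :
    m.mapDomain f = 0 ↔ m = 0 := by
  constructor
  · intro h
    rw [← Finsupp.support_eq_empty, Finset.eq_empty_iff_forall_notMem]
    intro x hx
    have : f x ∈ (m.mapDomain f).support := mem_support_mapDomain.2 ⟨x, hx, rfl⟩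
    simp [h] at this
  · rintro rfl; exact Finsupp.mapDomain_zero

/-- In the support of `m` no pair is nested in another one. -/
def NonNested (m : α × β →₀ ℕ) : Prop :=
  ∀ x ∈ m.support, ∀ y ∈ m.support, x.1 < y.1 → x.2 ≤ y.2

/-- A multiset of pairs without nested pairs is determined by its marginals. -/
theorem NonNested.eq_of_mapDomain_eq : ∀ {m m' : α × β →₀ ℕ}, NonNested m → NonNested m' →
    m.mapDomain Prod.fst = m'.mapDomain Prod.fst →
    m.mapDomain Prod.snd = m'.mapDomain Prod.snd → m = m' := by
  -- Without nesting, the least first entry and the least second entry occur together in one pair.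
  -- Both multisets contain this pair, which depends on the marginals only; removing it gives an
  -- induction.
  have corner : ∀ {m : α × β →₀ ℕ}, NonNested m →
      ∀ (h1 : (m.mapDomain Prod.fst).support.Nonempty)
        (h2 : (m.mapDomain Prod.snd).support.Nonempty),
      ((m.mapDomain Prod.fst).support.min' h1, (m.mapDomain Prod.snd).support.min' h2) ∈
        m.support := by
    intro m hm h1 h2
    obtain ⟨x, hx, hx1⟩ := mem_support_mapDomain.1 (Finset.min'_mem _ h1)
    obtain ⟨y, hy, hy1⟩ := mem_support_mapDomain.1 (Finset.min'_mem _ h2)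
    have hxy : x.1 ≤ y.1 := by
      rw [hx1]; exact Finset.min'_le _ _ (mem_support_mapDomain.2 ⟨y, hy, rfl⟩)
    have hyx : y.2 ≤ x.2 := by
      rw [hy1]; exact Finset.min'_le _ _ (mem_support_mapDomain.2 ⟨x, hx, rfl⟩)
    rcases hxy.eq_or_lt with h | h
    · rw [← hx1, ← hy1, h]; exact hy
    · rw [← hx1, ← hy1, ← (hm x hx y hy h).antisymm hyx]; exact hx
  have main : ∀ (n : ℕ) {m m' : α × β →₀ ℕ}, m.degree = n → NonNested m → NonNested m' →
      m.mapDomain Prod.fst = m'.mapDomain Prod.fst →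
      m.mapDomain Prod.snd = m'.mapDomain Prod.snd → m = m' := by
    intro n
    induction n with
    | zero =>
      intro m m' h0 _ _ h1 _
      rw [Finsupp.degree_eq_zero_iff] at h0
      rw [h0, Finsupp.mapDomain_zero] at h1
      rw [h0, mapDomain_nat_eq_zero_iff.1 h1.symm]
    | succ n ih =>
      intro m m' h0 hm hm' h1 h2
      have hne : m ≠ 0 := by rintro rfl; simp at h0
      have hn1 : (m.mapDomain Prod.fst).support.Nonempty := by
        rw [Finsupp.support_nonempty_iff]; exact fun h => hne (mapDomain_nat_eq_zero_iff.1 h)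
      have hn2 : (m.mapDomain Prod.snd).support.Nonempty := by
        rw [Finsupp.support_nonempty_iff]; exact fun h => hne (mapDomain_nat_eq_zero_iff.1 h)
      have hc := corner hm hn1 hn2
      have hc' := corner hm' (h1 ▸ hn1) (h2 ▸ hn2)
      have e1 : (m'.mapDomain Prod.fst).support.min' (h1 ▸ hn1) =
          (m.mapDomain Prod.fst).support.min' hn1 := by congr 2; exact h1.symm
      have e2 : (m'.mapDomain Prod.snd).support.min' (h2 ▸ hn2) =
          (m.mapDomain Prod.snd).support.min' hn2 := by congr 2; exact h2.symm
      rw [e1, e2] at hc'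
      set x : α × β := ((m.mapDomain Prod.fst).support.min' hn1,
        (m.mapDomain Prod.snd).support.min' hn2)
      have split : ∀ {m : α × β →₀ ℕ}, x ∈ m.support →
          m - Finsupp.single x 1 + Finsupp.single x 1 = m := by
        intro m hx
        refine tsub_add_cancel_of_le ?_
        rw [Finsupp.single_le_iff]
        exact Nat.one_le_iff_ne_zero.2 (Finsupp.mem_support_iff.1 hx)
      have sub : ∀ {m : α × β →₀ ℕ}, NonNested m → NonNested (m - Finsupp.single x 1) := by
        intro m hm y hy z hz
        exact hm y (Finsupp.support_tsub hy) z (Finsupp.support_tsub hz)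
      rw [← split hc, ← split hc'] at h1 h2
      rw [Finsupp.mapDomain_add, Finsupp.mapDomain_add] at h1 h2
      rw [← split hc, ← split hc', ih ?_ (sub hm) (sub hm') (add_right_cancel h1)
        (add_right_cancel h2)]
      have h3 := congrArg Finsupp.degree (split hc)
      rw [map_add, Finsupp.degree_single, h0] at h3
      omega
  intro m m' h1 h2 h3 h4
  exact main _ rfl h1 h2 h3 h4

end Nested

/-- Products of linear forms indexed by pairs `(a, b)` whose leading monomials are `P_a Q_b`:
those without nested pairs are linearly independent. -/
theorem linearIndependent_prod_of_nonNested {V α : Type} [Fintype V] [LinearOrder α]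
    {m : MonomialOrder (α ⊕ₗ α)} {pr : V → α × α} (hpr : Function.Injective pr)
    {F : V → MvPolynomial (α ⊕ₗ α) ℂ}
    (hF : ∀ v, MonicWith m (F v) (Finsupp.single (toLex (Sum.inl (pr v).1)) 1 +
      Finsupp.single (toLex (Sum.inr (pr v).2)) 1)) :
    LinearIndependent ℂ (fun c : {c : V →₀ ℕ // NonNested (c.mapDomain pr)} =>
      ∏ v, F v ^ c.1 v) := by
  classical
  refine linearIndependent_of_degree_injective
    (fun c => MonicWith.prod fun v _ => (hF v).pow (c.1 v)) ?_
  intro c c' h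
  refine Subtype.ext (Finsupp.mapDomain_injective hpr ?_)
  -- The leading exponent of a product records exactly the two marginals of its multiset of pairs.
  have hsum : ∀ c : V →₀ ℕ, ∑ v, c v • (Finsupp.single (toLex (Sum.inl (pr v).1) : α ⊕ₗ α) 1 +
      Finsupp.single (toLex (Sum.inr (pr v).2)) 1) =
      ((c.mapDomain pr).mapDomain Prod.fst).mapDomain (fun a => toLex (Sum.inl a)) +
      ((c.mapDomain pr).mapDomain Prod.snd).mapDomain (fun a => toLex (Sum.inr a)) := by
    intro c
    rw [← Finsupp.mapDomain_comp, ← Finsupp.mapDomain_comp, ← Finsupp.mapDomain_comp,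
      ← Finsupp.mapDomain_comp, Finsupp.mapDomain, Finsupp.mapDomain]
    rw [Finsupp.sum_fintype _ _ (by simp), Finsupp.sum_fintype _ _ (by simp),
      ← Finset.sum_add_distrib]
    refine Finset.sum_congr rfl fun v _ => ?_
    simp [Function.comp]
  simp only [hsum] at h
  have hinl : Function.Injective fun a : α => (toLex (Sum.inl a) : α ⊕ₗ α) :=
    fun a b h => Sum.inl_injective (toLex.injective h)
  have hinr : Function.Injective fun a : α => (toLex (Sum.inr a) : α ⊕ₗ α) :=
    fun a b h => Sum.inr_injective (toLex.injective h)
  have z1 : ∀ (x : α →₀ ℕ) (a : α), x.mapDomain (fun a => (toLex (Sum.inr a) : α ⊕ₗ α))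
      (toLex (Sum.inl a)) = 0 := fun x a =>
    Finsupp.mapDomain_of_notMem_range _ _ fun ⟨b, hb⟩ => by cases toLex.injective hb
  have z2 : ∀ (x : α →₀ ℕ) (a : α), x.mapDomain (fun a => (toLex (Sum.inl a) : α ⊕ₗ α))
      (toLex (Sum.inr a)) = 0 := fun x a =>
    Finsupp.mapDomain_of_notMem_range _ _ fun ⟨b, hb⟩ => by cases toLex.injective hb
  refine NonNested.eq_of_mapDomain_eq c.2 c'.2 ?_ ?_
  · ext a
    have := DFunLike.congr_fun h (toLex (Sum.inl a))
    simp only [Finsupp.add_apply, z1, add_zero] at this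
    rwa [Finsupp.mapDomain_apply hinl, Finsupp.mapDomain_apply hinl] at this
  · ext a
    have := DFunLike.congr_fun h (toLex (Sum.inr a))
    simp only [Finsupp.add_apply, z2, zero_add] at this
    rwa [Finsupp.mapDomain_apply hinr, Finsupp.mapDomain_apply hinr] at this

/-! ### The Plücker relations -/

section Pluecker

/-- Pairs `(i, j)` with `i < j`, ordered by `i` and then by decreasing `j`. -/
abbrev PairIdx (N : ℕ) : Type :=
  {p : Fin N ×ₗ (Fin N)ᵒᵈ // (ofLex p).1 < OrderDual.ofDual (ofLex p).2}

/-- The pair `(i, j)`. -/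
def pairIdx {N : ℕ} {i j : Fin N} (h : i < j) : PairIdx N := ⟨toLex (i, OrderDual.toDual j), h⟩

/-- The pair underlying an index. -/
def PairIdx.pair {N : ℕ} (v : PairIdx N) : Fin N × Fin N :=
  ((ofLex v.1).1, OrderDual.ofDual (ofLex v.1).2)

theorem PairIdx.pair_injective {N : ℕ} : Function.Injective (PairIdx.pair (N := N)) := by
  intro v w h
  refine Subtype.ext (ofLex.injective (Prod.ext ?_ ?_))
  · exact congrArg Prod.fst h
  · exact congrArg Prod.snd h

/-- The Plücker relation of a family `D` for the indices `i, j, k, l`. -/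
def plRel {R ι : Type*} [CommRing R] (D : ι → ι → R) (i j k l : ι) : R :=
  D i l * D j k - D i k * D j l + D i j * D k l

/-- The three-term Plücker relations. -/
def plSet (N : ℕ) : Set (MvPolynomial (PairIdx N) ℂ) :=
  {f | ∃ (i j k l : Fin N) (hij : i < j) (hjk : j < k) (hkl : k < l),
    f = X (pairIdx (hij.trans (hjk.trans hkl))) * X (pairIdx hjk) -
      X (pairIdx (hij.trans hjk)) * X (pairIdx (hjk.trans hkl)) +
        X (pairIdx hij) * X (pairIdx hkl)}

/-- The parametrization of the Plücker coordinates by the minors of a `2 × N` matrix. -/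
noncomputable def plParam (N : ℕ) :
    MvPolynomial (PairIdx N) ℂ →ₐ[ℂ] MvPolynomial (Fin N ⊕ₗ Fin N) ℂ :=
  aeval fun v => X (toLex (Sum.inl v.pair.1)) * X (toLex (Sum.inr v.pair.2)) -
    X (toLex (Sum.inl v.pair.2)) * X (toLex (Sum.inr v.pair.1))

theorem monicWith_minor {N : ℕ} {a b : Fin N} (h : a < b) :
    MonicWith MonomialOrder.lex (X (toLex (Sum.inl a)) * X (toLex (Sum.inr b)) -
      X (toLex (Sum.inl b)) * X (toLex (Sum.inr a)) : MvPolynomial (Fin N ⊕ₗ Fin N) ℂ)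
      (Finsupp.single (toLex (Sum.inl a)) 1 + Finsupp.single (toLex (Sum.inr b)) 1) := by
  rw [sub_eq_add_neg]
  refine MonicWith.add_supported (v := toLex (Sum.inl a)) ((monicWith_X _).mul (monicWith_X _))
    (by simp) ?_
  refine neg_mem (mul_mem (X_mem_supported.2 ?_) (X_mem_supported.2 ?_))
  · exact Sum.Lex.inl_lt_inl_iff.2 h
  · exact Sum.Lex.inl_lt_inr _ _

/-- The order on `PairIdx` puts the outer pair `(i, l)` before the pairs in the other two products,
so the product of the nested pairs leads and the standard monomials are those without nesting. -/
theorem monicWith_plRel {N : ℕ} {i j k l : Fin N} (hij : i < j) (hjk : j < k) (hkl : k < l) :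
    MonicWith MonomialOrder.lex
      (X (pairIdx (hij.trans (hjk.trans hkl))) * X (pairIdx hjk) -
        X (pairIdx (hij.trans hjk)) * X (pairIdx (hjk.trans hkl)) +
          X (pairIdx hij) * X (pairIdx hkl) : MvPolynomial (PairIdx N) ℂ)
      (Finsupp.single (pairIdx (hij.trans (hjk.trans hkl))) 1 +
        Finsupp.single (pairIdx hjk) 1) := by
  have hlt : ∀ {a b c e : Fin N} (hab : a < b) (hce : c < e), (a < c ∨ a = c ∧ e < b) →
      (X (pairIdx hce) : MvPolynomial (PairIdx N) ℂ) ∈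
        supported ℂ (Set.Ioi (pairIdx hab)) := by
    intro a b c e hab hce h
    refine X_mem_supported.2 ?_
    change (toLex (a, OrderDual.toDual b) : Fin N ×ₗ (Fin N)ᵒᵈ) < toLex (c, OrderDual.toDual e)
    rw [Prod.Lex.toLex_lt_toLex]
    exact h
  rw [sub_add]
  rw [sub_eq_add_neg]
  refine MonicWith.add_supported (v := pairIdx (hij.trans (hjk.trans hkl)))
    ((monicWith_X _).mul (monicWith_X _)) (by simp) ?_
  refine neg_mem (sub_mem (mul_mem ?_ ?_) (mul_mem ?_ ?_)) <;> apply hlt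
  · exact Or.inr ⟨rfl, hkl⟩
  · exact Or.inl hij
  · exact Or.inr ⟨rfl, hjk.trans hkl⟩
  · exact Or.inl (hij.trans hjk)

theorem plParam_eq_zero_of_mem {N : ℕ} {f : MvPolynomial (PairIdx N) ℂ} (hf : f ∈ plSet N) :
    plParam N f = 0 := by
  obtain ⟨i, j, k, l, hij, hjk, hkl, rfl⟩ := hf
  simp only [plParam, map_add, map_sub, map_mul, aeval_X, PairIdx.pair, pairIdx, ofLex_toLex,
    OrderDual.ofDual_toDual]
  ring

/-- The second fundamental theorem for `2 × N` matrices: the Plücker ideal is generated by the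
three-term relations. -/
theorem ker_plParam (N : ℕ) : RingHom.ker (plParam N) = Ideal.span (plSet N) := by
  classical
  refine le_antisymm ?_ (Ideal.span_le.2 fun f hf => plParam_eq_zero_of_mem hf)
  intro f hf
  -- Straightening by division: the monomials of the remainder `r` have no nested pairs. Their
  -- values are linearly independent, so `r` vanishes with its image.
  obtain ⟨g, r, hfr, -, hr⟩ := MonomialOrder.lex.div_set (B := plSet N) (fun b hb => by
    obtain ⟨i, j, k, l, hij, hjk, hkl, rfl⟩ := hb
    rw [(monicWith_plRel hij hjk hkl).2]
    exact isUnit_one) f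
  have hg : Finsupp.linearCombination _ (fun b : plSet N => (b : MvPolynomial (PairIdx N) ℂ)) g ∈
      Ideal.span (plSet N) := by
    rw [Finsupp.linearCombination_apply]
    exact sum_mem fun b _ => Ideal.mul_mem_left _ _ (Ideal.subset_span b.2)
  have hr0 : plParam N r = 0 := by
    have h1 : plParam N (Finsupp.linearCombination _
        (fun b : plSet N => (b : MvPolynomial (PairIdx N) ℂ)) g) = 0 :=
      (Ideal.span_le (I := RingHom.ker (plParam N))).2
        (fun f hf => plParam_eq_zero_of_mem hf) hg
    have h2 := RingHom.mem_ker.1 hf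
    rwa [hfr, map_add, h1, zero_add] at h2
  have hnn : ∀ c ∈ r.support, NonNested (c.mapDomain PairIdx.pair) := by
    intro c hc x hx y hy hxy
    obtain ⟨v, hv, rfl⟩ := mem_support_mapDomain.1 hx
    obtain ⟨w, hw, rfl⟩ := mem_support_mapDomain.1 hy
    by_contra! hlt
    have hvw : w.pair.1 < w.pair.2 := w.2
    refine hr c hc _ ⟨_, _, _, _, hxy, hvw, hlt, rfl⟩ ?_
    rw [(monicWith_plRel hxy hvw hlt).1]
    change Finsupp.single v 1 + Finsupp.single w 1 ≤ c
    intro u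
    have hne : v ≠ w := by rintro rfl; exact lt_irrefl _ hxy
    have h1 := Nat.one_le_iff_ne_zero.2 (Finsupp.mem_support_iff.1 hv)
    have h2 := Nat.one_le_iff_ne_zero.2 (Finsupp.mem_support_iff.1 hw)
    simp only [Finsupp.add_apply, Finsupp.single_apply]
    split_ifs with e1 e2 e2
    · exact absurd (e1.trans e2.symm) hne
    · rw [← e1]; exact h1
    · rw [← e2]; exact h2
    · exact Nat.zero_le _
  have hind := linearIndependent_prod_of_nonNested (m := MonomialOrder.lex)
    (PairIdx.pair_injective (N := N)) (F := fun v => X (toLex (Sum.inl v.pair.1)) *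
      X (toLex (Sum.inr v.pair.2)) - X (toLex (Sum.inl v.pair.2)) * X (toLex (Sum.inr v.pair.1)))
    (fun v => monicWith_minor v.2)
  have hr1 : r = 0 := by
    rw [← MvPolynomial.support_eq_empty, Finset.eq_empty_iff_forall_notMem]
    intro c hc
    rw [linearIndependent_iff'] at hind
    have := hind (r.support.subtype _) (fun c => r.coeff c.1) ?_ ⟨c, hnn c hc⟩ (by simpa using hc)
    · exact (mem_support_iff.1 hc) this
    · rw [← hr0, Finset.sum_subtype_of_mem (f := fun c => r.coeff c • ∏ v, ((X (toLex (Sum.inl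
        v.pair.1)) * X (toLex (Sum.inr v.pair.2)) - X (toLex (Sum.inl v.pair.2)) *
          X (toLex (Sum.inr v.pair.1)) : MvPolynomial (Fin N ⊕ₗ Fin N) ℂ) ^ c v)) hnn]
      conv_rhs => rw [r.as_sum, map_sum]
      refine Finset.sum_congr rfl fun c _ => ?_
      rw [plParam, aeval_monomial, Finsupp.prod_fintype _ _ (by simp), Algebra.smul_def]
  rw [hfr, hr1, add_zero]
  exact hg

end Pluecker

/-! ### The characteristic ideal of a complete graph -/

section CharIdeal

variable {R : Type*} [CommRing R] {d : ℕ}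

/-- The coefficient `a_{ij}`, which is zero unless `i, j ≤ d`. -/
def coeffN (a : CoeffIdx d → R) (i j : ℕ) : R :=
  if h : i < d + 1 ∧ j < d + 1 then a (idx ⟨i, h.1⟩ ⟨j, h.2⟩) else 0

/-- The coefficient of `u ^ j y ^ i` in `(u - y) Φ(u, y)`, for `i < j`. -/
def plCoord (a : CoeffIdx d → R) (i j : ℕ) : R :=
  coeffN a (j - 1) i - if i = 0 then 0 else coeffN a j (i - 1)

theorem map_coeffN {S F : Type*} [CommRing S] [FunLike F R S] [RingHomClass F R S] (f : F)
    (a : CoeffIdx d → R) (i j : ℕ) : f (coeffN a i j) = coeffN (fun v => f (a v)) i j := by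
  unfold coeffN
  split_ifs <;> simp

theorem map_plCoord {S F : Type*} [CommRing S] [FunLike F R S] [RingHomClass F R S] (f : F)
    (a : CoeffIdx d → R) (i j : ℕ) : f (plCoord a i j) = plCoord (fun v => f (a v)) i j := by
  unfold plCoord
  split_ifs <;> simp [map_coeffN]

theorem map_plRel {S F ι : Type*} [CommRing S] [FunLike F R S] [RingHomClass F R S] (f : F)
    (D : ι → ι → R) (i j k l : ι) :
    f (plRel D i j k l) = plRel (fun i j => f (D i j)) i j k l := by
  simp [plRel]

theorem coeffN_bezCoeff {p q : ℕ → R} (hp : ∀ k, d + 1 < k → p k = 0)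
    (hq : ∀ k, d + 1 < k → q k = 0) {i j : ℕ} (h : j ≤ i) :
    coeffN (bezCoeff d p q) i j = bez p q i j := by
  unfold coeffN
  split_ifs with h'
  · have h1 : (⟨j, h'.2⟩ : Fin (d + 1)) ≤ ⟨i, h'.1⟩ := h
    simp only [bezCoeff, idx, ofLex_toLex, max_eq_left h1, min_eq_right h1]
  · exact (bez_eq_zero hp hq (by omega) _).symm

theorem plCoord_bezCoeff {p q : ℕ → R} (hp : ∀ k, d + 1 < k → p k = 0)
    (hq : ∀ k, d + 1 < k → q k = 0) {i j : ℕ} (h : i < j) :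
    plCoord (bezCoeff d p q) i j = p j * q i - p i * q j := by
  obtain ⟨j, rfl⟩ : ∃ k, j = k + 1 := ⟨j - 1, by omega⟩
  rw [plCoord, Nat.add_sub_cancel, coeffN_bezCoeff hp hq (by omega)]
  cases i with
  | zero => rw [bez_zero_right]; simp
  | succ i =>
    rw [if_neg (Nat.succ_ne_zero i), Nat.add_sub_cancel, coeffN_bezCoeff hp hq (by omega),
      bez_succ_right]
    ring

/-- The Bezoutian of polynomials with `p_{d+1} ≠ 0` is one with `p` monic and `q_{d+1} = 0`. -/
theorem exists_bezCoeff_eq_bezPoint {p q : ℕ → ℂ} (hp : ∀ k, d + 1 < k → p k = 0)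
    (hq : ∀ k, d + 1 < k → q k = 0) (h0 : p (d + 1) ≠ 0) :
    ∃ s, bezCoeff d p q =
      bezPoint d (fun k : Fin (d + 1) => p (d + 1) * q k - q (d + 1) * p k) s := by
  -- The change from `(P, Q)` to `(P / p_{d+1}, p_{d+1} Q - q_{d+1} P)` has determinant one and
  -- preserves the Bezoutian.
  obtain ⟨s, hs⟩ := exists_eq_symCoeff (n := d + 1) (p := fun k => p k / p (d + 1))
    (div_self h0) (fun k hk => by rw [hp k hk, zero_div])
  have hq' : (fun k => p (d + 1) * q k - q (d + 1) * p k) = lowCoeff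
      fun k : Fin (d + 1) => p (d + 1) * q k - q (d + 1) * p k := by
    funext k
    unfold lowCoeff
    split_ifs with h
    · rfl
    · rcases eq_or_lt_of_le (not_lt.1 h) with h | h
      · rw [← h]; ring
      · rw [hp k h, hq k h]; ring
  refine ⟨s, ?_⟩
  rw [bezPoint, ← hs, ← hq']
  funext v
  simp only [bezCoeff, bez]
  refine Finset.sum_congr rfl fun k _ => ?_
  field_simp
  ring

/-- The characteristic ideal vanishes at Bezoutians of arbitrary polynomials with `p_{d+1} ≠ 0`. -/
theorem aeval_bezCoeff_of_mem {f : MvPolynomial (CoeffIdx d) ℂ} (hf : f ∈ charIdealK d)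
    {p q : ℕ → ℂ} (hp : ∀ k, d + 1 < k → p k = 0) (hq : ∀ k, d + 1 < k → q k = 0)
    (h0 : p (d + 1) ≠ 0) : aeval (bezCoeff d p q) f = 0 := by
  obtain ⟨s, hs⟩ := exists_bezCoeff_eq_bezPoint hp hq h0
  rw [hs]
  exact (mem_charIdealK f).1 hf _ _

/-- The characteristic ideal of `K_{d+1}` is the Plücker ideal of lines in `ℙ^{d+1}`. -/
theorem charIdealK_eq_span (d : ℕ) : charIdealK d = Ideal.span
    {f | ∃ i j k l : ℕ, i < j ∧ j < k ∧ k < l ∧ l < d + 2 ∧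
      f = plRel (plCoord (X : CoeffIdx d → MvPolynomial (CoeffIdx d) ℂ)) i j k l} := by
  apply le_antisymm
  · set ψ : MvPolynomial (PairIdx (d + 2)) ℂ →ₐ[ℂ] MvPolynomial (CoeffIdx d) ℂ :=
      aeval fun v => plCoord X v.pair.1 v.pair.2 with hψ
    have hcoord : ∀ i j : ℕ, i < j → j < d + 2 → plCoord X i j ∈ ψ.range := by
      intro i j hij hj
      have h : (⟨i, hij.trans hj⟩ : Fin (d + 2)) < ⟨j, hj⟩ := hij
      exact ⟨X (pairIdx h), by rw [hψ]; exact aeval_X _ _⟩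
    -- The coordinate change is triangular along antidiagonals: `a_{j,i+1} = D_{i+1,j+1} +
    -- a_{j+1,i}`.
    have hcoeff : ∀ i j : ℕ, i ≤ j → coeffN (X : CoeffIdx d → MvPolynomial _ ℂ) j i ∈ ψ.range := by
      intro i
      induction i with
      | zero =>
        intro j _
        by_cases hj : j + 1 < d + 2
        · have := hcoord 0 (j + 1) (by omega) hj
          simpa [plCoord] using this
        · rw [coeffN, dif_neg (by omega)]; exact zero_mem _
      | succ i ih =>
        intro j hij
        by_cases hj : j + 1 < d + 2
        · have := add_mem (hcoord (i + 1) (j + 1) (by omega) hj) (ih (j + 1) (by omega))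
          simpa [plCoord] using this
        · rw [coeffN, dif_neg (by omega)]; exact zero_mem _
    have hsurj : Function.Surjective ψ := by
      rw [← AlgHom.range_eq_top, ← top_le_iff, ← MvPolynomial.adjoin_range_X,
        Algebra.adjoin_le_iff]
      rintro _ ⟨v, rfl⟩
      have := hcoeff (ofLex v.1).2 (ofLex v.1).1 v.2
      rw [coeffN, dif_pos ⟨Fin.is_lt _, Fin.is_lt _⟩] at this
      rwa [show X v = X (idx (ofLex v.1).1 (ofLex v.1).2) by rw [idx_eta]]
    intro f hf
    obtain ⟨F, rfl⟩ := hsurj f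
    have hF : F ∈ RingHom.ker (plParam (d + 2)) := by
      rw [RingHom.mem_ker]
      -- It suffices to treat matrices with `p_{d+1} ≠ 0`; their minors are the coordinates of a
      -- Bezoutian that can be normalized.
      refine eq_zero_of_aeval_eq_zero_of_ne (H := X (toLex (Sum.inr (Fin.last (d + 1)))))
        (X_ne_zero _) fun x hx => ?_
      rw [aeval_X] at hx
      set p : ℕ → ℂ := lowCoeff fun k : Fin (d + 2) => x (toLex (Sum.inr k)) with hp
      set q : ℕ → ℂ := lowCoeff fun k : Fin (d + 2) => x (toLex (Sum.inl k)) with hq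
      have hp0 : ∀ k, d + 1 < k → p k = 0 := fun k hk => lowCoeff_of_le _ hk
      have hq0 : ∀ k, d + 1 < k → q k = 0 := fun k hk => lowCoeff_of_le _ hk
      have h1 := aeval_bezCoeff_of_mem hf hp0 hq0
        (by rw [hp]; exact (lowCoeff_val _ (Fin.last (d + 1))).trans_ne hx)
      rw [← h1, hψ, plParam, ← AlgHom.comp_apply, ← AlgHom.comp_apply, comp_aeval, comp_aeval]
      congr 2
      funext v
      have hv : (v.pair.1 : ℕ) < v.pair.2 := v.2
      simp only [map_plCoord, aeval_X]
      rw [plCoord_bezCoeff hp0 hq0 hv, hp, hq]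
      simp only [lowCoeff_val, map_sub, map_mul, aeval_X]
      ring
    rw [ker_plParam] at hF
    have : Ideal.span (plSet (d + 2)) ≤ (Ideal.span {f | ∃ i j k l : ℕ, i < j ∧ j < k ∧ k < l ∧
        l < d + 2 ∧ f = plRel (plCoord (X : CoeffIdx d → MvPolynomial (CoeffIdx d) ℂ)) i j k l}).comap
          ψ := by
      rw [Ideal.span_le]
      rintro _ ⟨i, j, k, l, hij, hjk, hkl, rfl⟩
      refine Ideal.subset_span ⟨i, j, k, l, hij, hjk, hkl, l.2, ?_⟩
      simp [hψ, plRel, PairIdx.pair, pairIdx]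
    exact this hF
  · rw [Ideal.span_le]
    rintro _ ⟨i, j, k, l, hij, hjk, hkl, -, rfl⟩
    rw [SetLike.mem_coe, mem_charIdealK]
    intro q s
    rw [map_plRel]
    simp only [map_plCoord, aeval_X, plRel, bezPoint]
    have hp0 : ∀ k, d + 1 < k → symCoeff s k = 0 := fun k hk => symCoeff_of_lt s hk
    have hq0 : ∀ k, d + 1 < k → lowCoeff q k = 0 := fun k hk => lowCoeff_of_le q hk.le
    rw [plCoord_bezCoeff hp0 hq0 (by omega), plCoord_bezCoeff hp0 hq0 (by omega),
      plCoord_bezCoeff hp0 hq0 (by omega), plCoord_bezCoeff hp0 hq0 (by omega),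
      plCoord_bezCoeff hp0 hq0 (by omega), plCoord_bezCoeff hp0 hq0 (by omega)]
    ring

end CharIdeal

/-! ### The listed generators of the characteristic ideals of `K_3`, `K_4`, `K_5` -/

/-- Testing in all quotients turns equality of ideals into an equivalence of equations over
arbitrary commutative rings, which is accessible to `linear_combination`. -/
theorem _root_.Ideal.span_eq_span_of_forall_quotient {R : Type*} [CommRing R] {S T : Set R}
    (h : ∀ I : Ideal R, (∀ f ∈ S, Ideal.Quotient.mk I f = 0) ↔
      ∀ f ∈ T, Ideal.Quotient.mk I f = 0) : Ideal.span S = Ideal.span T := by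
  simp only [Ideal.Quotient.eq_zero_iff_mem] at h
  exact le_antisymm (Ideal.span_le.2 ((h _).2 fun f hf => Ideal.subset_span hf))
    (Ideal.span_le.2 ((h _).1 fun f hf => Ideal.subset_span hf))

theorem gensK3_eq_zero_iff {R : Type} [CommRing R] (x : CoeffIdx 2 → R) :
    (∀ f ∈ gensK3 fun i j => x (idx i j), f = 0) ↔
      ∀ i j k l : ℕ, i < j → j < k → k < l → l < 2 + 2 → plRel (plCoord x) i j k l = 0 := by
  have e01 : plCoord x 0 1 = x (idx 0 0) := by simp [plCoord, coeffN]; try rfl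
  have e02 : plCoord x 0 2 = x (idx 1 0) := by simp [plCoord, coeffN]; try rfl
  have e03 : plCoord x 0 3 = x (idx 2 0) := by simp [plCoord, coeffN]; try rfl
  have e12 : plCoord x 1 2 = x (idx 1 1) - x (idx 2 0) := by simp [plCoord, coeffN]; try rfl
  have e13 : plCoord x 1 3 = x (idx 2 1) := by simp [plCoord, coeffN]; try rfl
  have e23 : plCoord x 2 3 = x (idx 2 2) := by simp [plCoord, coeffN]; try rfl
  simp only [gensK3, Set.mem_singleton_iff, forall_eq]
  constructor
  · rintro g0
    have h0123 : plRel (plCoord x) 0 1 2 3 = 0 := by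
      simp only [plRel, e01, e02, e03, e12, e13, e23]
      linear_combination g0
    intro i j k l hij hjk hkl hl
    obtain ⟨rfl, rfl, rfl, rfl⟩ : i = 0 ∧ j = 1 ∧ k = 2 ∧ l = 3 := by omega
    assumption
  · intro h
    have h0123 := h 0 1 2 3 (by norm_num) (by norm_num) (by norm_num) (by norm_num)
    simp only [plRel, e01, e02, e03, e12, e13, e23]
      at h0123
    clear h e01 e02 e03 e12 e13 e23
    linear_combination h0123

theorem charIdealK_two : charIdealK 2 = Ideal.span (gensK3 coeffVar) := by
  rw [charIdealK_eq_span]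
  refine Ideal.span_eq_span_of_forall_quotient fun I => ?_
  have h := gensK3_eq_zero_iff fun v => Ideal.Quotient.mk I (X v)
  constructor
  · intro hI
    have h1 := h.2 fun i j k l hij hjk hkl hl => by
      have := hI _ ⟨i, j, k, l, hij, hjk, hkl, hl, rfl⟩
      simpa only [map_plRel, map_plCoord] using this
    simpa only [gensK3, coeffVar, Set.mem_insert_iff, Set.mem_singleton_iff, forall_eq_or_imp,
      forall_eq, map_add, map_sub, map_mul, map_pow] using h1
  · rintro hI _ ⟨i, j, k, l, hij, hjk, hkl, hl, rfl⟩
    have h1 := h.1 (by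
      simpa only [gensK3, coeffVar, Set.mem_insert_iff, Set.mem_singleton_iff, forall_eq_or_imp,
        forall_eq, map_add, map_sub, map_mul, map_pow] using hI) i j k l hij hjk hkl hl
    simpa only [map_plRel, map_plCoord] using h1

theorem gensK4_eq_zero_iff {R : Type} [CommRing R] (x : CoeffIdx 3 → R) :
    (∀ f ∈ gensK4 fun i j => x (idx i j), f = 0) ↔
      ∀ i j k l : ℕ, i < j → j < k → k < l → l < 3 + 2 → plRel (plCoord x) i j k l = 0 := by
  have e01 : plCoord x 0 1 = x (idx 0 0) := by simp [plCoord, coeffN]; try rfl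
  have e02 : plCoord x 0 2 = x (idx 1 0) := by simp [plCoord, coeffN]; try rfl
  have e03 : plCoord x 0 3 = x (idx 2 0) := by simp [plCoord, coeffN]; try rfl
  have e04 : plCoord x 0 4 = x (idx 3 0) := by simp [plCoord, coeffN]; try rfl
  have e12 : plCoord x 1 2 = x (idx 1 1) - x (idx 2 0) := by simp [plCoord, coeffN]; try rfl
  have e13 : plCoord x 1 3 = x (idx 2 1) - x (idx 3 0) := by simp [plCoord, coeffN]; try rfl
  have e14 : plCoord x 1 4 = x (idx 3 1) := by simp [plCoord, coeffN]; try rfl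
  have e23 : plCoord x 2 3 = x (idx 2 2) - x (idx 3 1) := by simp [plCoord, coeffN]; try rfl
  have e24 : plCoord x 2 4 = x (idx 3 2) := by simp [plCoord, coeffN]; try rfl
  have e34 : plCoord x 3 4 = x (idx 3 3) := by simp [plCoord, coeffN]; try rfl
  simp only [gensK4, Set.mem_insert_iff, Set.mem_singleton_iff, forall_eq_or_imp, forall_eq]
  constructor
  · rintro ⟨g0, g1, g2, g3, g4, g5⟩
    have h0123 : plRel (plCoord x) 0 1 2 3 = 0 := by
      simp only [plRel, e01, e02, e03, e12, e13, e23]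
      linear_combination g5
    have h0124 : plRel (plCoord x) 0 1 2 4 = 0 := by
      simp only [plRel, e01, e02, e04, e12, e14, e24]
      linear_combination g4
    have h0134 : plRel (plCoord x) 0 1 3 4 = 0 := by
      simp only [plRel, e01, e03, e04, e13, e14, e34]
      linear_combination g3
    have h0234 : plRel (plCoord x) 0 2 3 4 = 0 := by
      simp only [plRel, e02, e03, e04, e23, e24, e34]
      linear_combination g1
    have h1234 : plRel (plCoord x) 1 2 3 4 = 0 := by
      simp only [plRel, e12, e13, e14, e23, e24, e34]
      linear_combination g0
    intro i j k l hij hjk hkl hl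
    interval_cases l <;> interval_cases k <;> interval_cases j <;> interval_cases i <;>
      assumption
  · intro h
    have h0123 := h 0 1 2 3 (by norm_num) (by norm_num) (by norm_num) (by norm_num)
    have h0124 := h 0 1 2 4 (by norm_num) (by norm_num) (by norm_num) (by norm_num)
    have h0134 := h 0 1 3 4 (by norm_num) (by norm_num) (by norm_num) (by norm_num)
    have h0234 := h 0 2 3 4 (by norm_num) (by norm_num) (by norm_num) (by norm_num)
    have h1234 := h 1 2 3 4 (by norm_num) (by norm_num) (by norm_num) (by norm_num)
    simp only [plRel, e01, e02, e03, e04, e12, e13, e14, e23, e24, e34]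
      at h0123 h0124 h0134 h0234 h1234
    clear h e01 e02 e03 e04 e12 e13 e14 e23 e24 e34
    refine ⟨?_, ?_, ?_, ?_, ?_, ?_⟩
    · linear_combination h1234
    · linear_combination h0234
    -- The cubic generator is redundant: a combination of two Plücker relations with Plücker
    -- coordinates as factors.
    · linear_combination (x (idx 1 1) - x (idx 2 0)) * h0234 - x (idx 1 0) * h1234
    · linear_combination h0134
    · linear_combination h0124
    · linear_combination h0123

theorem charIdealK_three : charIdealK 3 = Ideal.span (gensK4 coeffVar) := by
  rw [charIdealK_eq_span]
  refine Ideal.span_eq_span_of_forall_quotient fun I => ?_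
  have h := gensK4_eq_zero_iff fun v => Ideal.Quotient.mk I (X v)
  constructor
  · intro hI
    have h1 := h.2 fun i j k l hij hjk hkl hl => by
      have := hI _ ⟨i, j, k, l, hij, hjk, hkl, hl, rfl⟩
      simpa only [map_plRel, map_plCoord] using this
    simpa only [gensK4, coeffVar, Set.mem_insert_iff, Set.mem_singleton_iff, forall_eq_or_imp,
      forall_eq, map_add, map_sub, map_mul, map_pow] using h1
  · rintro hI _ ⟨i, j, k, l, hij, hjk, hkl, hl, rfl⟩
    have h1 := h.1 (by
      simpa only [gensK4, coeffVar, Set.mem_insert_iff, Set.mem_singleton_iff, forall_eq_or_imp,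
        forall_eq, map_add, map_sub, map_mul, map_pow] using hI) i j k l hij hjk hkl hl
    simpa only [map_plRel, map_plCoord] using h1

/-- The fifteen quadrics are the Plücker relations, two of them with another relation added; the
seven cubics are redundant. -/
theorem gensK5_eq_zero_iff {R : Type} [CommRing R] (x : CoeffIdx 4 → R) :
    (∀ f ∈ gensK5 fun i j => x (idx i j), f = 0) ↔
      ∀ i j k l : ℕ, i < j → j < k → k < l → l < 4 + 2 → plRel (plCoord x) i j k l = 0 := by
  have e01 : plCoord x 0 1 = x (idx 0 0) := by simp [plCoord, coeffN]; try rfl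
  have e02 : plCoord x 0 2 = x (idx 1 0) := by simp [plCoord, coeffN]; try rfl
  have e03 : plCoord x 0 3 = x (idx 2 0) := by simp [plCoord, coeffN]; try rfl
  have e04 : plCoord x 0 4 = x (idx 3 0) := by simp [plCoord, coeffN]; try rfl
  have e05 : plCoord x 0 5 = x (idx 4 0) := by simp [plCoord, coeffN]; try rfl
  have e12 : plCoord x 1 2 = x (idx 1 1) - x (idx 2 0) := by simp [plCoord, coeffN]; try rfl
  have e13 : plCoord x 1 3 = x (idx 2 1) - x (idx 3 0) := by simp [plCoord, coeffN]; try rfl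
  have e14 : plCoord x 1 4 = x (idx 3 1) - x (idx 4 0) := by simp [plCoord, coeffN]; try rfl
  have e15 : plCoord x 1 5 = x (idx 4 1) := by simp [plCoord, coeffN]; try rfl
  have e23 : plCoord x 2 3 = x (idx 2 2) - x (idx 3 1) := by simp [plCoord, coeffN]; try rfl
  have e24 : plCoord x 2 4 = x (idx 3 2) - x (idx 4 1) := by simp [plCoord, coeffN]; try rfl
  have e25 : plCoord x 2 5 = x (idx 4 2) := by simp [plCoord, coeffN]; try rfl
  have e34 : plCoord x 3 4 = x (idx 3 3) - x (idx 4 2) := by simp [plCoord, coeffN]; try rfl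
  have e35 : plCoord x 3 5 = x (idx 4 3) := by simp [plCoord, coeffN]; try rfl
  have e45 : plCoord x 4 5 = x (idx 4 4) := by simp [plCoord, coeffN]; try rfl
  simp only [gensK5, Set.mem_insert_iff, Set.mem_singleton_iff, forall_eq_or_imp, forall_eq]
  constructor
  · rintro ⟨g0, g1, g2, g3, g4, g5, g6, g7, g8, g9, g10, g11, g12, g13, g14, g15, g16, g17, g18,
    g19, g20, g21⟩
    have h0123 : plRel (plCoord x) 0 1 2 3 = 0 := by
      simp only [plRel, e01, e02, e03, e12, e13, e23]
      linear_combination g21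
    have h0124 : plRel (plCoord x) 0 1 2 4 = 0 := by
      simp only [plRel, e01, e02, e04, e12, e14, e24]
      linear_combination g20
    have h0125 : plRel (plCoord x) 0 1 2 5 = 0 := by
      simp only [plRel, e01, e02, e05, e12, e15, e25]
      linear_combination g18
    have h0134 : plRel (plCoord x) 0 1 3 4 = 0 := by
      simp only [plRel, e01, e03, e04, e13, e14, e34]
      linear_combination -g18 + g19
    have h0135 : plRel (plCoord x) 0 1 3 5 = 0 := by
      simp only [plRel, e01, e03, e05, e13, e15, e35]
      linear_combination g17
    have h0145 : plRel (plCoord x) 0 1 4 5 = 0 := by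
      simp only [plRel, e01, e04, e05, e14, e15, e45]
      linear_combination g16
    have h0234 : plRel (plCoord x) 0 2 3 4 = 0 := by
      simp only [plRel, e02, e03, e04, e23, e24, e34]
      linear_combination g12
    have h0235 : plRel (plCoord x) 0 2 3 5 = 0 := by
      simp only [plRel, e02, e03, e05, e23, e25, e35]
      linear_combination g11
    have h0245 : plRel (plCoord x) 0 2 4 5 = 0 := by
      simp only [plRel, e02, e04, e05, e24, e25, e45]
      linear_combination g10
    have h0345 : plRel (plCoord x) 0 3 4 5 = 0 := by
      simp only [plRel, e03, e04, e05, e34, e35, e45]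
      linear_combination g3
    have h1234 : plRel (plCoord x) 1 2 3 4 = 0 := by
      simp only [plRel, e12, e13, e14, e23, e24, e34]
      linear_combination g9
    have h1235 : plRel (plCoord x) 1 2 3 5 = 0 := by
      simp only [plRel, e12, e13, e15, e23, e25, e35]
      linear_combination g8
    have h1245 : plRel (plCoord x) 1 2 4 5 = 0 := by
      simp only [plRel, e12, e14, e15, e24, e25, e45]
      linear_combination -g3 + g7
    have h1345 : plRel (plCoord x) 1 3 4 5 = 0 := by
      simp only [plRel, e13, e14, e15, e34, e35, e45]
      linear_combination g1
    have h2345 : plRel (plCoord x) 2 3 4 5 = 0 := by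
      simp only [plRel, e23, e24, e25, e34, e35, e45]
      linear_combination g0
    intro i j k l hij hjk hkl hl
    interval_cases l <;> interval_cases k <;> interval_cases j <;> interval_cases i <;>
      assumption
  · intro h
    have h0123 := h 0 1 2 3 (by norm_num) (by norm_num) (by norm_num) (by norm_num)
    have h0124 := h 0 1 2 4 (by norm_num) (by norm_num) (by norm_num) (by norm_num)
    have h0125 := h 0 1 2 5 (by norm_num) (by norm_num) (by norm_num) (by norm_num)
    have h0134 := h 0 1 3 4 (by norm_num) (by norm_num) (by norm_num) (by norm_num)
    have h0135 := h 0 1 3 5 (by norm_num) (by norm_num) (by norm_num) (by norm_num)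
    have h0145 := h 0 1 4 5 (by norm_num) (by norm_num) (by norm_num) (by norm_num)
    have h0234 := h 0 2 3 4 (by norm_num) (by norm_num) (by norm_num) (by norm_num)
    have h0235 := h 0 2 3 5 (by norm_num) (by norm_num) (by norm_num) (by norm_num)
    have h0245 := h 0 2 4 5 (by norm_num) (by norm_num) (by norm_num) (by norm_num)
    have h0345 := h 0 3 4 5 (by norm_num) (by norm_num) (by norm_num) (by norm_num)
    have h1234 := h 1 2 3 4 (by norm_num) (by norm_num) (by norm_num) (by norm_num)
    have h1235 := h 1 2 3 5 (by norm_num) (by norm_num) (by norm_num) (by norm_num)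
    have h1245 := h 1 2 4 5 (by norm_num) (by norm_num) (by norm_num) (by norm_num)
    have h1345 := h 1 3 4 5 (by norm_num) (by norm_num) (by norm_num) (by norm_num)
    have h2345 := h 2 3 4 5 (by norm_num) (by norm_num) (by norm_num) (by norm_num)
    simp only [plRel, e01, e02, e03, e04, e05, e12, e13, e14, e15, e23, e24, e25, e34, e35, e45]
      at h0123 h0124 h0125 h0134 h0135 h0145 h0234 h0235 h0245 h0345 h1234 h1235 h1245 h1345 h2345
    clear h e01 e02 e03 e04 e05 e12 e13 e14 e15 e23 e24 e25 e34 e35 e45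
    refine ⟨?_, ?_, ?_, ?_, ?_, ?_, ?_, ?_, ?_, ?_, ?_, ?_, ?_, ?_, ?_, ?_, ?_, ?_, ?_, ?_, ?_, ?_⟩
    · linear_combination h2345
    · linear_combination h1345
    · linear_combination -x (idx 4 3) * h1234 + (x (idx 3 3) - x (idx 4 2)) * h1235
    · linear_combination h0345
    · linear_combination (x (idx 2 2) - x (idx 3 1)) * h0345 - x (idx 2 0) * h2345
    · linear_combination (x (idx 2 1) - x (idx 3 0)) * h0345 - x (idx 2 0) * h1345
    · linear_combination (x (idx 1 1) - x (idx 2 0)) * h0345 - x (idx 4 0) * h1234 + x (idx 3 0) *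
      h1235 - x (idx 2 0) * h1245
    · linear_combination h0345 + h1245
    · linear_combination h1235
    · linear_combination h1234
    · linear_combination h0245
    · linear_combination h0235
    · linear_combination h0234
    · linear_combination -x (idx 4 2) * h0124 + (x (idx 3 2) - x (idx 4 1)) * h0125
    · linear_combination (x (idx 1 1) - x (idx 2 0)) * h0235 - x (idx 1 0) * h1235
    · linear_combination (x (idx 1 1) - x (idx 2 0)) * h0234 - x (idx 1 0) * h1234
    · linear_combination h0145
    · linear_combination h0135
    · linear_combination h0125
    · linear_combination h0125 + h0134
    · linear_combination h0124
    · linear_combination h0123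

theorem charIdealK_four : charIdealK 4 = Ideal.span (gensK5 coeffVar) := by
  rw [charIdealK_eq_span]
  refine Ideal.span_eq_span_of_forall_quotient fun I => ?_
  have h := gensK5_eq_zero_iff fun v => Ideal.Quotient.mk I (X v)
  constructor
  · intro hI
    have h1 := h.2 fun i j k l hij hjk hkl hl => by
      have := hI _ ⟨i, j, k, l, hij, hjk, hkl, hl, rfl⟩
      simpa only [map_plRel, map_plCoord] using this
    simpa only [gensK5, coeffVar, Set.mem_insert_iff, Set.mem_singleton_iff, forall_eq_or_imp,
      forall_eq, map_add, map_sub, map_mul, map_pow] using h1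
  · rintro hI _ ⟨i, j, k, l, hij, hjk, hkl, hl, rfl⟩
    have h1 := h.1 (by
      simpa only [gensK5, coeffVar, Set.mem_insert_iff, Set.mem_singleton_iff, forall_eq_or_imp,
        forall_eq, map_add, map_sub, map_mul, map_pow] using hI) i j k l hij hjk hkl hl
    simpa only [map_plRel, map_plCoord] using h1

/-! ### Gröbner bases from leading exponents -/

section Groebner

variable {σ : Type} {m : MonomialOrder σ} {I : Ideal (MvPolynomial σ ℂ)} {S : Set (σ →₀ ℕ)}

/-- Division with remainder by the elements of an ideal with leading exponents in a given set. -/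
theorem exists_remainder (hS : ∀ s ∈ S, ∃ f ∈ I, MonicWith m f s) (f : MvPolynomial σ ℂ) :
    ∃ r, f - r ∈ I ∧ (∀ c ∈ r.support, ∀ s ∈ S, ¬ s ≤ c) ∧
      m.toSyn (m.degree r) ≤ m.toSyn (m.degree f) ∧
      (f ≠ 0 → r = 0 → ∃ s ∈ S, s ≤ m.degree f) := by
  obtain ⟨g, r, hfr, hdeg, hr⟩ := m.div_set (B := {b | b ∈ I ∧ ∃ s ∈ S, MonicWith m b s})
    (fun b hb => by
      obtain ⟨-, s, -, hb⟩ := hb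
      rw [hb.2]
      exact isUnit_one) f
  rw [Finsupp.linearCombination_apply, Finsupp.sum] at hfr
  set t := ∑ b ∈ g.support, g b • (b : MvPolynomial σ ℂ) with ht
  have htdeg : m.toSyn (m.degree t) ≤ m.toSyn (m.degree f) := by
    refine (MonomialOrder.degree_sum_le (m := m)).trans (Finset.sup_le fun b _ => ?_)
    rw [smul_eq_mul, mul_comm]
    exact hdeg b
  have hrt : r = f - t := by rw [hfr]; ring
  refine ⟨r, ?_, ?_, ?_, ?_⟩
  · rw [hrt, sub_sub_cancel]
    exact sum_mem fun b _ => Ideal.mul_mem_left _ _ b.2.1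
  · intro c hc s hs
    obtain ⟨b, hb, hbs⟩ := hS s hs
    have := hr c hc b ⟨hb, s, hs, hbs⟩
    rwa [hbs.1] at this
  · rw [hrt]
    exact MonomialOrder.degree_sub_le.trans (max_le le_rfl htdeg)
  -- If nothing remains, the leading monomial of `f` occurs in some product `g b * b`. The degree
  -- bound makes it the leading monomial of that product, hence a multiple of the leading monomial
  -- of `b`.
  · intro hf0 hr0
    rw [hr0, add_zero] at hfr
    have hc : t.coeff (m.degree f) ≠ 0 := by
      rw [← hfr]
      exact MonomialOrder.coeff_degree_ne_zero_iff.2 hf0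
    rw [ht, coeff_sum] at hc
    obtain ⟨b, -, hb⟩ := Finset.exists_ne_zero_of_sum_ne_zero hc
    obtain ⟨-, s, hs, hbs⟩ := b.2
    refine ⟨s, hs, ?_⟩
    rw [smul_eq_mul, mul_comm] at hb
    have hgb : g b ≠ 0 := by
      intro h
      rw [h, mul_zero, coeff_zero] at hb
      exact hb rfl
    have h1 : m.degree (b.1 * g b) = m.degree f :=
      m.toSyn.injective (le_antisymm (hdeg b)
        (MonomialOrder.le_degree (mem_support_iff.2 hb)))
    rw [MonomialOrder.degree_mul hbs.ne_zero hgb, hbs.1] at h1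
    exact h1 ▸ le_self_add

/-- An antichain of leading exponents of elements of an ideal which generates all leading exponents
gives rise to a reduced Gröbner basis. -/
theorem exists_isReducedGroebnerBasis (S : Finset (σ →₀ ℕ))
    (hanti : ∀ s ∈ S, ∀ t ∈ S, t ≤ s → t = s)
    (hS : ∀ s ∈ S, ∃ f ∈ I, MonicWith m f s)
    (hI : ∀ f ∈ I, f ≠ 0 → ∃ s ∈ S, s ≤ m.degree f) :
    ∃ G : Finset (MvPolynomial σ ℂ), G.card = S.card ∧
      Ideal.span (G : Set (MvPolynomial σ ℂ)) = I ∧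
        IsReducedGroebnerBasis m I (G : Set (MvPolynomial σ ℂ)) := by
  classical
  -- The basis element for `s` is the monomial minus its remainder. All other terms are standard,
  -- and `s` itself is divisible by no other member of the antichain.
  have key : ∀ s ∈ S, ∃ f ∈ I, MonicWith m f s ∧
      ∀ e ∈ f.support, ∀ t ∈ S, t ≠ s → ¬ t ≤ e := by
    intro s hs
    obtain ⟨r, hr, hrS, hrdeg, -⟩ :=
      exists_remainder (S := (S : Set (σ →₀ ℕ))) hS (monomial s (1 : ℂ))
    have hmon : m.degree (monomial s (1 : ℂ)) = s := by
      rw [MonomialOrder.degree_monomial, if_neg one_ne_zero]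
    have hsr : r.coeff s = 0 := by
      by_contra h
      exact hrS s (mem_support_iff.2 h) s hs le_rfl
    have hco : (monomial s (1 : ℂ) - r).coeff s = 1 := by
      rw [coeff_sub, coeff_monomial, if_pos rfl, hsr, sub_zero]
    have hdeg : m.degree (monomial s (1 : ℂ) - r) = s := by
      refine m.toSyn.injective (le_antisymm ?_ (MonomialOrder.le_degree (mem_support_iff.2 ?_)))
      · refine MonomialOrder.degree_sub_le.trans (max_le ?_ ?_)
        · rw [hmon]
        · rwa [hmon] at hrdeg
      · rw [hco]; exact one_ne_zero
    refine ⟨_, hr, ⟨hdeg, by rw [MonomialOrder.leadingCoeff, hdeg, hco]⟩, ?_⟩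
    intro e he t ht hts hte
    rw [mem_support_iff, coeff_sub, coeff_monomial] at he
    split_ifs at he with h
    · subst h
      exact hts (hanti _ hs _ ht hte)
    · rw [zero_sub, neg_ne_zero] at he
      exact hrS e (mem_support_iff.2 he) t ht hte
  choose! F hFI hF hFred using key
  have hinj : Set.InjOn F S := by
    intro s hs t ht h
    rw [← (hF s hs).1, h, (hF t ht).1]
  refine ⟨S.image F, Finset.card_image_of_injOn hinj, ?_, ?_⟩
  · apply le_antisymm
    · rw [Ideal.span_le, Finset.coe_image]
      rintro _ ⟨s, hs, rfl⟩
      exact hFI s hs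
    · intro f hf
      have hS' : ∀ s ∈ S, ∃ f ∈ Ideal.span (S.image F : Set (MvPolynomial σ ℂ)),
          MonicWith m f s := fun s hs =>
        ⟨F s, Ideal.subset_span (Finset.mem_coe.2 (Finset.mem_image_of_mem F hs)), hF s hs⟩
      obtain ⟨r, hr, hrS, -⟩ := exists_remainder (S := (S : Set (σ →₀ ℕ))) hS' f
      have hle : Ideal.span (S.image F : Set (MvPolynomial σ ℂ)) ≤ I := by
        rw [Ideal.span_le, Finset.coe_image]
        rintro _ ⟨s, hs, rfl⟩
        exact hFI s hs
      have hrI : r ∈ I := by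
        have := sub_mem hf (hle hr)
        rwa [sub_sub_cancel] at this
      have hr0 : r = 0 := by
        by_contra h
        obtain ⟨s, hs, hsr⟩ := hI r hrI h
        exact hrS _ (MonomialOrder.degree_mem_support h) s hs hsr
      rwa [hr0, sub_zero] at hr
  · constructor
    · intro g hg
      obtain ⟨s, hs, rfl⟩ := Finset.mem_image.1 (Finset.mem_coe.1 hg)
      exact hFI s hs
    · intro g hg
      obtain ⟨s, hs, rfl⟩ := Finset.mem_image.1 (Finset.mem_coe.1 hg)
      exact (hF s hs).2
    · intro f hf hf0
      obtain ⟨s, hs, hsf⟩ := hI f hf hf0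
      exact ⟨F s, Finset.mem_coe.2 (Finset.mem_image_of_mem F hs), by rwa [(hF s hs).1]⟩
    · intro g hg h hh hne e he
      obtain ⟨s, hs, rfl⟩ := Finset.mem_image.1 (Finset.mem_coe.1 hg)
      obtain ⟨t, ht, rfl⟩ := Finset.mem_image.1 (Finset.mem_coe.1 hh)
      rw [(hF t ht).1]
      exact hFred s hs e he t ht fun h => hne (h ▸ rfl)

/-- If in each degree the standard monomials are at most as many as suitable linearly independent
values of a homomorphism vanishing on a homogeneous ideal, then every leading exponent of the ideal
is a multiple of one of the given leading exponents. -/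
theorem exists_le_degree_of_card_le [Fintype σ] [DecidableEq σ] {Q : Type*} [CommRing Q]
    [Algebra ℂ Q] (hS : ∀ s ∈ S, ∃ f ∈ I, MonicWith m f s)
    (hhom : ∀ f ∈ I, ∀ k, homogeneousComponent k f ∈ I)
    (ψ : MvPolynomial σ ℂ →ₐ[ℂ] Q) (hψ : ∀ f ∈ I, ψ f = 0)
    (M : ℕ → Finset (σ →₀ ℕ))
    (hM : ∀ k c, c ∈ M k ↔ c.degree = k ∧ ∀ s ∈ S, ¬ s ≤ c)
    (hcard : ∀ k, ∃ (ι : Type) (_ : Fintype ι) (h : ι → MvPolynomial σ ℂ),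
      (∀ i, (h i).IsHomogeneous k) ∧ LinearIndependent ℂ (fun i => ψ (h i)) ∧
        (M k).card ≤ Fintype.card ι) :
    ∀ f ∈ I, f ≠ 0 → ∃ s ∈ S, s ≤ m.degree f := by
  intro f hf hf0
  obtain ⟨r, hr, hrS, -, hr0⟩ := exists_remainder hS f
  refine hr0 hf0 ?_
  have hrI : r ∈ I := by
    have := sub_mem hf hr
    rwa [sub_sub_cancel] at this
  ext c
  rw [coeff_zero]
  obtain ⟨ι, _, h, hh, hind, hle⟩ := hcard c.degree
  set k := c.degree with hk
  set T : (M k → ℂ) →ₗ[ℂ] Q := Fintype.linearCombination ℂ fun c : M k => ψ (monomial c.1 1)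
    with hT
  have hTr : ∀ r : MvPolynomial σ ℂ, (∀ c ∈ r.support, ∀ s ∈ S, ¬ s ≤ c) →
      T (fun c => r.coeff c.1) = ψ (homogeneousComponent k r) := by
    intro r hr
    rw [hT, Fintype.linearCombination_apply, homogeneousComponent_apply, map_sum,
      Finset.sum_coe_sort (M k) fun c => r.coeff c • ψ (monomial c 1)]
    symm
    refine Finset.sum_subset_zero_on_sdiff (fun c hc => ?_) (fun c hc => ?_) fun c hc => ?_
    · rw [Finset.mem_filter] at hc
      exact (hM k c).2 ⟨hc.2, hr c hc.1⟩
    · rw [Finset.mem_sdiff, Finset.mem_filter, not_and] at hc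
      have h0 : c ∉ r.support := fun h => hc.2 h ((hM k c).1 hc.1).1
      rw [notMem_support_iff.1 h0, zero_smul]
    · rw [← map_smul, smul_monomial, smul_eq_mul, mul_one]
  have hrange : ∀ i, ψ (h i) ∈ LinearMap.range T := by
    intro i
    obtain ⟨t, ht, htS, -⟩ := exists_remainder hS (h i)
    refine ⟨_, (hTr t htS).trans ?_⟩
    have h1 := hψ _ (hhom _ ht k)
    rw [map_sub, map_sub, homogeneousComponent_of_mem (hh i), if_pos rfl, sub_eq_zero] at h1
    exact h1.symm
  -- The range contains at least as many independent vectors as there are standard monomials of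
  -- degree `k`, so the values of these monomials are independent.
  have hker : LinearMap.ker T = ⊥ := by
    have h1 : Fintype.card ι ≤ Module.finrank ℂ (LinearMap.range T) := by
      rw [← finrank_span_eq_card hind]
      exact Submodule.finrank_mono (Submodule.span_le.2 (by rintro _ ⟨i, rfl⟩; exact hrange i))
    have h2 := LinearMap.finrank_range_add_finrank_ker T
    rw [Module.finrank_fintype_fun_eq_card, Fintype.card_coe] at h2
    exact Submodule.finrank_eq_zero.1 (by omega)
  by_contra hc
  have hcM : c ∈ M k := (hM k c).2 ⟨rfl, hrS c (mem_support_iff.2 hc)⟩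
  have h0 : (fun c : M k => r.coeff c.1) = 0 := by
    rw [← Submodule.mem_bot ℂ, ← hker, LinearMap.mem_ker, hTr r hrS]
    exact hψ _ (hhom _ hrI k)
  exact hc (congrFun h0 ⟨c, hcM⟩)

end Groebner

/-! ### Counting the faces of a simplicial complex -/

section Faces

/-- Sum of two coefficient lists. -/
def addList : List ℕ → List ℕ → List ℕ
  | [], l => l
  | a :: l, [] => a :: l
  | a :: l, b :: l' => (a + b) :: addList l l'

/-- The value `∑ i, l_i φ(i)`. -/
def weigh : List ℕ → (ℕ → ℕ) → ℕ
  | [], _ => 0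
  | a :: l, φ => a * φ 0 + weigh l fun i => φ (i + 1)

theorem weigh_addList (l l' : List ℕ) (φ : ℕ → ℕ) :
    weigh (addList l l') φ = weigh l φ + weigh l' φ := by
  induction l generalizing l' φ with
  | nil => simp [addList, weigh]
  | cons a l ih =>
    cases l' with
    | nil => simp [addList, weigh]
    | cons b l' =>
      simp only [addList, weigh, ih]
      ring

/-- Whether the empty set is a member of the list. -/
def hasNil : List (List ℕ) → Bool
  | [] => false
  | [] :: _ => true
  | (_ :: _) :: G => hasNil G

theorem hasNil_eq_true {G : List (List ℕ)} : hasNil G = true ↔ [] ∈ G := by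
  induction G with
  | nil => simp [hasNil]
  | cons g G ih => cases g <;> simp [hasNil, ih]

/-- The sets which do not start with `v`. -/
def deleteHead (v : ℕ) : List (List ℕ) → List (List ℕ)
  | [] => []
  | [] :: G => [] :: deleteHead v G
  | (x :: g) :: G => bif Nat.beq x v then deleteHead v G else (x :: g) :: deleteHead v G

/-- The sets with a first element `v` removed. -/
def contractHead (v : ℕ) : List (List ℕ) → List (List ℕ)
  | [] => []
  | [] :: G => [] :: contractHead v G
  | (x :: g) :: G => (bif Nat.beq x v then g else x :: g) :: contractHead v G

/-- The numbers of faces of each size of the simplicial complex on the vertices `vs` with the list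
of nonfaces `G`. -/
def faceCount : List ℕ → List (List ℕ) → List ℕ
  | [], G => bif hasNil G then [] else [1]
  | v :: vs, G =>
    bif hasNil G then [] else
      -- Without nonfaces the two branches agree, and the recursion is evaluated only once.
      bif G.isEmpty then (fun l => addList l (0 :: l)) (faceCount vs [])
      else addList (faceCount vs (deleteHead v G)) (0 :: faceCount vs (contractHead v G))

theorem mem_deleteHead {v : ℕ} {G : List (List ℕ)} {g : List ℕ} :
    g ∈ deleteHead v G ↔ g ∈ G ∧ g.head? ≠ some v := by
  induction G with
  | nil => simp [deleteHead]
  | cons h G ih =>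
    cases h with
    | nil =>
      simp only [deleteHead, List.mem_cons, ih]
      constructor
      · rintro (rfl | h)
        · simp
        · exact ⟨Or.inr h.1, h.2⟩
      · rintro ⟨rfl | h, h'⟩
        · exact Or.inl rfl
        · exact Or.inr ⟨h, h'⟩
    | cons x h =>
      by_cases hx : x = v
      · subst hx
        simp only [deleteHead, Nat.beq_refl, cond_true, ih, List.mem_cons]
        constructor
        · exact fun h => ⟨Or.inr h.1, h.2⟩
        · rintro ⟨rfl | h, h'⟩
          · simp at h'
          · exact ⟨h, h'⟩
      · have : Nat.beq x v = false := by
          rw [← Bool.not_eq_true, Nat.beq_eq]; exact hx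
        simp only [deleteHead, this, cond_false, List.mem_cons, ih]
        constructor
        · rintro (rfl | h)
          · simpa using hx
          · exact ⟨Or.inr h.1, h.2⟩
        · rintro ⟨rfl | h, h'⟩
          · exact Or.inl rfl
          · exact Or.inr ⟨h, h'⟩

theorem contractHead_eq_map (v : ℕ) (G : List (List ℕ)) :
    contractHead v G = G.map fun g => if g.head? = some v then g.tail else g := by
  induction G with
  | nil => rfl
  | cons h G ih =>
    cases h with
    | nil => simp [contractHead, ih]
    | cons x h =>
      by_cases hx : x = v
      · subst hx
        simp [contractHead, ih]
      · have : Nat.beq x v = false := by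
          rw [← Bool.not_eq_true, Nat.beq_eq]; exact hx
        simp [contractHead, ih, this, hx]

/-- `F` contains no member of `G`. -/
def IsFace (G : List (List ℕ)) (F : Finset ℕ) : Prop := ∀ g ∈ G, ¬ ∀ x ∈ g, x ∈ F

-- Faces avoiding `v` only see the nonfaces without `v`; faces through `v` correspond to faces of
-- the complex with `v` removed from the nonfaces. As nonfaces are sublists of `vs`, `v` can occur
-- in them only as the head. The weight is arbitrary because the second case shifts it.
open Classical in
theorem sum_isFace_eq_weigh : ∀ (vs : List ℕ) (G : List (List ℕ)), vs.Nodup →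
    (∀ g ∈ G, g.Sublist vs) → ∀ φ : ℕ → ℕ,
      ∑ F ∈ vs.toFinset.powerset, (if IsFace G F then φ F.card else 0) = weigh (faceCount vs G) φ
  | [], G, _, hG, φ => by
    simp only [List.toFinset_nil, Finset.powerset_empty, Finset.sum_singleton, faceCount]
    by_cases h : [] ∈ G
    · rw [hasNil_eq_true.2 h, if_neg fun h' => h' [] h (by simp)]
      rfl
    · have h' : hasNil G = false := by rwa [← Bool.not_eq_true, hasNil_eq_true]
      rw [h', if_pos]
      · simp [weigh]
      · intro g hg hgF
        cases g with
        | nil => exact h hg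
        | cons x g => simpa using hgF x (by simp)
  | v :: vs, G, hvs, hG, φ => by
    by_cases h : [] ∈ G
    · rw [faceCount, hasNil_eq_true.2 h, cond_true, weigh]
      exact Finset.sum_eq_zero fun F _ => if_neg fun h' => h' [] h (by simp)
    have h' : hasNil G = false := by rwa [← Bool.not_eq_true, hasNil_eq_true]
    obtain ⟨hv, hvs'⟩ := List.nodup_cons.1 hvs
    have hv' : v ∉ vs.toFinset := by simpa using hv
    have hcard : ∀ F ∈ vs.toFinset.powerset, (insert v F).card = F.card + 1 := fun F hF =>
      Finset.card_insert_of_notMem fun h => hv' (Finset.mem_powerset.1 hF h)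
    rw [faceCount, h', cond_false, List.toFinset_cons, Finset.sum_powerset_insert hv']
    cases G with
    | nil =>
      have hface : ∀ F, IsFace [] F := fun F g hg => absurd hg List.not_mem_nil
      have ih := fun φ => sum_isFace_eq_weigh vs [] hvs' (by simp) φ
      simp only [hface, if_true] at ih ⊢
      rw [List.isEmpty_nil, cond_true, weigh_addList, weigh, zero_mul, zero_add, ← ih, ← ih]
      congr 1
      exact Finset.sum_congr rfl fun F hF => by rw [hcard F hF]
    | cons g₀ G₀ =>
      rw [List.isEmpty_cons, cond_false]
      set G := g₀ :: G₀
      have hsub : ∀ g ∈ G, g.head? ≠ some v → g.Sublist vs := by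
        intro g hg hgv
        cases hG g hg with
        | cons _ h => exact h
        | cons_cons _ h => simp at hgv
      have htail : ∀ g ∈ G, g.head? = some v → ∃ g', g = v :: g' ∧ g'.Sublist vs := by
        intro g hg hgv
        cases g with
        | nil => simp at hgv
        | cons x g =>
          obtain rfl : x = v := by simpa using hgv
          exact ⟨g, rfl, List.cons_sublist_cons.1 (hG _ hg)⟩
      rw [weigh_addList, weigh, zero_mul, zero_add,
        ← sum_isFace_eq_weigh vs (deleteHead v G) hvs' ?_ φ,
        ← sum_isFace_eq_weigh vs (contractHead v G) hvs' ?_ fun i => φ (i + 1)]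
      · congr 1
        · refine Finset.sum_congr rfl fun F hF => ?_
          have hvF : v ∉ F := fun h => hv' (Finset.mem_powerset.1 hF h)
          congr 1
          rw [eq_iff_iff]
          constructor
          · exact fun hf g hg => hf g (mem_deleteHead.1 hg).1
          · intro hf g hg hgF
            by_cases hgv : g.head? = some v
            · obtain ⟨g', rfl, -⟩ := htail g hg hgv
              exact hvF (hgF v (by simp))
            · exact hf g (mem_deleteHead.2 ⟨hg, hgv⟩) hgF
        · refine Finset.sum_congr rfl fun F hF => ?_
          rw [hcard F hF]
          congr 1
          rw [eq_iff_iff, contractHead_eq_map]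
          unfold IsFace
          rw [List.forall_mem_map]
          refine forall₂_congr fun g hg => not_congr ?_
          split_ifs with hgv
          · obtain ⟨g', rfl, hg'⟩ := htail g hg hgv
            simp only [List.tail_cons, List.mem_cons, forall_eq_or_imp, Finset.mem_insert, true_or,
              true_and]
            refine forall₂_congr fun x hx => or_iff_right ?_
            rintro rfl
            exact hv (hg'.subset hx)
          · refine forall₂_congr fun x hx => ?_
            rw [Finset.mem_insert]
            refine or_iff_right ?_
            rintro rfl
            exact hv ((hsub g hg hgv).subset hx)
      · rw [contractHead_eq_map, List.forall_mem_map]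
        intro g hg
        split_ifs with hgv
        · obtain ⟨g', rfl, hg'⟩ := htail g hg hgv
          exact hg'
        · exact hsub g hg hgv
      · intro g hg
        obtain ⟨hg, hgv⟩ := mem_deleteHead.1 hg
        exact hsub g hg hgv

/-! ### From face numbers to numbers of monomials -/

variable {V : Type} [Fintype V] [DecidableEq V]

/-- The number of exponents of given degree and support depends only on the size of the support. -/
theorem card_finsuppAntidiag_support_eq (k : ℕ) {F F' : Finset V} (h : F.card = F'.card) :
    ((Finset.univ.finsuppAntidiag k).filter fun c : V →₀ ℕ => c.support = F).card =
      ((Finset.univ.finsuppAntidiag k).filter fun c : V →₀ ℕ => c.support = F').card := by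
  have key : ∀ {F F' : Finset V}, F.card = F'.card →
      ((Finset.univ.finsuppAntidiag k).filter fun c : V →₀ ℕ => c.support = F).card ≤
        ((Finset.univ.finsuppAntidiag k).filter fun c : V →₀ ℕ => c.support = F').card := by
    intro F F' h
    obtain ⟨π, hπ⟩ : ∃ π : Equiv.Perm V, F.map π.toEmbedding = F' := by
      let e : {x // x ∈ F} ≃ {x // x ∈ F'} := Fintype.equivOfCardEq (by simpa using h)
      refine ⟨e.extendSubtype, Finset.eq_of_subset_of_card_le (fun x hx => ?_)
        (by rw [Finset.card_map, h])⟩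
      obtain ⟨y, hy, rfl⟩ := Finset.mem_map.1 hx
      exact e.extendSubtype_mem y hy
    refine Finset.card_le_card_of_injOn (fun c => c.equivMapDomain π) (fun c hc => ?_) ?_
    · simp only [Finset.coe_filter, Finset.mem_finsuppAntidiag, Finset.subset_univ, and_true,
        Set.mem_ofPred_eq] at hc ⊢
      constructor
      · rw [← hc.1]
        exact Equiv.sum_comp π.symm c
      · rw [← hπ, ← hc.2]
        rfl
    · exact fun c _ c' _ h => (Finsupp.domCongr (M := ℕ) π).injective h
  exact le_antisymm (key h) (key h.symm)

open Classical in
/-- Two simplicial complexes with equal numbers of faces have equally many exponents of each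
degree supported on faces. -/
theorem card_filter_isFace_eq (code : V ↪ ℕ) {vs vs' : List ℕ} {G G' : List (List ℕ)}
    (hvs : vs.Nodup) (hvs' : vs'.Nodup) (hcode : vs.toFinset = Finset.univ.map code)
    (hcode' : vs'.toFinset = Finset.univ.map code) (hG : ∀ g ∈ G, g.Sublist vs)
    (hG' : ∀ g ∈ G', g.Sublist vs') (h : faceCount vs G = faceCount vs' G') (k : ℕ) :
    ((Finset.univ.finsuppAntidiag k).filter
      fun c : V →₀ ℕ => IsFace G (c.support.map code)).card =
    ((Finset.univ.finsuppAntidiag k).filter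
      fun c : V →₀ ℕ => IsFace G' (c.support.map code)).card := by
  obtain ⟨φ, hφ⟩ : ∃ φ : ℕ → ℕ, ∀ F : Finset V, ((Finset.univ.finsuppAntidiag k).filter
      fun c : V →₀ ℕ => c.support = F).card = φ F.card := by
    choose! F hF using fun (j : ℕ) (h : ∃ F : Finset V, F.card = j) => h
    exact ⟨fun j => ((Finset.univ.finsuppAntidiag k).filter fun c : V →₀ ℕ =>
      c.support = F j).card,
      fun F' => card_finsuppAntidiag_support_eq k (hF _ ⟨F', rfl⟩).symm⟩
  have key : ∀ {vs : List ℕ} {G : List (List ℕ)}, vs.Nodup → vs.toFinset = Finset.univ.map code →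
      (∀ g ∈ G, g.Sublist vs) → ((Finset.univ.finsuppAntidiag k).filter
        fun c : V →₀ ℕ => IsFace G (c.support.map code)).card = weigh (faceCount vs G) φ := by
    intro vs G hvs hcode hG
    rw [← sum_isFace_eq_weigh vs G hvs hG φ, hcode,
      Finset.card_eq_sum_card_fiberwise (f := fun c => c.support) (t := Finset.univ)
        (fun _ _ => Finset.mem_coe.2 (Finset.mem_univ _))]
    refine Finset.sum_bij (fun F _ => F.map code) (fun F _ => ?_)
      (fun F _ F' _ h => Finset.map_injective code h) (fun F hF => ?_) fun F _ => ?_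
    · rw [Finset.mem_powerset]
      exact Finset.map_subset_map.2 (Finset.subset_univ F)
    · obtain ⟨u, -, rfl⟩ := Finset.subset_map_iff.1 (Finset.mem_powerset.1 hF)
      exact ⟨u, Finset.mem_univ u, rfl⟩
    · rw [Finset.filter_filter, Finset.card_map]
      split_ifs with hF
      · rw [← hφ F]
        congr 1
        refine Finset.filter_congr fun c _ => ?_
        refine and_iff_right_of_imp ?_
        rintro rfl
        exact hF
      · rw [Finset.card_eq_zero, Finset.filter_eq_empty_iff]
        rintro c - ⟨h1, rfl⟩
        exact hF h1
  rw [key hvs hcode hG, key hvs' hcode' hG', h]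

end Faces

/-! ### Characteristic ideals with one coefficient of the top row put to zero -/

section Reduced

theorem _root_.MvPolynomial.IsHomogeneous.aeval_smul {σ R : Type*} [CommRing R]
    {f : MvPolynomial σ R} {k : ℕ} (hf : f.IsHomogeneous k) (t : R) (x : σ → R) :
    aeval (t • x) f = t ^ k * aeval x f := by
  rw [aeval_def, aeval_def, eval₂_eq, eval₂_eq, Finset.mul_sum]
  refine Finset.sum_congr rfl fun c hc => ?_
  have hk : c.degree = k := by
    rw [Finsupp.degree_eq_weight_one]
    exact hf (mem_support_iff.1 hc)
  simp only [Pi.smul_apply, smul_eq_mul, mul_pow, Finset.prod_mul_distrib,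
    Finset.prod_pow_eq_pow_sum]
  rw [← hk, Finsupp.degree_apply]
  ring

variable {d : ℕ} {j : Fin (d + 1)}

theorem aeval_reducedCoeff {q s : Fin (d + 1) → ℂ} (hq : q j = 0) (u : CoeffIdx d) :
    aeval (fun v : {v : CoeffIdx d // v ≠ idx (Fin.last d) j} => bezPoint d q s v)
      (reducedCoeff d (idx (Fin.last d) j) u) = bezPoint d q s u := by
  unfold reducedCoeff
  split_ifs with h
  · rw [h, bezPoint_top, hq, map_zero]
  · rw [aeval_X]

/-- The reduced characteristic ideal vanishes at Bezoutians of polynomials with `p_{d+1} ≠ 0`. -/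
theorem aeval_bezCoeff_of_mem_reduced
    {f : MvPolynomial {v : CoeffIdx d // v ≠ idx (Fin.last d) j} ℂ}
    (hf : f ∈ charIdealKReduced d (idx (Fin.last d) j)) {p q : ℕ → ℂ}
    (hp : ∀ k, d + 1 < k → p k = 0) (hq : ∀ k, d + 1 < k → q k = 0) (h0 : p (d + 1) ≠ 0)
    (h : p (d + 1) * q j - q (d + 1) * p j = 0) :
    aeval (fun v : {v : CoeffIdx d // v ≠ idx (Fin.last d) j} => bezCoeff d p q v) f = 0 := by
  obtain ⟨s, hs⟩ := exists_bezCoeff_eq_bezPoint hp hq h0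
  rw [hs]
  exact (mem_charIdealKReduced j f).1 hf _ _ h

theorem bezPoint_smul (t : ℂ) (q s : Fin (d + 1) → ℂ) (v : CoeffIdx d) :
    bezPoint d (t • q) s v = t * bezPoint d q s v := by
  have hl : ∀ k, lowCoeff (t • q) k = t * lowCoeff q k := by
    intro k
    unfold lowCoeff
    split_ifs <;> simp
  rw [bezPoint, funext hl]
  exact bez_smul_right _ _ _ _ _

/-- The reduced characteristic ideal is homogeneous. -/
theorem homogeneousComponent_mem_charIdealKReduced
    {f : MvPolynomial {v : CoeffIdx d // v ≠ idx (Fin.last d) j} ℂ}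
    (hf : f ∈ charIdealKReduced d (idx (Fin.last d) j)) (k : ℕ) :
    homogeneousComponent k f ∈ charIdealKReduced d (idx (Fin.last d) j) := by
  rw [mem_charIdealKReduced] at hf ⊢
  intro q s hq
  set x : {v : CoeffIdx d // v ≠ idx (Fin.last d) j} → ℂ := fun v => bezPoint d q s v with hx
  -- Scaling `q` by `t` scales the Bezoutian by `t`, so the values of the homogeneous components are
  -- the coefficients of a polynomial in `t` that vanishes identically.
  have hP : (∑ i ∈ Finset.range (f.totalDegree + 1),
      Polynomial.monomial i (aeval x (homogeneousComponent i f))) = 0 := by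
    refine Polynomial.funext fun t => ?_
    have h1 := hf (t • q) s (by rw [Pi.smul_apply, hq, smul_zero])
    have h2 : (fun v : {v : CoeffIdx d // v ≠ idx (Fin.last d) j} =>
        bezPoint d (t • q) s v) = t • x := by
      funext v
      exact bezPoint_smul t q s v
    rw [h2, ← sum_homogeneousComponent f, map_sum] at h1
    rw [Polynomial.eval_finsetSum, Polynomial.eval_zero, ← h1]
    refine Finset.sum_congr rfl fun i _ => ?_
    rw [Polynomial.eval_monomial, (homogeneousComponent_isHomogeneous i f).aeval_smul, mul_comm]
  by_cases hk : k < f.totalDegree + 1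
  · have := congrArg (fun P => Polynomial.coeff P k) hP
    simpa [Polynomial.finsetSum_coeff, Polynomial.coeff_monomial, hk] using this
  · rw [homogeneousComponent_eq_zero _ _ (by omega), map_zero]

end Reduced

/-! ### Leading exponents for `K_6` with `a_{54} = 0` -/

section KSix

/-- The indices of the coefficients other than `a_{54}`. -/
abbrev RedIdx : Type := {v : CoeffIdx 5 // v ≠ idx (Fin.last 5) 4}

/-- The index of the coefficient `a_{b-1,a}`. -/
def redVar (a b : ℕ) (h : a < b ∧ b < 7 ∧ ¬ (a = 4 ∧ b = 6)) : RedIdx :=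
  ⟨idx ⟨b - 1, by omega⟩ ⟨a, by omega⟩, fun h' => by
    have h1 : (⟨a, by omega⟩ : Fin 6) ≤ ⟨b - 1, by omega⟩ := Nat.le_sub_one_of_lt h.1
    have h2 := congrArg (fun v : CoeffIdx 5 => (ofLex v.1)) h'
    simp only [idx, ofLex_toLex, max_eq_left h1, min_eq_right h1, Prod.mk.injEq, Fin.ext_iff] at h2
    have h3 : b - 1 = 5 := h2.1
    have h4 : a = 4 := h2.2
    omega⟩

theorem exists_eq_redVar (v : RedIdx) : ∃ a b h, v = redVar a b h := by
  obtain ⟨v, hv⟩ := v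
  have h1 : ((ofLex v.1).2 : ℕ) ≤ (ofLex v.1).1 := v.2
  have h2 : ((ofLex v.1).1 : ℕ) < 6 := Fin.is_lt _
  refine ⟨(ofLex v.1).2, (ofLex v.1).1 + 1, ⟨by omega, by omega, fun h => hv ?_⟩,
    Subtype.ext (idx_eta v).symm⟩
  rw [← idx_eta v]
  congr 1
  · exact Fin.ext (by have := h.2; simp only [Fin.val_last]; omega)
  · exact Fin.ext h.1

theorem val_redVar {a b : ℕ} (h : a < b ∧ b < 7 ∧ ¬ (a = 4 ∧ b = 6)) :
    (redVar a b h).1.1 = toLex ((⟨b - 1, by omega⟩ : Fin 6), (⟨a, by omega⟩ : Fin 6)) := by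
  have h1 : (⟨a, by omega⟩ : Fin 6) ≤ ⟨b - 1, by omega⟩ := Nat.le_sub_one_of_lt h.1
  simp only [redVar, idx, max_eq_left h1, min_eq_right h1]

/-- The code `7 a + b` of the index of `a_{b-1,a}`. -/
def redCode : RedIdx ↪ ℕ where
  toFun v := 7 * (ofLex v.1.1).2 + ((ofLex v.1.1).1 + 1)
  inj' v w h := by
    obtain ⟨a, b, hab, rfl⟩ := exists_eq_redVar v
    obtain ⟨a', b', hab', rfl⟩ := exists_eq_redVar w
    simp only [val_redVar, ofLex_toLex] at h
    obtain rfl : a = a' := by omega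
    obtain rfl : b = b' := by omega
    rfl

theorem redCode_redVar {a b : ℕ} (h : a < b ∧ b < 7 ∧ ¬ (a = 4 ∧ b = 6)) :
    redCode (redVar a b h) = 7 * a + b := by
  change 7 * ((ofLex (redVar a b h).1.1).2 : ℕ) + ((ofLex (redVar a b h).1.1).1 + 1) = _
  rw [val_redVar]
  simp only [ofLex_toLex]
  omega

theorem redVar_lt_redVar {a b a' b' : ℕ} (h : a < b ∧ b < 7 ∧ ¬ (a = 4 ∧ b = 6))
    (h' : a' < b' ∧ b' < 7 ∧ ¬ (a' = 4 ∧ b' = 6)) (hlt : b < b' ∨ b = b' ∧ a < a') :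
    redVar a b h < redVar a' b' h' := by
  change (redVar a b h).1.1 < (redVar a' b' h').1.1
  rw [val_redVar, val_redVar, Prod.Lex.toLex_lt_toLex]
  simp only [Fin.mk_lt_mk, Fin.mk.injEq]
  omega

/-- The Plücker coordinates in terms of the coefficients other than `a_{54}`. -/
noncomputable def redCoord (a b : ℕ) : MvPolynomial RedIdx ℂ := plCoord (reducedCoeff 5 (idx (Fin.last 5) 4)) a b

theorem coeffN_reducedCoeff {a b : ℕ} (h : a < b ∧ b < 7 ∧ ¬ (a = 4 ∧ b = 6)) :
    coeffN (reducedCoeff 5 (idx (Fin.last 5) 4)) (b - 1) a = X (redVar a b h) := by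
  rw [coeffN, dif_pos ⟨by omega, by omega⟩, reducedCoeff, dif_neg]
  rfl

theorem coeffN_reducedCoeff_eq_zero {a b : ℕ} (hab : a < b)
    (h : ¬ (a < b ∧ b < 7 ∧ ¬ (a = 4 ∧ b = 6))) :
    coeffN (reducedCoeff 5 (idx (Fin.last 5) 4)) (b - 1) a = 0 := by
  unfold coeffN
  split_ifs with h1
  · obtain ⟨rfl, rfl⟩ : a = 4 ∧ b = 6 := by omega
    exact dif_pos rfl
  · rfl

theorem coeffN_reducedCoeff_mem {a b x y : ℕ} (h : x < y ∧ y < 7 ∧ ¬ (x = 4 ∧ y = 6))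
    (hab : a < b) (hlt : y < b ∨ y = b ∧ x < a) :
    coeffN (reducedCoeff 5 (idx (Fin.last 5) 4)) (b - 1) a ∈
      supported ℂ (Set.Ioi (redVar x y h)) := by
  by_cases h' : a < b ∧ b < 7 ∧ ¬ (a = 4 ∧ b = 6)
  · rw [coeffN_reducedCoeff h']
    exact X_mem_supported.2 (redVar_lt_redVar h h' hlt)
  · rw [coeffN_reducedCoeff_eq_zero hab h']
    exact zero_mem _

theorem redCoord_self {a : ℕ} (ha : 1 ≤ a) : redCoord a a = 0 := by
  rw [redCoord, plCoord, if_neg (by omega), sub_eq_zero]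
  unfold coeffN
  split_ifs with h1 h2 h2
  · exact congrArg _ (idx_comm _ _)
  · omega
  · omega
  · rfl

theorem redCoord_mem {a b x y : ℕ} (h : x < y ∧ y < 7 ∧ ¬ (x = 4 ∧ y = 6))
    (hab : a ≤ b) (ha : 1 ≤ a ∨ a < b) (hlt : y < b ∨ y = b ∧ x < a) :
    redCoord a b ∈ supported ℂ (Set.Ioi (redVar x y h)) := by
  rcases hab.eq_or_lt with rfl | hab
  · rw [redCoord_self (by omega)]
    exact zero_mem _
  · refine sub_mem (coeffN_reducedCoeff_mem h hab hlt) ?_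
    split_ifs
    · exact zero_mem _
    · exact coeffN_reducedCoeff_mem (b := b + 1) h (by omega) (by omega)

/-- The correction `a_{b,a-1}` in `D_ab = a_{b-1,a} - a_{b,a-1}` comes later in the order of the
variables, so it is smaller. -/
theorem monicWith_redCoord {a b : ℕ} (h : a < b ∧ b < 7 ∧ ¬ (a = 4 ∧ b = 6)) :
    MonicWith MonomialOrder.lex (redCoord a b) (Finsupp.single (redVar a b h) 1) := by
  rw [redCoord, plCoord, coeffN_reducedCoeff h, sub_eq_add_neg]
  refine MonicWith.add_supported (v := redVar a b h) (monicWith_X _) (by simp) (neg_mem ?_)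
  split_ifs
  · exact zero_mem _
  · exact coeffN_reducedCoeff_mem (b := b + 1) h (by omega) (by omega)

theorem redCoord_isHomogeneous (a b : ℕ) : (redCoord a b).IsHomogeneous 1 := by
  have h : ∀ i j, (coeffN (reducedCoeff 5 (idx (Fin.last 5) 4)) i j).IsHomogeneous 1 := by
    intro i j
    unfold coeffN reducedCoeff
    split_ifs
    · exact isHomogeneous_zero _ _ _
    · exact isHomogeneous_X _ _
    · exact isHomogeneous_zero _ _ _
  refine (h _ _).sub ?_
  split_ifs
  · exact isHomogeneous_zero _ _ _
  · exact h _ _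

/-! ### Quadratic and cubic elements of the reduced ideal -/

/-- The reduced characteristic ideal of `K_6`. -/
noncomputable abbrev redIdeal : Ideal (MvPolynomial RedIdx ℂ) := charIdealKReduced 5 (idx (Fin.last 5) 4)

theorem mem_redIdeal {f : MvPolynomial RedIdx ℂ}
    (h : ∀ (p q : ℕ → ℂ) (φ : MvPolynomial RedIdx ℂ →ₐ[ℂ] ℂ),
      (∀ a b, a < b → φ (redCoord a b) = p b * q a - p a * q b) → φ f = 0) : f ∈ redIdeal := by
  rw [redIdeal, mem_charIdealKReduced]
  intro q s hq
  refine h (symCoeff s) (lowCoeff q) _ fun a b hab => ?_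
  rw [redCoord, map_plCoord]
  simp only [aeval_reducedCoeff hq]
  exact plCoord_bezCoeff (fun k hk => symCoeff_of_lt s hk) (fun k hk => lowCoeff_of_le q hk.le) hab

/-- A `3 × 3` minor of a family `D`. -/
def detRel {R ι : Type*} [CommRing R] (D : ι → ι → R) (i j k p q r : ι) : R :=
  D i p * (D j q * D k r - D j r * D k q) +
    (D i r * (D j p * D k q - D j q * D k p) - D i q * (D j p * D k r - D j r * D k p))

theorem plRel_mem_redIdeal {i j k l : ℕ} (hij : i < j) (hjk : j < k) (hkl : k < l) :
    plRel redCoord i j k l ∈ redIdeal := by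
  refine mem_redIdeal fun p q φ h => ?_
  rw [map_plRel, plRel, h _ _ (by omega), h _ _ (by omega), h _ _ (by omega), h _ _ (by omega),
    h _ _ (by omega), h _ _ (by omega)]
  ring

/-- The matrix `p_b q_a - p_a q_b` has rank at most two. For `k = p` the entry `D_kk` is zero, in
accordance with skew symmetry. -/
theorem detRel_mem_redIdeal {i j k p q r : ℕ} (hij : i < j) (hjk : j < k) (hkp : k ≤ p)
    (hpq : p < q) (hqr : q < r) : detRel redCoord i j k p q r ∈ redIdeal := by
  refine mem_redIdeal fun P Q φ h => ?_
  have hkp' : φ (redCoord k p) = P p * Q k - P k * Q p := by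
    rcases hkp.eq_or_lt with rfl | hkp
    · rw [redCoord_self (by omega), map_zero]; ring
    · exact h _ _ hkp
  simp only [detRel, map_add, map_sub, map_mul]
  rw [hkp', h _ _ (by omega), h _ _ (by omega), h _ _ (by omega), h _ _ (by omega),
    h _ _ (by omega), h _ _ (by omega), h _ _ (by omega), h _ _ (by omega)]
  ring

/-- Here the larger label decides the order first, so `D_ij D_kl` leads, unlike in
`monicWith_plRel`. -/
theorem monicWith_plRel_redCoord {i j k l : ℕ} (hij : i < j) (hjk : j < k) (hkl : k < l)
    (hl : l < 7) (h : ¬ (k = 4 ∧ l = 6)) :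
    MonicWith MonomialOrder.lex (plRel redCoord i j k l)
      (Finsupp.single (redVar i j (by omega)) 1 + Finsupp.single (redVar k l (by omega)) 1) := by
  rw [plRel, add_comm (_ - _) _]
  refine MonicWith.add_supported (v := redVar i j (by omega))
    ((monicWith_redCoord _).mul (monicWith_redCoord _)) (by simp)
    (sub_mem (mul_mem ?_ ?_) (mul_mem ?_ ?_)) <;>
  exact redCoord_mem _ (by omega) (by omega) (by omega)

theorem redCoord_four_six : redCoord 4 6 = 0 := by
  rw [redCoord, plCoord, coeffN_reducedCoeff_eq_zero (by omega) (by omega), if_neg (by omega),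
    coeffN, dif_neg (by omega), sub_zero]

/-- The product that would lead contains `D_46 = 0`; the next one enters with a negative sign. -/
theorem monicWith_neg_plRel_redCoord {i j : ℕ} (hij : i < j) (hj : j < 4) :
    MonicWith MonomialOrder.lex (-plRel redCoord i j 4 6)
      (Finsupp.single (redVar i 4 (by omega)) 1 + Finsupp.single (redVar j 6 (by omega)) 1) := by
  rw [plRel, redCoord_four_six, mul_zero, add_zero, neg_sub, sub_eq_add_neg]
  refine MonicWith.add_supported (v := redVar i 4 (by omega))
    ((monicWith_redCoord _).mul (monicWith_redCoord _)) (by simp) (neg_mem (mul_mem ?_ ?_)) <;>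
  exact redCoord_mem _ (by omega) (by omega) (by omega)

theorem monicWith_detRel_redCoord {i j k p q r : ℕ} (hij : i < j) (hjk : j < k) (hkp : k ≤ p)
    (hpq : p < q) (hqr : q < r) (hr : r < 7) (h : ¬ (r = 6 ∧ (p = 4 ∨ q = 4))) :
    MonicWith MonomialOrder.lex (detRel redCoord i j k p q r)
      (Finsupp.single (redVar i p (by omega)) 1 + (Finsupp.single (redVar j q (by omega)) 1 +
        Finsupp.single (redVar k r (by omega)) 1)) := by
  refine MonicWith.add_supported (v := redVar i p (by omega))
    ((monicWith_redCoord _).mul ?_) (by simp) (sub_mem (mul_mem ?_ (sub_mem (mul_mem ?_ ?_)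
      (mul_mem ?_ ?_))) (mul_mem ?_ (sub_mem (mul_mem ?_ ?_) (mul_mem ?_ ?_))))
  · rw [sub_eq_add_neg]
    refine MonicWith.add_supported (v := redVar j q (by omega))
      ((monicWith_redCoord _).mul (monicWith_redCoord _)) (by simp) (neg_mem (mul_mem ?_ ?_)) <;>
    exact redCoord_mem _ (by omega) (by omega) (by omega)
  all_goals exact redCoord_mem _ (by omega) (by omega) (by omega)

/-! ### Finite combinatorics of the leading exponents -/

/-- The leading exponents for `K_6` with `a_{54} = 0`, as lists of codes of coefficients. -/
def leadList : List (List ℕ) :=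
  ((List.range 7).flatMap fun l => (List.range l).flatMap fun k => (List.range k).flatMap fun j =>
    (List.range j).map fun i =>
      if k = 4 ∧ l = 6 then [7 * i + 4, 7 * j + 6] else [7 * i + j, 7 * k + l]) ++
  ((List.range 7).flatMap fun r => (List.range r).flatMap fun q => (List.range q).flatMap fun p =>
    -- In these cases the diagonal contains `D_46 = 0` or is a multiple of `D_i4 D_k6` or `D_j4
    -- D_k6`, already a quadratic leading monomial.
    if r = 6 ∧ (p = 4 ∨ q = 4) then [] else
      (List.range (p + 1)).flatMap fun k => (List.range k).flatMap fun j =>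
        (List.range j).map fun i => [7 * i + p, 7 * j + q, 7 * k + r])

/-- The codes of the coefficients, in an order suitable for counting with `leadList`. -/
def leadVerts : List ℕ :=
  [41, 2, 25, 1, 27, 18, 9, 26, 33, 3, 4, 11, 20, 10, 19, 13, 17, 12, 6, 5]

/-- The codes of the coefficients, in an order suitable for counting with `nestList`. -/
def nestVerts : List ℕ :=
  [41, 9, 25, 1, 33, 2, 27, 17, 4, 5, 20, 3, 18, 11, 10, 13, 12, 26, 6, 19]

/-- The position of a label in the order `6, 4, 0, 1, 2, 3, 5`. -/
def labelPos (k : ℕ) : Fin 7 := [2, 3, 4, 5, 1, 6, 0].getD k 0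

/-- The ordered pair of positions of the two labels of a coefficient. -/
def posPair (x : ℕ) : Fin 7 × Fin 7 :=
  (min (labelPos (x / 7)) (labelPos (x % 7)), max (labelPos (x / 7)) (labelPos (x % 7)))

/-- The nested pairs with respect to the order `6, 4, 0, 1, 2, 3, 5` of the labels. -/
def nestList : List (List ℕ) :=
  nestVerts.flatMap fun x => (nestVerts.filter fun y =>
    (posPair x).1 < (posPair y).1 ∧ (posPair y).2 < (posPair x).2).map fun y => [x, y]

/-- The members of a list of sets with their elements in the order of `vs`. -/
def arrange (vs : List ℕ) (G : List (List ℕ)) : List (List ℕ) :=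
  G.map fun g => vs.filter fun x => x ∈ g

theorem isFace_arrange {vs : List ℕ} {G : List (List ℕ)} (h : ∀ g ∈ G, ∀ x ∈ g, x ∈ vs)
    (F : Finset ℕ) : IsFace (arrange vs G) F ↔ IsFace G F := by
  unfold IsFace arrange
  rw [List.forall_mem_map]
  refine forall₂_congr fun g hg => not_congr ?_
  simp only [List.mem_filter, decide_eq_true_eq]
  exact ⟨fun h' x hx => h' x ⟨h g hg x hx, hx⟩, fun h' x hx => h' x hx.2⟩

theorem sublist_of_mem_arrange {vs : List ℕ} {G : List (List ℕ)} :
    ∀ g ∈ arrange vs G, g.Sublist vs := by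
  intro g hg
  obtain ⟨g, -, rfl⟩ := List.mem_map.1 hg
  exact List.filter_sublist

-- The computational core: the two complexes have the same face numbers, hence equally many
-- monomials of each degree. This takes the place of reducing S-polynomials.
set_option maxRecDepth 100000 in
theorem faceCount_leadList_eq : faceCount leadVerts (arrange leadVerts leadList) =
    faceCount nestVerts (arrange nestVerts nestList) := by
  decide +kernel

theorem leadList_subset : ∀ g ∈ leadList, ∀ x ∈ g, x ∈ leadVerts := by decide +kernel

theorem nestList_subset : ∀ g ∈ nestList, ∀ x ∈ g, x ∈ nestVerts := by decide +kernel

theorem leadList_antichain : ∀ g ∈ leadList, ∀ h ∈ leadList, (∀ x ∈ h, x ∈ g) → h = g := by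
  decide +kernel

theorem toFinset_leadVerts : leadVerts.toFinset = Finset.univ.map redCode := by
  have h1 : ∀ x ∈ leadVerts, x / 7 < x % 7 ∧ x % 7 < 7 ∧ ¬ (x / 7 = 4 ∧ x % 7 = 6) := by
    decide +kernel
  have h2 : ∀ b < 7, ∀ a < b, ¬ (a = 4 ∧ b = 6) → 7 * a + b ∈ leadVerts := by
    decide +kernel
  ext x
  rw [List.mem_toFinset, Finset.mem_map]
  constructor
  · intro hx
    refine ⟨redVar (x / 7) (x % 7) (h1 x hx), Finset.mem_univ _, ?_⟩
    rw [redCode_redVar]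
    omega
  · rintro ⟨v, -, rfl⟩
    obtain ⟨a, b, h, rfl⟩ := exists_eq_redVar v
    rw [redCode_redVar]
    exact h2 b h.2.1 a h.1 h.2.2

theorem toFinset_nestVerts : nestVerts.toFinset = Finset.univ.map redCode := by
  rw [← toFinset_leadVerts]
  decide +kernel

/-- The indicator function of a set of coefficients. -/
noncomputable def expOf (g : List ℕ) : RedIdx →₀ ℕ :=
  Finsupp.equivFunOnFinite.symm fun v => if redCode v ∈ g then 1 else 0

theorem expOf_apply (g : List ℕ) (v : RedIdx) : expOf g v = if redCode v ∈ g then 1 else 0 := rfl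

theorem expOf_nil : expOf [] = 0 := by
  ext v
  simp [expOf_apply]

theorem expOf_cons {v : RedIdx} {g : List ℕ} (h : redCode v ∉ g) :
    expOf (redCode v :: g) = Finsupp.single v 1 + expOf g := by
  ext u
  rw [Finsupp.add_apply, expOf_apply, expOf_apply, Finsupp.single_apply]
  by_cases huv : v = u
  · subst huv
    simp [h]
  · have : redCode u ≠ redCode v := fun h => huv (redCode.injective h).symm
    simp [huv, this]

theorem expOf_le_iff {g : List ℕ} (hg : ∀ x ∈ g, x ∈ leadVerts) {c : RedIdx →₀ ℕ} :
    expOf g ≤ c ↔ ∀ x ∈ g, x ∈ c.support.map redCode := by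
  constructor
  · intro h x hx
    have : x ∈ Finset.univ.map redCode := by
      rw [← toFinset_leadVerts]
      exact List.mem_toFinset.2 (hg x hx)
    obtain ⟨v, -, rfl⟩ := Finset.mem_map.1 this
    refine Finset.mem_map_of_mem _ (Finsupp.mem_support_iff.2 ?_)
    have h1 := h v
    rw [expOf_apply, if_pos hx] at h1
    omega
  · intro h v
    rw [expOf_apply]
    split_ifs with hv
    · have := (Finset.mem_map' redCode).1 (h _ hv)
      exact Nat.one_le_iff_ne_zero.2 (Finsupp.mem_support_iff.1 this)
    · exact Nat.zero_le _

theorem expOf_le_expOf {g h : List ℕ} (hh : h ∈ leadList) (hle : expOf h ≤ expOf g) :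
    ∀ x ∈ h, x ∈ g := by
  intro x hx
  obtain ⟨v, hv, rfl⟩ := Finset.mem_map.1 ((expOf_le_iff (leadList_subset h hh)).1 hle x hx)
  rw [Finsupp.mem_support_iff, expOf_apply] at hv
  by_contra h'
  exact hv (if_neg h')

theorem exists_monicWith_expOf {g : List ℕ} (hg : g ∈ leadList) :
    ∃ f ∈ redIdeal, MonicWith MonomialOrder.lex f (expOf g) := by
  rw [leadList, List.mem_append] at hg
  rcases hg with hg | hg
  · simp only [List.mem_flatMap, List.mem_range, List.mem_map] at hg
    obtain ⟨l, hl, k, hkl, j, hjk, i, hij, rfl⟩ := hg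
    split_ifs with h
    · obtain ⟨rfl, rfl⟩ := h
      refine ⟨_, neg_mem (plRel_mem_redIdeal hij hjk hkl), ?_⟩
      rw [← redCode_redVar (a := i) (b := 4) (by omega),
        ← redCode_redVar (a := j) (b := 6) (by omega), expOf_cons, expOf_cons (by simp), expOf_nil,
        add_zero]
      · exact monicWith_neg_plRel_redCoord hij hjk
      · rw [List.mem_singleton, redCode_redVar, redCode_redVar]
        omega
    · refine ⟨_, plRel_mem_redIdeal hij hjk hkl, ?_⟩
      rw [← redCode_redVar (a := i) (b := j) (by omega),
        ← redCode_redVar (a := k) (b := l) (by omega), expOf_cons, expOf_cons (by simp), expOf_nil,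
        add_zero]
      · exact monicWith_plRel_redCoord hij hjk hkl hl h
      · rw [List.mem_singleton, redCode_redVar, redCode_redVar]
        omega
  · simp only [List.mem_flatMap, List.mem_range] at hg
    obtain ⟨r, hr, q, hqr, p, hpq, hg⟩ := hg
    split_ifs at hg with h
    · exact absurd hg List.not_mem_nil
    simp only [List.mem_flatMap, List.mem_range, List.mem_map] at hg
    obtain ⟨k, hkp, j, hjk, i, hij, rfl⟩ := hg
    refine ⟨_, detRel_mem_redIdeal hij hjk (Nat.lt_succ_iff.1 hkp) hpq hqr, ?_⟩
    rw [← redCode_redVar (a := i) (b := p) (by omega),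
      ← redCode_redVar (a := j) (b := q) (by omega),
      ← redCode_redVar (a := k) (b := r) (by omega), expOf_cons, expOf_cons,
      expOf_cons (by simp), expOf_nil, add_zero]
    · exact monicWith_detRel_redCoord hij hjk (Nat.lt_succ_iff.1 hkp) hpq hqr hr h
    · rw [List.mem_singleton, redCode_redVar, redCode_redVar]
      omega
    · simp only [List.mem_cons, List.not_mem_nil, or_false, redCode_redVar]
      omega

/-! ### Evaluation at the generic Bezoutian with `Q_4 = Q_6 = 0` -/

/-- The value of a Plücker coordinate, `P_x Q_y - P_y Q_x` with `Q_0 = Q_1 = 0`. -/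
noncomputable def posMinor (x y : Fin 7) : MvPolynomial (Fin 7 ⊕ₗ Fin 7) ℂ :=
  X (toLex (Sum.inl x)) * (if y < 2 then 0 else X (toLex (Sum.inr y))) -
    X (toLex (Sum.inl y)) * (if x < 2 then 0 else X (toLex (Sum.inr x)))

/-- The labels `6` and `4` occupy the positions `0` and `1`, so the only pair without a leading term
`P_x Q_y` is the one of the missing coordinate `D_46`. -/
theorem monicWith_posMinor {x y : Fin 7} (h : x < y) (hy : ¬ y < 2) :
    MonicWith MonomialOrder.lex (posMinor x y)
      (Finsupp.single (toLex (Sum.inl x)) 1 + Finsupp.single (toLex (Sum.inr y)) 1) := by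
  rw [posMinor, if_neg hy, sub_eq_add_neg]
  refine MonicWith.add_supported (v := toLex (Sum.inl x)) ((monicWith_X _).mul (monicWith_X _))
    (by simp) (neg_mem (mul_mem (X_mem_supported.2 ?_) ?_))
  · exact Sum.Lex.inl_lt_inl_iff.2 h
  · split_ifs
    · exact zero_mem _
    · exact X_mem_supported.2 (Sum.Lex.inl_lt_inr _ _)

/-- The generic polynomial `P`. -/
noncomputable def posP : ℕ → MvPolynomial (Fin 7 ⊕ₗ Fin 7) ℂ :=
  lowCoeff fun k : Fin 7 => X (toLex (Sum.inl (labelPos k)))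

/-- The generic polynomial `Q` with `Q_4 = Q_6 = 0`. -/
noncomputable def posQ : ℕ → MvPolynomial (Fin 7 ⊕ₗ Fin 7) ℂ :=
  lowCoeff fun k : Fin 7 => if labelPos k < 2 then 0 else X (toLex (Sum.inr (labelPos k)))

/-- The generic Bezoutian of polynomials `P`, `Q` with `Q_4 = Q_6 = 0`. -/
noncomputable def posEval : MvPolynomial RedIdx ℂ →ₐ[ℂ] MvPolynomial (Fin 7 ⊕ₗ Fin 7) ℂ :=
  aeval fun v => bezCoeff 5 posP posQ v

theorem posP_of_lt {k : ℕ} (hk : 6 < k) : posP k = 0 := lowCoeff_of_le _ hk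

theorem posQ_of_lt {k : ℕ} (hk : 6 < k) : posQ k = 0 := lowCoeff_of_le _ hk

theorem posQ_four : posQ 4 = 0 := (lowCoeff_val _ (4 : Fin 7)).trans (if_pos (by decide))

theorem posQ_six : posQ 6 = 0 := (lowCoeff_val _ (6 : Fin 7)).trans (if_pos (by decide))

theorem posEval_redCoord {a b : ℕ} (hab : a < b) (hb : b < 7) :
    posEval (redCoord a b) = posMinor (labelPos b) (labelPos a) := by
  have h0 : ∀ u, posEval (reducedCoeff 5 (idx (Fin.last 5) 4) u) = bezCoeff 5 posP posQ u := by
    intro u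
    unfold reducedCoeff
    split_ifs with h
    · have h1 : max (Fin.last 5) (4 : Fin 6) = Fin.last 5 := by decide
      have h2 : min (Fin.last 5) (4 : Fin 6) = 4 := by decide
      rw [h, map_zero]
      simp only [bezCoeff, idx, ofLex_toLex, h1, h2, bez]
      symm
      -- The value belonging to the omitted coefficient must be zero. Only the summand `P_6 Q_4 -
      -- P_4 Q_6` is within the degrees, and both entries of `Q` vanish.
      refine Finset.sum_eq_zero fun k _ => ?_
      rcases k with _ | k
      · change posP 6 * posQ 4 - posP 4 * posQ 6 = 0
        rw [posQ_four, posQ_six]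
        ring
      · have h3 : 6 < ((Fin.last 5 : Fin 6) : ℕ) + 1 + (k + 1) := by
          rw [Fin.val_last]
          omega
        rw [posP_of_lt h3, posQ_of_lt h3]
        ring
    · exact aeval_X _ _
  rw [redCoord, map_plCoord]
  simp only [h0]
  rw [plCoord_bezCoeff (fun k hk => posP_of_lt hk) (fun k hk => posQ_of_lt hk) hab]
  have hP : ∀ k < 7, posP k = X (toLex (Sum.inl (labelPos k))) := fun k hk =>
    lowCoeff_val _ (⟨k, hk⟩ : Fin 7)
  have hQ : ∀ k < 7, posQ k = if labelPos k < 2 then 0 else X (toLex (Sum.inr (labelPos k))) :=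
    fun k hk => lowCoeff_val _ (⟨k, hk⟩ : Fin 7)
  rw [hP a (by omega), hP b hb, hQ a (by omega), hQ b hb, posMinor]

/-- Where `P_6 ≠ 0` the Bezoutian can be normalized, and `P_6 Q_4 - Q_6 P_4 = 0` holds by the choice
of `Q`; density does the rest. -/
theorem posEval_eq_zero {f : MvPolynomial RedIdx ℂ} (hf : f ∈ redIdeal) : posEval f = 0 := by
  refine eq_zero_of_aeval_eq_zero_of_ne (H := X (toLex (Sum.inl (labelPos 6))))
    (X_ne_zero _) fun x hx => ?_
  rw [aeval_X] at hx
  rw [← aeval_bezCoeff_of_mem_reduced hf (p := fun k => aeval x (posP k))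
    (q := fun k => aeval x (posQ k)) (fun k hk => by rw [posP_of_lt hk, map_zero])
    (fun k hk => by rw [posQ_of_lt hk, map_zero]) ?_ ?_, posEval, ← AlgHom.comp_apply, comp_aeval]
  · simp only [map_bezCoeff]
  · have : posP 6 = X (toLex (Sum.inl (labelPos 6))) := lowCoeff_val _ (6 : Fin 7)
    change aeval x (posP 6) ≠ 0
    rwa [this, aeval_X]
  · change aeval x (posP 6) * aeval x (posQ 4) - aeval x (posQ 6) * aeval x (posP 4) = 0
    rw [posQ_four, posQ_six, map_zero]
    ring

/-- The Plücker coordinate of a coefficient, with the sign for which it has a monic value. -/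
noncomputable def signedCoord (v : RedIdx) : MvPolynomial RedIdx ℂ :=
  if labelPos (redCode v / 7) < labelPos (redCode v % 7) then
    -redCoord (redCode v / 7) (redCode v % 7)
  else redCoord (redCode v / 7) (redCode v % 7)

theorem signedCoord_isHomogeneous (v : RedIdx) : (signedCoord v).IsHomogeneous 1 := by
  unfold signedCoord
  split_ifs
  · exact (redCoord_isHomogeneous _ _).neg
  · exact redCoord_isHomogeneous _ _

theorem posPair_injective : Function.Injective fun v : RedIdx => posPair (redCode v) := by
  have h : ∀ x ∈ leadVerts, ∀ y ∈ leadVerts, posPair x = posPair y → x = y := by decide +kernel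
  have hv : ∀ v, redCode v ∈ leadVerts := fun v => by
    rw [← List.mem_toFinset, toFinset_leadVerts]
    exact Finset.mem_map_of_mem _ (Finset.mem_univ v)
  exact fun v w hvw => redCode.injective (h _ (hv v) _ (hv w) hvw)

theorem monicWith_posEval_signedCoord (v : RedIdx) :
    MonicWith MonomialOrder.lex (posEval (signedCoord v))
      (Finsupp.single (toLex (Sum.inl (posPair (redCode v)).1)) 1 +
        Finsupp.single (toLex (Sum.inr (posPair (redCode v)).2)) 1) := by
  have h1 : ∀ x ∈ leadVerts, x / 7 < x % 7 ∧ (posPair x).1 < (posPair x).2 ∧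
      ¬ (posPair x).2 < 2 := by decide +kernel
  have hv : redCode v ∈ leadVerts := by
    rw [← List.mem_toFinset, toFinset_leadVerts]
    exact Finset.mem_map_of_mem _ (Finset.mem_univ v)
  obtain ⟨h2, h3, h4⟩ := h1 _ hv
  have h5 : posEval (signedCoord v) =
      posMinor (posPair (redCode v)).1 (posPair (redCode v)).2 := by
    have h6 := posEval_redCoord h2 (Nat.mod_lt _ (by norm_num))
    unfold signedCoord posPair
    split_ifs with h
    · rw [map_neg, h6, min_eq_left h.le, max_eq_right h.le]
      unfold posMinor
      ring
    · rw [h6, min_eq_right (not_lt.1 h), max_eq_left (not_lt.1 h)]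
  rw [h5]
  exact monicWith_posMinor h3 h4

theorem nonNested_of_isFace {c : RedIdx →₀ ℕ} (h : IsFace nestList (c.support.map redCode)) :
    NonNested (c.mapDomain fun v => posPair (redCode v)) := by
  intro x hx y hy hxy
  obtain ⟨v, hv, rfl⟩ := mem_support_mapDomain.1 hx
  obtain ⟨w, hw, rfl⟩ := mem_support_mapDomain.1 hy
  by_contra! hlt
  have hmem : ∀ v, redCode v ∈ nestVerts := fun v => by
    rw [← List.mem_toFinset, toFinset_nestVerts]
    exact Finset.mem_map_of_mem _ (Finset.mem_univ v)
  refine h [redCode v, redCode w] ?_ ?_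
  · simp only [nestList, List.mem_flatMap, List.mem_map, List.mem_filter, decide_eq_true_eq]
    exact ⟨_, hmem v, _, ⟨hmem w, hxy, hlt⟩, rfl⟩
  · intro x hx
    simp only [List.mem_cons, List.not_mem_nil, or_false] at hx
    rcases hx with rfl | rfl
    · exact Finset.mem_map_of_mem _ hv
    · exact Finset.mem_map_of_mem _ hw

/-! ### Comparison of the counts and the Gröbner basis -/

open Classical in
theorem exists_le_degree_redIdeal :
    ∀ f ∈ redIdeal, f ≠ 0 → ∃ s ∈ (leadList.toFinset.image expOf : Finset (RedIdx →₀ ℕ)),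
      s ≤ MonomialOrder.lex.degree f := by
  have hS : ∀ c : RedIdx →₀ ℕ, (∀ s ∈ leadList.toFinset.image expOf, ¬ s ≤ c) ↔
      IsFace leadList (c.support.map redCode) := by
    intro c
    simp only [Finset.mem_image, List.mem_toFinset, forall_exists_index, and_imp,
      forall_apply_eq_imp_iff₂]
    exact forall₂_congr fun g hg => not_congr (expOf_le_iff (leadList_subset g hg))
  refine exists_le_degree_of_card_le (S := (leadList.toFinset.image expOf : Finset _)) ?_
    (fun f hf k => homogeneousComponent_mem_charIdealKReduced hf k) posEval
    (fun f hf => posEval_eq_zero hf)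
    (fun k => (Finset.univ.finsuppAntidiag k).filter fun c : RedIdx →₀ ℕ =>
      IsFace leadList (c.support.map redCode)) ?_ fun k => ?_
  · intro s hs
    obtain ⟨g, hg, rfl⟩ := Finset.mem_image.1 (Finset.mem_coe.1 hs)
    exact exists_monicWith_expOf (List.mem_toFinset.1 hg)
  · intro k c
    rw [Finset.mem_filter, Finset.mem_finsuppAntidiag, ← hS, Finsupp.degree_eq_sum]
    simp
  -- In degree `k` there are as many standard exponents as exponents without nested pairs, and the
  -- latter give products of signed coordinates with independent values under `posEval`.
  · have hcount := card_filter_isFace_eq redCode (vs := leadVerts) (vs' := nestVerts)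
      (by decide +kernel) (by decide +kernel) toFinset_leadVerts toFinset_nestVerts
      sublist_of_mem_arrange sublist_of_mem_arrange faceCount_leadList_eq k
    simp only [isFace_arrange leadList_subset, isFace_arrange nestList_subset] at hcount
    refine ⟨((Finset.univ.finsuppAntidiag k).filter fun c : RedIdx →₀ ℕ =>
      IsFace nestList (c.support.map redCode) : Finset _), inferInstance,
      fun c => ∏ v, signedCoord v ^ c.1 v, fun c => ?_, ?_, ?_⟩
    · have h1 := (Finset.mem_finsuppAntidiag.1 (Finset.mem_filter.1 c.2).1).1
      have h2 : (∏ v, signedCoord v ^ c.1 v).IsHomogeneous (∑ v, c.1 v) :=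
        IsHomogeneous.prod _ _ _ fun v _ => by
          simpa using (signedCoord_isHomogeneous v).pow (c.1 v)
      rwa [h1] at h2
    · have hind := linearIndependent_prod_of_nonNested posPair_injective
        monicWith_posEval_signedCoord
      have := hind.comp (fun c : ((Finset.univ.finsuppAntidiag k).filter fun c : RedIdx →₀ ℕ =>
        IsFace nestList (c.support.map redCode) : Finset _) =>
          ⟨c.1, nonNested_of_isFace (Finset.mem_filter.1 c.2).2⟩)
        fun c c' h => by
          have h' := congrArg (fun z => z.1) h
          exact Subtype.ext h'
      simpa only [Function.comp_def, map_prod, map_pow] using this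
    · rw [Fintype.card_coe, hcount]

/-- The reduced Gröbner basis of the reduced characteristic ideal of `K_6`. -/
theorem exists_isReducedGroebnerBasis_charIdealKReduced :
    ∃ G : Finset (MvPolynomial {v : CoeffIdx 5 // v ≠ idx (5 : Fin 6) 4} ℂ),
      G.card = 48 ∧
      Ideal.span (G : Set (MvPolynomial {v : CoeffIdx 5 // v ≠ idx (5 : Fin 6) 4} ℂ)) =
        charIdealKReduced 5 (idx 5 4) ∧
      IsReducedGroebnerBasis MonomialOrder.lex (charIdealKReduced 5 (idx 5 4)) (G : Set _) := by
  classical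
  have hinj : Set.InjOn expOf (leadList.toFinset : Set (List ℕ)) := by
    intro g hg h hh hgh
    have hg' := List.mem_toFinset.1 (Finset.mem_coe.1 hg)
    have hh' := List.mem_toFinset.1 (Finset.mem_coe.1 hh)
    exact leadList_antichain h hh' g hg' (expOf_le_expOf hg' hgh.le)
  have hcard : (leadList.toFinset.image expOf).card = 48 := by
    rw [Finset.card_image_of_injOn hinj]
    decide +kernel
  have key := exists_isReducedGroebnerBasis (I := redIdeal) (m := MonomialOrder.lex)
    (leadList.toFinset.image expOf) ?_ ?_ exists_le_degree_redIdeal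
  · rw [hcard] at key
    exact key
  · intro s hs t ht hts
    obtain ⟨g, hg, rfl⟩ := Finset.mem_image.1 hs
    obtain ⟨h, hh, rfl⟩ := Finset.mem_image.1 ht
    rw [leadList_antichain g (List.mem_toFinset.1 hg) h (List.mem_toFinset.1 hh)
      (expOf_le_expOf (List.mem_toFinset.1 hh) hts)]
  · intro s hs
    obtain ⟨g, hg, rfl⟩ := Finset.mem_image.1 hs
    exact exists_monicWith_expOf (List.mem_toFinset.1 hg)

end KSix

end PolyGraph
theorem mainTheorem9 :
    -- the characteristic ideals of `K_3`, `K_4`, `K_5`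
    PolyGraph.charIdealK 2 = Ideal.span (PolyGraph.gensK3 PolyGraph.coeffVar) ∧
    PolyGraph.charIdealK 3 = Ideal.span (PolyGraph.gensK4 PolyGraph.coeffVar) ∧
    PolyGraph.charIdealK 4 = Ideal.span (PolyGraph.gensK5 PolyGraph.coeffVar) ∧
    -- for `K_6` with `a_{54} = 0`: the 48 generators of the reduced Gröbner basis for the
    -- lexicographic order with `a_{00} > a_{10} > a_{11} > a_{20} > ⋯ > a_{55}`
    (∃ G : Finset (MvPolynomial
        {v : PolyGraph.CoeffIdx 5 // v ≠ PolyGraph.idx (5 : Fin 6) 4} ℂ),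
      G.card = 48 ∧
      Ideal.span (G : Set (MvPolynomial
        {v : PolyGraph.CoeffIdx 5 // v ≠ PolyGraph.idx (5 : Fin 6) 4} ℂ)) =
          PolyGraph.charIdealKReduced 5 (PolyGraph.idx 5 4) ∧
      PolyGraph.IsReducedGroebnerBasis MonomialOrder.lex
        (PolyGraph.charIdealKReduced 5 (PolyGraph.idx 5 4)) (G : Set _)) ∧
    -- the systems in the elementary symmetric functions
    PolyGraph.ReducesTo PolyGraph.systemK3 (-1 + PolyGraph.s 1) ∧
    PolyGraph.ReducesTo PolyGraph.systemK4 (PolyGraph.s 1) ∧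
    PolyGraph.ReducesTo PolyGraph.systemK5 (-1 + PolyGraph.s 1) ∧
    PolyGraph.ReducesTo PolyGraph.systemK6 (PolyGraph.s 1) ∧
    -- the conjecture for `K_3`, `K_4`, `K_5`, `K_6`
    PolyGraph.ConjectureFor 2 (⊤ : SimpleGraph (Fin 3)) ∧
    PolyGraph.ConjectureFor 3 (⊤ : SimpleGraph (Fin 4)) ∧
    PolyGraph.ConjectureFor 4 (⊤ : SimpleGraph (Fin 5)) ∧
    PolyGraph.ConjectureFor 5 (⊤ : SimpleGraph (Fin 6)) := by
  refine ⟨PolyGraph.charIdealK_two, PolyGraph.charIdealK_three, PolyGraph.charIdealK_four,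
    PolyGraph.exists_isReducedGroebnerBasis_charIdealKReduced, ?_, ?_, ?_, ?_,
    PolyGraph.conjectureFor_top (by norm_num), PolyGraph.conjectureFor_top (by norm_num),
    PolyGraph.conjectureFor_top (by norm_num), PolyGraph.conjectureFor_top (by norm_num)⟩
  · have h := PolyGraph.reducesTo_of_eq_bezSystem (by norm_num) PolyGraph.systemK3_eq (-1)
    rwa [map_neg, map_one] at h
  · have h := PolyGraph.reducesTo_of_eq_bezSystem (by norm_num) PolyGraph.systemK4_eq 0
    rwa [map_zero, zero_add] at h
  · have h := PolyGraph.reducesTo_of_eq_bezSystem (by norm_num) PolyGraph.systemK5_eq (-1)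
    rwa [map_neg, map_one] at h
  · have h := PolyGraph.reducesTo_of_eq_bezSystem (by norm_num) PolyGraph.systemK6_eq 0
    rwa [map_zero, zero_add] at h
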